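/- **Conventions.** Let $\Bbbk$ be a complete normed field of characteristic $0$ (e.g. $\mathbb C$), $q\in\Bbbk$ with $|q|<1$, $\mathbf c=(c_1,c_2,\dots)$ a sequence in $\Bbbk$ with $\sum_i|c_i|<\infty$, and $t\in\Bbbk$. Put $$M(q,t,\mathbf c,z)=\prod_{k\ge0}\prod_{i\ge1}\frac{1-tzq^kc_i}{1-zq^kc_i}=\sum_{j\ge0}M_j\,z^j\in\Bbbk[[z]].$$ For a partition $\mu$ of $n$ let $\mathrm{cyc}(\mu)\subset S_n$ be the class of permutations of cycle type $\mu$ and $\ell^*(\mu)=n-\ell(\mu)$ the colength. *Combinatorial numbers.* For partitions $\mu,\nu$ of $n$ and $\lambda$ of $d$, let $m^\lambda_{\mu\nu}$ be the number of sequences $h,(a_1b_1)h,\dots,(a_db_d)\cdots(a_1b_1)h$ with $a_i<b_i$, $b_1\le\dots\le b_d$, starting in $\mathrm{cyc}(\mu)$, ending in $\mathrm{cyc}(\nu)$, in which the multiplicities of the distinct $b_i$ are the parts of $\lambda$. Put $$F^d_{M(q,t,\mathbf c)}(\mu,\nu)=\frac1{n!}\sum_{|\lambda|=d}\Big(\prod_iM_{\lambda_i}\Big)m^\lambda_{\mu\nu}.$$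 *Geometric numbers.* $H(\mu^{(1)},\dots,\mu^{(k)})$ is the number of isomorphism classes of (not necessarily connected) $n$-sheeted coverings of the sphere with ramification profiles $\mu^{(1)},\dots,\mu^{(k)}$ over $k$ given points, each weighted by $1/|\mathrm{Aut}|$; a covering is described by its monodromy $(g_1,\dots,g_k)$, $g_i\in\mathrm{cyc}(\mu^{(i)})$, $g_1\cdots g_k=1$, up to simultaneous conjugation in $S_n$. For profiles whose colengths are the parts of $\lambda$ (of length $k$, with $m_j(\lambda)$ parts equal to $j$), let $|\mathrm{aut}(\lambda)|=\prod_jm_j(\lambda)!$ and $$W_{E(q)}(\mu^{(1)},\dots,\mu^{(k)})=\frac1{|\mathrm{aut}(\lambda)|}\sum_{\sigma\in S_k}\ \sum_{0\le i_1<\dots<i_k}\ \prod_{u=1}^kq^{\,i_u\ell^*(\mu^{(\sigma(u))})},$$ $$W_{H(q)}(\nu^{(1)},\dots,\nu^{(k)})=\frac{(-1)^{|\lambda|-k}}{|\mathrm{aut}(\lambda)|}\sum_{\sigma\in S_k}\ \sum_{0\le i_1\le\dots\le i_k}\ \prod_{u=1}^kq^{\,i_u\ell^*(\nu^{(\sigma(u))})},$$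 both equal to $1$ for $k=0$. For $d,e\ge0$ put $$H^{(d,e)}_{(\mathbf c,q)}(\mu,\nu)=\sum m_\lambda(\mathbf c)\prod_{i=1}^lW_{E(q)}\big(\{\mu^{(i,u)}\}_{u\le k_i}\big)W_{H(q)}\big(\{\nu^{(i,v)}\}_{v\le\tilde k_i}\big)\;H\big(\{\mu^{(i,u)}\},\{\nu^{(i,v)}\},\mu,\nu\big),$$ where $m_\lambda$ is the monomial symmetric function and the sum is over all $l\ge0$ and all configurations of $l$ species, the $i$-th consisting of partitions $\mu^{(i,1)},\dots,\mu^{(i,k_i)}$ (class I) and $\nu^{(i,1)},\dots,\nu^{(i,\tilde k_i)}$ (class II) of $n$, all different from $(1^n)$, with $k_i,\tilde k_i\ge0$ and $k_i+\tilde k_i\ge1$, such that $\sum_{i,u}\ell^*(\mu^{(i,u)})=e$ and $\sum_id_i=d$, where $d_i=\sum_u\ell^*(\mu^{(i,u)})+\sum_v\ell^*(\nu^{(i,v)})$. The labelling is normalized: $\lambda=(d_1\ge\dots\ge d_l)$, and within each species and class the colengths are weakly decreasing. *$\tau$-function.* In two infinite sets of variables $\mathbf t,\mathbf s$, put $\tau^{M(q,t,\mathbf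 c,z)}(\mathbf t,\mathbf s)=\sum_\lambda r_\lambda\,s_\lambda(\mathbf t)s_\lambda(\mathbf s)$, summed over all partitions, where $r_\lambda=\prod_{(i,j)\in\lambda}M(q,t,\mathbf c,z(j-i))$, $s_\lambda(\mathbf t)=\det\big(h_{\lambda_i-i+j}(\mathbf t)\big)$, $\sum_kh_k(\mathbf t)\zeta^k=\exp\sum_{i\ge1}t_i\zeta^i$; and $p_\mu(\mathbf t)=\prod_i\mu_it_{\mu_i}$. **Theorem.** For every $t$ the product $M(q,t,\mathbf c,z)$ converges, coefficient by coefficient in $z$. For all $n,d\ge0$ and all partitions $\mu,\nu$ of $n$, the number $F^d_{M(q,t,\mathbf c)}(\mu,\nu)$ is a polynomial in $t$ of degree at most $d$, whose coefficient of $t^e$ is $(-1)^eH^{(d,e)}_{(\mathbf c,q)}(\mu,\nu)$ for every $e\ge 0$: $$F^d_{M(q,t,\mathbf c)}(\mu,\nu)=\sum_{e=0}^dH^{(d,e)}_{(\mathbf c,q)}(\mu,\nu)\,(-t)^e.$$ Hence, as formal power series in $z,\mathbf t,\mathbf s$, for every $t$, $$\tau^{M(q,t,\mathbf c,z)}(\mathbf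 t,\mathbf s)=\sum_{d\ge0}\sum_{e=0}^dz^d(-t)^e\sum_{|\mu|=|\nu|}H^{(d,e)}_{(\mathbf c,q)}(\mu,\nu)\,p_\mu(\mathbf t)\,p_\nu(\mathbf s).$$ -/

import Mathlib

open scoped PowerSeries Polynomial

namespace QuantumHurwitz

noncomputable section

/-! ### Partitions and symmetric functions -/

/-- The colength `ℓ*(μ) = |μ| - ℓ(μ)` of a partition `μ` of `n`. -/
def colength {n : ℕ} (μ : n.Partition) : ℕ := n - μ.parts.card

/-- `|aut(λ)| = ∏ⱼ mⱼ(λ)!`, where `mⱼ(λ)` is the multiplicity of `j` in the list `a` of the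
parts of `λ`. -/
def autOrder (a : List ℕ) : ℕ := ∏ j ∈ a.toFinset, (a.count j).factorial

/-- The monomial symmetric function
`m_λ(x) = |aut(λ)|⁻¹ ∑_{σ ∈ S_k} ∑_{i₁ < ⋯ < i_k} x_{i₁}^{λ_{σ(1)}} ⋯ x_{i_k}^{λ_{σ(k)}}`
at an infinite sequence of arguments; `a` lists the parts of `λ`. -/
def monomialSym {𝕜 : Type*} [NormedField 𝕜] (x : ℕ → 𝕜) (a : List ℕ) : 𝕜 :=
  (autOrder a : 𝕜)⁻¹ * ∑ σ : Equiv.Perm (Fin a.length),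
    ∑' i : {i : Fin a.length → ℕ // StrictMono i}, ∏ u, x (i.1 u) ^ a.get (σ u)

/-- The forgotten symmetric function
`f_λ(x) = (-1)^{ℓ*(λ)} |aut(λ)|⁻¹ ∑_{σ ∈ S_k} ∑_{i₁ ≤ ⋯ ≤ i_k}
  x_{i₁}^{λ_{σ(1)}} ⋯ x_{i_k}^{λ_{σ(k)}}`
at an infinite sequence of arguments; `a` lists the (positive) parts of `λ`. -/
def forgottenSym {𝕜 : Type*} [NormedField 𝕜] (x : ℕ → 𝕜) (a : List ℕ) : 𝕜 :=
  (-1) ^ (a.sum - a.length) * (autOrder a : 𝕜)⁻¹ * ∑ σ : Equiv.Perm (Fin a.length),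
    ∑' i : {i : Fin a.length → ℕ // Monotone i}, ∏ u, x (i.1 u) ^ a.get (σ u)

/-! ### The weight generating function -/

/-- The factor `(1 - t z q^k c_i) / (1 - z q^k c_i)`, a formal power series in `z`, for
`p = (k, i)`. -/
def macdonaldFactor {𝕜 : Type*} [NormedField 𝕜] (q t : 𝕜) (c : ℕ → 𝕜) (p : ℕ × ℕ) : 𝕜⟦X⟧ :=
  (1 - PowerSeries.C (t * q ^ p.1 * c p.2) * PowerSeries.X) *
    (1 - PowerSeries.C (q ^ p.1 * c p.2) * PowerSeries.X)⁻¹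

open scoped PowerSeries.WithPiTopology in
/-- Convergence of the double product over `k, i ≥ 0`, coefficient by coefficient in `z`. -/
def MacdonaldConverges {𝕜 : Type*} [NormedField 𝕜] (q t : 𝕜) (c : ℕ → 𝕜) : Prop :=
  Multipliable (macdonaldFactor q t c)

open scoped PowerSeries.WithPiTopology in
/-- `M(q,t,c,z) = ∏_k ∏_i (1 - t z q^k c_i) / (1 - z q^k c_i)` as a formal power series in `z`;
the product converges coefficient by coefficient. -/
def macdonaldWeight {𝕜 : Type*} [NormedField 𝕜] (q t : 𝕜) (c : ℕ → 𝕜) : 𝕜⟦X⟧ :=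
  ∏' p : ℕ × ℕ, macdonaldFactor q t c p

/-! ### Combinatorial weighted Hurwitz numbers -/

/-- `g` lies in the conjugacy class `cyc(μ)`: its cycle lengths, fixed points included, are the
parts of `μ`. -/
def InClass {n : ℕ} (μ : n.Partition) (g : Equiv.Perm (Fin n)) : Prop :=
  g.partition.parts = μ.parts

/-- The signature of a sequence of transpositions `(a₁ b₁), …, (a_d b_d)` with second elements
`b₁, …, b_d`: the multiset of the numbers of occurrences of the distinct second elements. -/
def signature {n d : ℕ} (b : Fin d → Fin n) : Multiset ℕ :=
  (Finset.univ.image b).val.map fun x => (Finset.univ.filter fun i => b i = x).card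

/-- A path `h → (a₁ b₁) h → ⋯ → (a_d b_d) ⋯ (a₁ b₁) h` in the Cayley graph of `S_n` generated by
the transpositions, with `a_i < b_i`, which is monotonic (`b₁ ≤ ⋯ ≤ b_d`), has signature `lam`,
starts in `cyc(μ)` and ends in `cyc(ν)`. -/
structure MonotonePath {n d : ℕ} (lam : d.Partition) (μ ν : n.Partition) where
  start : Equiv.Perm (Fin n)
  a : Fin d → Fin n
  b : Fin d → Fin n
  lt : ∀ i, a i < b i
  monotone : Monotone b
  signature_eq : signature b = lam.parts
  start_mem : InClass μ start
  end_mem : InClass ν ((List.ofFn fun i => Equiv.swap (a i) (b i)).reverse.prod * start)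

/-- `m^λ_{μν}`, the number of monotonic paths of signature `λ` from `cyc(μ)` to `cyc(ν)`. -/
def pathCount {n d : ℕ} (lam : d.Partition) (μ ν : n.Partition) : ℕ :=
  Nat.card (MonotonePath lam μ ν)

/-- The combinatorial weighted Hurwitz number
`F^d_G(μ,ν) = (1/n!) ∑_{|λ| = d} G_λ m^λ_{μν}`, `G_λ = ∏ᵢ G_{λᵢ}`, of a weight generating function
`G(z) = ∑ⱼ Gⱼ zʲ`. -/
def combinatorialHurwitz {𝕜 : Type*} [NormedField 𝕜] (G : 𝕜⟦X⟧) (d : ℕ) {n : ℕ}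
    (μ ν : n.Partition) : 𝕜 :=
  (n.factorial : 𝕜)⁻¹ * ∑ lam : d.Partition,
    (lam.parts.map fun j => PowerSeries.coeff j G).prod * (pathCount lam μ ν : 𝕜)

/-! ### Geometric Hurwitz numbers -/

/-- An `n`-sheeted covering of the sphere (not necessarily connected), branched at most over
`k` given points, with ramification profiles `L = [μ⁽¹⁾, …, μ⁽ᵏ⁾]`, together with a labelling of
the sheets over a base point, is given by its monodromy: permutations `g₁, …, g_k` of the sheets
with `g_i ∈ cyc(μ⁽ⁱ⁾)` and `g₁ ⋯ g_k = 1`. -/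
structure Monodromy {n : ℕ} (L : List n.Partition) where
  g : Fin L.length → Equiv.Perm (Fin n)
  profile : ∀ i, InClass (L.get i) (g i)
  prod_eq_one : (List.ofFn g).prod = 1

/-- Two coverings are isomorphic if and only if their monodromies differ by a relabelling of the
sheets. -/
def Monodromy.setoid {n : ℕ} (L : List n.Partition) : Setoid (Monodromy L) where
  r x y := ∃ s : Equiv.Perm (Fin n), ∀ i, s * x.g i * s⁻¹ = y.g i
  iseqv :=
    { refl := fun x => ⟨1, fun i => by simp⟩
      symm := by
        rintro x y ⟨s, hs⟩
        exact ⟨s⁻¹, fun i => by rw [← hs i]; group⟩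
      trans := by
        rintro x y z ⟨s, hs⟩ ⟨r, hr⟩
        exact ⟨r * s, fun i => by rw [← hr i, ← hs i]; group⟩ }

/-- The order of the automorphism group of a covering: the relabellings of the sheets that commute
with the monodromy. -/
def Monodromy.autCard {n : ℕ} {L : List n.Partition} (x : Monodromy L) : ℕ :=
  Nat.card {s : Equiv.Perm (Fin n) // ∀ i, s * x.g i * s⁻¹ = x.g i}

/-- The Hurwitz number `H(μ⁽¹⁾, …, μ⁽ᵏ⁾)`: the number of isomorphism classes of `n`-sheeted branched
coverings with the given ramification profiles, each weighted by the inverse of the order of its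
automorphism group. -/
def hurwitz {n : ℕ} (L : List n.Partition) : ℚ :=
  ∑ᶠ x : Quotient (Monodromy.setoid L), (x.out.autCard : ℚ)⁻¹

/-! ### Geometric quantum weighted Hurwitz numbers -/

/-- The branching profiles of one species (colour): those of class I, `μ^{(i,1)}, …, μ^{(i,k_i)}`,
and those of class II, `ν^{(i,1)}, …, ν^{(i,k̃_i)}`. -/
abbrev Species (n : ℕ) := List n.Partition × List n.Partition

/-- The total colength `d_i` of a species. -/
def Species.weight {n : ℕ} (S : Species n) : ℕ :=
  (S.1.map colength).sum + (S.2.map colength).sum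

/-- No profile is trivial, at least one profile occurs, and within each class the profiles are
labelled so that the colengths weakly decrease. -/
def Species.IsAdmissible {n : ℕ} (S : Species n) : Prop :=
  (∀ ρ ∈ S.1 ++ S.2, colength ρ ≠ 0) ∧ S.1 ++ S.2 ≠ [] ∧
    (S.1.map colength).Pairwise (· ≥ ·) ∧ (S.2.map colength).Pairwise (· ≥ ·)

/-- The configurations `{μ^{(i,u_i)}, ν^{(i,v_i)}}`, `i = 1, …, l`, with any number `l` of species,
labelled so that `d₁ ≥ ⋯ ≥ d_l`, of total colength `d`, whose class I profiles have total colength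
`e`. -/
def configurations (n d e : ℕ) : Set (List (Species n)) :=
  {A | (∀ S ∈ A, S.IsAdmissible) ∧ (A.map Species.weight).Pairwise (· ≥ ·) ∧
    (A.map fun S => (S.1.map colength).sum).sum = e ∧ (A.map Species.weight).sum = d}

/-- `W_{E(q)}(μ⁽¹⁾, …, μ⁽ᵏ⁾) = m_λ(1, q, q², …)`, where `λ` has the parts `ℓ*(μ⁽ⁱ⁾)`. -/
def weightE {𝕜 : Type*} [NormedField 𝕜] (q : 𝕜) {n : ℕ} (L : List n.Partition) : 𝕜 :=
  monomialSym (fun i => q ^ i) (L.map colength)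

/-- `W_{H(q)}(ν⁽¹⁾, …, ν⁽ᵏ⁾) = f_λ(1, q, q², …)`, where `λ` has the parts `ℓ*(ν⁽ⁱ⁾)`. -/
def weightH {𝕜 : Type*} [NormedField 𝕜] (q : 𝕜) {n : ℕ} (L : List n.Partition) : 𝕜 :=
  forgottenSym (fun i => q ^ i) (L.map colength)

/-- `W_{Q(q)}({μ^{(i,u_i)}, ν^{(i,v_i)}}, c)
  = m_λ(c) ∏ᵢ W_{E(q)}({μ^{(i,u_i)}}) W_{H(q)}({ν^{(i,v_i)}})`, where `λ` has the parts `d_i`. -/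
def weightQ {𝕜 : Type*} [NormedField 𝕜] (q : 𝕜) (c : ℕ → 𝕜) {n : ℕ} (A : List (Species n)) : 𝕜 :=
  (A.map fun S => weightE q S.1 * weightH q S.2).prod * monomialSym c (A.map Species.weight)

/-- The geometric quantum weighted Hurwitz number `H^{(d,e)}_{(c,q)}(μ,ν)`: the (finite) sum of
`W_{Q(q)}({μ^{(i,u_i)}, ν^{(i,v_i)}}, c) H({μ^{(i,u_i)}}, {ν^{(i,v_i)}}, μ, ν)` over all
configurations. -/
def geometricHurwitz {𝕜 : Type*} [NormedField 𝕜] (q : 𝕜) (c : ℕ → 𝕜) (d e : ℕ) {n : ℕ}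
    (μ ν : n.Partition) : 𝕜 :=
  ∑ᶠ A ∈ configurations n d e, weightQ q c A *
    (hurwitz (A.flatMap Prod.fst ++ A.flatMap Prod.snd ++ [μ, ν]) : 𝕜)

/-! ### The hypergeometric `τ`-function -/

/-- The row length `λ_{i+1}` of the Young diagram of `λ`, zero if `i ≥ ℓ(λ)`. -/
def row {n : ℕ} (lam : n.Partition) (i : ℕ) : ℕ := (lam.parts.sort (· ≥ ·)).getD i 0

/-- The complete symmetric functions in terms of the flow parameters `x₁, x₂, …` (`x i = pᵢ / i`),
`∑_k h_k(x) ζᵏ = exp (∑_{i ≥ 1} xᵢ ζⁱ)`, that is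
`h_k(x) = ∑_{|μ| = k} ∏ᵢ xᵢ^{mᵢ(μ)} / mᵢ(μ)!`, with `h_k = 0` for `k < 0`. -/
def completeSym {A : Type*} [CommRing A] [Algebra ℚ A] (x : ℕ → A) : ℤ → A
  | .ofNat k => ∑ μ : k.Partition, ∏ i ∈ μ.parts.toFinset,
      ((μ.parts.count i).factorial : ℚ)⁻¹ • x i ^ μ.parts.count i
  | .negSucc _ => 0

/-- The Schur function `s_λ(x) = det (h_{λᵢ - i + j}(x))` in terms of the flow parameters. -/
def schur {A : Type*} [CommRing A] [Algebra ℚ A] (x : ℕ → A) {n : ℕ} (lam : n.Partition) : A :=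
  Matrix.det (Matrix.of fun i j : Fin lam.parts.card =>
    completeSym x ((row lam i : ℤ) - (i : ℤ) + (j : ℤ)))

/-- The power sum product `p_μ = ∏ᵢ p_{μᵢ}`, with `pᵢ = i xᵢ` in terms of the flow parameters. -/
def powerSum {A : Type*} [CommRing A] (x : ℕ → A) {n : ℕ} (μ : n.Partition) : A :=
  (μ.parts.map fun k : ℕ => (k : A) * x k).prod

/-- The content product `r_λ^{G(z)} = ∏_{(i,j) ∈ λ} G(z (j - i))`. -/
def contentProduct {𝕜 : Type*} [NormedField 𝕜] (G : 𝕜⟦X⟧) {n : ℕ} (lam : n.Partition) : 𝕜⟦X⟧ :=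
  ∏ i ∈ Finset.range lam.parts.card, ∏ j ∈ Finset.range (row lam i),
    PowerSeries.rescale ((j : 𝕜) - (i : 𝕜)) G

/-- Formal power series over `𝕜⟦z⟧` in two infinite sequences of variables
`t₁, t₂, …` and `s₁, s₂, …` (the variables with index `0` are not used). -/
abbrev TauSeries (𝕜 : Type*) [NormedField 𝕜] := MvPowerSeries (ℕ ⊕ ℕ) 𝕜⟦X⟧

/-- The first sequence of flow parameters. -/
def tVar (𝕜 : Type*) [NormedField 𝕜] (i : ℕ) : TauSeries 𝕜 := MvPowerSeries.X (Sum.inl i)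

/-- The second sequence of flow parameters. -/
def sVar (𝕜 : Type*) [NormedField 𝕜] (i : ℕ) : TauSeries 𝕜 := MvPowerSeries.X (Sum.inr i)

/-- The sum of a family of formal power series in which each monomial occurs in finitely many
members. -/
def formalSum {ι σ R : Type*} [CommRing R] (f : ι → MvPowerSeries σ R) : MvPowerSeries σ R :=
  fun m => ∑ᶠ i, MvPowerSeries.coeff m (f i)

/-- `τ^{G(z)}(t,s) = ∑_λ r_λ^{G(z)} s_λ(t) s_λ(s)`, summed over all partitions `λ` of all integers
`n ≥ 0`. -/
def tau {𝕜 : Type*} [NormedField 𝕜] [CharZero 𝕜] (G : 𝕜⟦X⟧) : TauSeries 𝕜 :=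
  formalSum fun lam : (Σ n : ℕ, n.Partition) =>
    MvPowerSeries.C (contentProduct G lam.2) * schur (tVar 𝕜) lam.2 * schur (sVar 𝕜) lam.2

end

end QuantumHurwitz

open scoped PowerSeries Polynomial

namespace QuantumHurwitz

noncomputable section

/-! ### Cycle types, colourings and the standard embeddings of symmetric groups -/

open Equiv Finset

/-! Everything is read off from one central element of the group algebra of $S_n$: the coefficient
of $z^d$ in $\prod_b G(zX_b)$, where the $X_b=\sum_{a<b}(a\,b)$ are the commuting Jucys–Murphy
elements. If $G_0=1$, its expansion runs through the monotone sequences of transpositions, so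
$F^d_G(\mu,\nu)$ is $1/n!$ times the pairing of this element with the classes $\mu$ and $\nu$
(`combinatorialHurwitz_eq`).

Geometric side. By Jucys' theorem (`jucys`), $\prod_b(1+zX_b)$ is the generating function $C(z)$ of
the class sums by colength, so a linear factor $1-vz$ of $G$ contributes $C(-vz)$. Truncate the
product to $k,i<N$ and put $T(z)=\prod_{k<N}C(q^kz)$. Then $c_i$ contributes
$T(-tc_iz)\,T(-c_iz)^{-1}$. The expansion of $T$ has monomial symmetric functions of the $q^k$ as
coefficients (class I), that of $T^{-1}$ forgotten ones (class II). The product over $i$ is expanded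
by the same device, with whole species as letters, which yields $m_\lambda(\mathbf c)$. The
coefficient of the identity in a product of class sums counts monodromies, hence coverings
(`coeff_prod_classSum`, `factorial_mul_hurwitz`). This gives an exact identity for each $N$
(`classPairing_truncated`). For fixed $n,d$ it involves finitely many configurations and is
polynomial in finitely many coefficients of $G$, so $N\to\infty$ may be taken termwise.

The $\tau$-function. No representations are constructed: $\chi_l(g)$ is defined as the coefficient
of $x^l$ in the alternant times the power sum product of the cycle type of $g$. Multiplied by the
alternant, the cut-and-join identity (`sum_swap_colPoly`) becomes diagonal on monomials, so the sum
of all transpositions acts on $\chi_l$ by a scalar (`sum_swap_chi`). Along the branching rule these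
scalars differ by contents of boxes; therefore a symmetric polynomial in the $X_b$ acts on
$\chi_\lambda$ by its value at the contents of $\lambda$ (`chiLin_jmHom`). The bialternant formula
gives the orthogonality relations, and these give the Frobenius formula (`classPairing_jmHom`).
Since Schur functions are combinations of power sums with coefficients $\chi_\lambda$, the
coefficients of $\tau^G$ in the basis $p_\mu p_\nu$ are the same pairings as before (`tau_eq`). -/

/-- The product over the orbits of a permutation is the product over its cycle lengths. -/
theorem prod_orbits_eq {n : ℕ} {B : Type*} [CommMonoid B] (g : Perm (Fin n)) (F : ℕ → B)
    [Fintype (Quotient (Perm.SameCycle.setoid g))]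
    [∀ (w : Quotient (Perm.SameCycle.setoid g)) (j : Fin n),
      Decidable (Quotient.mk (Perm.SameCycle.setoid g) j = w)] :
    ∏ w : Quotient (Perm.SameCycle.setoid g),
      F (#{j : Fin n | Quotient.mk (Perm.SameCycle.setoid g) j = w}) =
    (g.partition.parts.map F).prod := by
  classical
  rw [Perm.parts_partition, Multiset.map_add, Multiset.prod_add, Multiset.map_replicate,
    Multiset.prod_replicate, Perm.cycleType_def, Multiset.map_map]
  have hmk : ∀ j k : Fin n, (Quotient.mk (Perm.SameCycle.setoid g) j =
      Quotient.mk (Perm.SameCycle.setoid g) k) ↔ g.SameCycle j k := fun j k => Quotient.eq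
  have key : ∀ w : Quotient (Perm.SameCycle.setoid g), g w.out ≠ w.out →
      (#{j : Fin n | Quotient.mk (Perm.SameCycle.setoid g) j = w}) =
        #(g.cycleOf w.out).support := by
    intro w hw
    congr 1
    ext j
    rw [mem_filter, Perm.mem_support_cycleOf_iff' hw, ← hmk, Quotient.out_eq]
    simp [eq_comm]
  have key1 : ∀ w : Quotient (Perm.SameCycle.setoid g), g w.out = w.out →
      (#{j : Fin n | Quotient.mk (Perm.SameCycle.setoid g) j = w}) = 1 := by
    intro w hw
    rw [card_eq_one]
    refine ⟨w.out, ?_⟩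
    ext j
    rw [mem_filter, mem_singleton]
    constructor
    · rintro ⟨-, h⟩
      rw [← Quotient.out_eq w, hmk] at h
      exact (Perm.SameCycle.eq_of_right h hw)
    · rintro rfl
      simp
  -- Orbits of moved points correspond to the cycle factors of `g`, the remaining orbits to its
  -- fixed points; `Perm.parts_partition` splits the cycle lengths in the same way.
  rw [← Finset.prod_filter_mul_prod_filter_not univ
    (fun w : Quotient (Perm.SameCycle.setoid g) => g w.out ≠ w.out)]
  congr 1
  · change _ = ∏ c ∈ g.cycleFactorsFinset, F (#c.support)
    refine Finset.prod_bij (fun w _ => g.cycleOf w.out) ?_ ?_ ?_ ?_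
    · intro w hw
      rw [Perm.cycleOf_mem_cycleFactorsFinset_iff, Perm.mem_support]
      exact (mem_filter.1 hw).2
    · intro w hw v hv h
      rw [← Quotient.out_eq w, ← Quotient.out_eq v, hmk]
      have := (Perm.mem_support_cycleOf_iff' (mem_filter.1 hw).2 (y := v.out)).1
      apply this
      rw [h, Perm.mem_support_cycleOf_iff' (mem_filter.1 hv).2]
    · intro c hc
      obtain ⟨j, hj⟩ := (Perm.mem_cycleFactorsFinset_iff.1 hc).1.nonempty_support
      have hcj := Perm.cycle_is_cycleOf hj hc
      refine ⟨Quotient.mk _ j, ?_, ?_⟩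
      · simp only [mem_filter, mem_univ, true_and]
        have h1 : g.SameCycle (Quotient.mk (Perm.SameCycle.setoid g) j).out j := by
          rw [← hmk, Quotient.out_eq]
        intro h2
        have := Perm.SameCycle.eq_of_left h1 h2
        rw [this] at h2
        have h3 := (Perm.mem_cycleFactorsFinset_support_le hc) hj
        exact Perm.mem_support.1 h3 h2
      · have h1 : g.SameCycle (Quotient.mk (Perm.SameCycle.setoid g) j).out j := by
          rw [← hmk, Quotient.out_eq]
        rw [hcj]
        exact h1.cycleOf_eq
    · intro w hw
      rw [key w (mem_filter.1 hw).2]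
  · rw [Finset.prod_congr rfl (g := fun _ => F 1), Finset.prod_const]
    · congr 1
      have : Fintype.card (Fin n) - #g.support = #(g.supportᶜ) := by
        rw [card_compl]
      rw [this]
      refine Finset.card_bij (fun w _ => w.out) ?_ ?_ ?_
      · intro w hw
        simpa using hw
      · intro w _ v _ h
        exact Quotient.out_injective h
      · intro j hj
        have hj' : g j = j := by simpa using hj
        have h1 : g.SameCycle (Quotient.mk (Perm.SameCycle.setoid g) j).out j := by
          rw [← hmk, Quotient.out_eq]
        have h2 := Perm.SameCycle.eq_of_right h1 hj'
        refine ⟨Quotient.mk _ j, ?_, h2⟩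
        simp [h2, hj']
    · intro w hw
      rw [key1 w (by simpa using hw)]

/-- The generating function of the colourings fixed by a permutation. -/
theorem sum_fixed_colourings {n : ℕ} {ι B : Type*} [Fintype ι] [DecidableEq ι] [CommSemiring B]
    (g : Perm (Fin n)) (y : ι → B) :
    ∑ f : Fin n → ι with (f ∘ g = f), ∏ j, y (f j) =
      (g.partition.parts.map fun k => ∑ i, y i ^ k).prod := by
  classical
  let Ω := Quotient (Perm.SameCycle.setoid g)
  let _ : Fintype Ω := Fintype.ofFinite _
  -- A fixed colouring is a free choice of one colour per orbit, and an orbit of size `k` and colour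
  -- `i` contributes `y i ^ k`.
  rw [← prod_orbits_eq g fun k => ∑ i, y i ^ k, Finset.prod_univ_sum, Fintype.piFinset_univ]
  symm
  refine Finset.sum_bij (fun (F : Ω → ι) _ => fun j => F (Quotient.mk _ j)) ?_ ?_ ?_ ?_
  · intro F _
    simp only [mem_filter, mem_univ, true_and]
    funext j
    simp only [Function.comp]
    congr 1
    exact Quotient.sound (Perm.sameCycle_apply_left.2 (Perm.SameCycle.refl _ _))
  · intro F _ F' _ h
    funext w
    rw [← Quotient.out_eq w]
    exact congrFun h w.out
  · intro f hf
    have hf' : ∀ j, f (g j) = f j := fun j => congrFun (mem_filter.1 hf).2 j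
    have hz : ∀ (m : ℕ) j, f ((g ^ m) j) = f j := by
      intro m
      induction m with
      | zero => intro j; rfl
      | succ m ih => intro j; rw [pow_succ', Perm.mul_apply, hf', ih]
    refine ⟨fun w => Quotient.lift f ?_ w, mem_univ _, ?_⟩
    · intro a b hab
      obtain ⟨m, -, hm⟩ := Perm.SameCycle.exists_pow_eq' (show g.SameCycle a b from hab)
      rw [← hm, hz]
    · funext j
      rfl
  · intro F _
    simp_rw [← Finset.prod_const]
    rw [← Finset.prod_fiberwise (univ : Finset (Fin n)) (fun j => Quotient.mk _ j : Fin n → Ω)]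
    refine Finset.prod_congr rfl fun w _ => Finset.prod_congr rfl fun j hj => ?_
    rw [(mem_filter.1 hj).2]

/-- The cycle type of a permutation of `Fin n` as a partition of `n`. -/
def cycleClass {n : ℕ} (g : Perm (Fin n)) : n.Partition where
  parts := g.partition.parts
  parts_pos := g.partition.parts_pos
  parts_sum := by rw [g.partition.parts_sum, Fintype.card_fin]

theorem inClass_iff {n : ℕ} (μ : n.Partition) (g : Perm (Fin n)) :
    InClass μ g ↔ cycleClass g = μ := by
  rw [InClass, Nat.Partition.ext_iff]
  rfl

theorem cycleClass_eq_iff {n : ℕ} (g h : Perm (Fin n)) :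
    cycleClass g = cycleClass h ↔ IsConj g h := by
  rw [Perm.partition_eq_of_isConj, Nat.Partition.ext_iff, Nat.Partition.ext_iff]
  rfl

theorem cycleClass_conj {n : ℕ} (s g : Perm (Fin n)) :
    cycleClass (s * g * s⁻¹) = cycleClass g := by
  rw [cycleClass_eq_iff, isConj_comm, isConj_iff]
  exact ⟨s, rfl⟩
theorem cycleClass_inv {n : ℕ} (g : Perm (Fin n)) : cycleClass g⁻¹ = cycleClass g := by
  rw [cycleClass_eq_iff]
  exact Perm.isConj_iff_cycleType_eq.2 (Perm.cycleType_inv g)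

/-- `Perm.cycleType` omits fixed points, so only the parts that are at least 2 are realized
directly; the number of parts equal to 1 is then forced by the sum being `n` (`h1`). -/
theorem cycleClass_surjective {n : ℕ} (μ : n.Partition) :
    ∃ g : Perm (Fin n), cycleClass g = μ := by
  have h := (Perm.exists_with_cycleType_iff (Fin n) (m := μ.parts.filter (2 ≤ ·))).2 ⟨?_, ?_⟩
  · obtain ⟨g, hg⟩ := h
    refine ⟨g, ?_⟩
    rw [Nat.Partition.ext_iff]
    have h1 : ∀ ρ : n.Partition,
        ρ.parts = ρ.parts.filter (2 ≤ ·) + Multiset.replicate (n - (ρ.parts.filter (2 ≤ ·)).sum) 1 := by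
      intro ρ
      have h2 := Multiset.filter_add_not (2 ≤ ·) ρ.parts
      have h3 : ρ.parts.filter (fun a => ¬ 2 ≤ a) =
          Multiset.replicate (ρ.parts.filter (fun a => ¬ 2 ≤ a)).card 1 := by
        rw [Multiset.eq_replicate_card]
        intro b hb
        rw [Multiset.mem_filter] at hb
        have := ρ.parts_pos hb.1
        omega
      have h4 : n = (ρ.parts.filter (2 ≤ ·)).sum + (ρ.parts.filter (fun a => ¬ 2 ≤ a)).card := by
        conv_lhs => rw [← ρ.parts_sum, ← h2, Multiset.sum_add]
        rw [h3]
        simp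
      conv_lhs => rw [← h2, h3]
      congr 2
      omega
    rw [h1 (cycleClass g), h1 μ]
    have h5 : (cycleClass g).parts.filter (2 ≤ ·) = μ.parts.filter (2 ≤ ·) := by
      rw [← hg]
      exact Perm.filter_parts_partition_eq_cycleType
    rw [h5]
  · rw [Fintype.card_fin]
    conv_rhs => rw [← μ.parts_sum, ← Multiset.filter_add_not (2 ≤ ·) μ.parts, Multiset.sum_add]
    omega
  · intro a ha
    exact (Multiset.mem_filter.1 ha).2

/-- The number of cycles, fixed points included. -/
def cycleCount {n : ℕ} (g : Perm (Fin n)) : ℕ := (cycleClass g).parts.card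

/-- This turns the counting of cycles into the counting of two-colourings, so that the effect of a
transposition on the number of cycles can be found without handling cycles. -/
theorem two_pow_cycleCount {n : ℕ} (g : Perm (Fin n)) :
    #{f : Fin n → Fin 2 | f ∘ g = f} = 2 ^ cycleCount g := by
  have := sum_fixed_colourings g (fun _ : Fin 2 => (1 : ℕ))
  simp only [prod_const_one, sum_const, smul_eq_mul, mul_one, one_pow, card_univ, Fintype.card_fin,
    Multiset.map_const', Multiset.prod_replicate] at this
  exact this

/-- The standard embedding `S_n → S_{n+1}` whose image fixes the last letter. -/
def permSucc (n : ℕ) : Perm (Fin n) →* Perm (Fin (n + 1)) :=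
  Perm.viaEmbeddingHom Fin.castSuccEmb

@[simp]
theorem permSucc_castSucc {n : ℕ} (g : Perm (Fin n)) (i : Fin n) :
    permSucc n g i.castSucc = (g i).castSucc :=
  Perm.viaEmbedding_apply g Fin.castSuccEmb i

@[simp]
theorem permSucc_last {n : ℕ} (g : Perm (Fin n)) : permSucc n g (Fin.last n) = Fin.last n := by
  refine Perm.viaEmbedding_apply_of_notMem g Fin.castSuccEmb _ ?_
  rintro ⟨i, hi⟩
  exact (Fin.castSucc_lt_last i).ne hi

theorem permSucc_swap {n : ℕ} (a b : Fin n) :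
    permSucc n (swap a b) = swap a.castSucc b.castSucc := by
  ext i
  refine Fin.lastCases ?_ (fun i => ?_) i
  · rw [permSucc_last, swap_apply_of_ne_of_ne (Fin.castSucc_lt_last a).ne'
      (Fin.castSucc_lt_last b).ne']
  · rw [permSucc_castSucc, (Fin.castSucc_injective n).swap_apply]

/-- Coset decomposition of `S_{n+1}` with respect to `S_n`. -/
def cosetEquiv (n : ℕ) : Fin (n + 1) × Perm (Fin n) ≃ Perm (Fin (n + 1)) :=
  Equiv.ofBijective (fun p => swap p.1 (Fin.last n) * permSucc n p.2) <| by
    rw [Fintype.bijective_iff_injective_and_card]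
    constructor
    · rintro ⟨x, g⟩ ⟨y, h⟩ hxy
      have h1 : x = y := by simpa using congrArg (fun p : Perm (Fin (n + 1)) => p (Fin.last n)) hxy
      subst h1
      have h2 : permSucc n g = permSucc n h := mul_left_cancel hxy
      rw [Perm.viaEmbeddingHom_injective _ h2]
    · simp [Fintype.card_perm, Nat.factorial_succ]

@[simp]
theorem cosetEquiv_apply {n : ℕ} (x : Fin (n + 1)) (g : Perm (Fin n)) :
    cosetEquiv n (x, g) = swap x (Fin.last n) * permSucc n g := rfl

theorem comp_permSucc_eq_iff {n : ℕ} {ι : Type*} (g : Perm (Fin n)) (f : Fin (n + 1) → ι) :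
    f ∘ permSucc n g = f ↔ (fun i => f (Fin.castSucc i)) ∘ g = fun i => f (Fin.castSucc i) := by
  constructor
  · intro h
    funext i
    simpa using congrFun h i.castSucc
  · intro h
    funext i
    refine Fin.lastCases ?_ (fun i => ?_) i
    · simp
    · simpa using congrFun h i

theorem comp_swap_permSucc_eq_iff {n : ℕ} {ι : Type*} (a : Fin n) (g : Perm (Fin n))
    (f : Fin (n + 1) → ι) :
    f ∘ (swap a.castSucc (Fin.last n) * permSucc n g : Perm (Fin (n + 1))) = f ↔
      f (Fin.last n) = f a.castSucc ∧
      (fun i => f (Fin.castSucc i)) ∘ g = fun i => f (Fin.castSucc i) := by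
  have key : f (Fin.last n) = f a.castSucc →
      f ∘ (swap a.castSucc (Fin.last n) : Perm (Fin (n + 1))) = f := by
    intro h
    funext i
    by_cases h1 : i = a.castSucc
    · subst h1; simp [h]
    · by_cases h2 : i = Fin.last n
      · subst h2; simp [h]
      · simp [swap_apply_of_ne_of_ne h1 h2]
  rw [Perm.coe_mul, ← Function.comp_assoc]
  constructor
  · intro h
    have h1 : f (Fin.last n) = f a.castSucc := by
      have := congrFun h (Fin.last n)
      simpa using this.symm
    rw [key h1, comp_permSucc_eq_iff] at h
    exact ⟨h1, h⟩
  · rintro ⟨h1, h2⟩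
    rw [key h1, comp_permSucc_eq_iff]
    exact h2

/-- The added fixed letter has a free colour, which doubles the number of fixed two-colourings. -/
theorem cycleCount_permSucc {n : ℕ} (g : Perm (Fin n)) :
    cycleCount (permSucc n g) = cycleCount g + 1 := by
  have h : 2 ^ cycleCount (permSucc n g) = 2 ^ (cycleCount g + 1) := by
    rw [← two_pow_cycleCount, pow_succ', ← two_pow_cycleCount]
    trans #((univ : Finset (Fin 2)) ×ˢ (univ : Finset (Fin n → Fin 2)).filter (fun f => f ∘ g = f))
    swap
    · rw [card_product]
      rfl
    symm
    refine card_equiv (Fin.snocEquiv fun _ : Fin (n + 1) => Fin 2) ?_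
    rintro ⟨x, f⟩
    simp [comp_permSucc_eq_iff, Fin.snocEquiv]
  exact Nat.pow_right_injective le_rfl h

/-- The last letter is inserted into the cycle of `a`: its colour is forced to be that of `a`, so
the number of fixed two-colourings is unchanged. -/
theorem cycleCount_swap_permSucc {n : ℕ} (a : Fin n) (g : Perm (Fin n)) :
    cycleCount (swap a.castSucc (Fin.last n) * permSucc n g) = cycleCount g := by
  have h : 2 ^ cycleCount (swap a.castSucc (Fin.last n) * permSucc n g) = 2 ^ (cycleCount g) := by
    rw [← two_pow_cycleCount, ← two_pow_cycleCount]
    symm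
    refine card_bij (fun f _ => Fin.snoc (α := fun _ => Fin 2) f (f a)) ?_ ?_ ?_
    · intro f hf
      simp only [mem_filter, mem_univ, true_and] at hf ⊢
      rw [comp_swap_permSucc_eq_iff]
      simp [hf]
    · intro f _ f' _ hff
      funext i
      simpa using congrFun hff i.castSucc
    · intro f hf
      simp only [mem_filter, mem_univ, true_and] at hf
      rw [comp_swap_permSucc_eq_iff] at hf
      refine ⟨fun i => f i.castSucc, by simpa using hf.2, ?_⟩
      funext i
      refine Fin.lastCases ?_ (fun i => ?_) i
      · simp [hf.1]
      · simp
  exact Nat.pow_right_injective le_rfl h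

theorem cycleCount_le {n : ℕ} (g : Perm (Fin n)) : cycleCount g ≤ n := by
  have h : (cycleClass g).parts.card • 1 ≤ (cycleClass g).parts.sum :=
    Multiset.card_nsmul_le_sum fun x hx => (cycleClass g).parts_pos hx
  rw [(cycleClass g).parts_sum] at h
  simpa [cycleCount] using h

theorem colength_cycleClass {n : ℕ} (g : Perm (Fin n)) :
    colength (cycleClass g) = n - cycleCount g := rfl

theorem colength_permSucc {n : ℕ} (g : Perm (Fin n)) :
    colength (cycleClass (permSucc n g)) = colength (cycleClass g) := by
  rw [colength_cycleClass, colength_cycleClass, cycleCount_permSucc]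
  omega

theorem colength_swap_permSucc {n : ℕ} (a : Fin n) (g : Perm (Fin n)) :
    colength (cycleClass (swap a.castSucc (Fin.last n) * permSucc n g)) =
      colength (cycleClass g) + 1 := by
  rw [colength_cycleClass, colength_cycleClass, cycleCount_swap_permSucc]
  have := cycleCount_le g
  omega
end

end QuantumHurwitz

open scoped PowerSeries Polynomial

namespace QuantumHurwitz

noncomputable section

/-! ### The group algebra, Jucys–Murphy elements and class sums -/

open Equiv Finset
open scoped IsMulCommutative

/-- The group algebra of the symmetric group `S_n`. -/
abbrev GroupAlg (R : Type*) [CommRing R] (n : ℕ) := MonoidAlgebra R (Perm (Fin n))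

section GroupAlgebra

variable {R : Type*} [CommRing R] {n : ℕ}

/-- The basis element of the group algebra given by a permutation. -/
abbrev perm (R : Type*) [CommRing R] {n : ℕ} (g : Perm (Fin n)) : GroupAlg R n :=
  MonoidAlgebra.of R (Perm (Fin n)) g

theorem eq_sum_perm (x : GroupAlg R n) : x = ∑ g, x.coeff g • perm R g := by
  ext h
  simp [MonoidAlgebra.coeff_sum]

/-- The linear functional on the group algebra extending a function on `S_n`. -/
def extendLin (χ : Perm (Fin n) → R) : GroupAlg R n →ₗ[R] R where
  toFun x := ∑ g, x.coeff g * χ g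
  map_add' x y := by simp [add_mul, sum_add_distrib]
  map_smul' r x := by simp [mul_sum, mul_assoc]

theorem extendLin_apply (χ : Perm (Fin n) → R) (x : GroupAlg R n) :
    extendLin χ x = ∑ g, x.coeff g * χ g := rfl

@[simp]
theorem extendLin_perm (χ : Perm (Fin n) → R) (g : Perm (Fin n)) :
    extendLin χ (perm R g) = χ g := by
  simp [extendLin_apply, Finsupp.single_apply]

theorem linearMap_ext_perm {M : Type*} [AddCommMonoid M] [Module R M] {f f' : GroupAlg R n →ₗ[R] M}
    (h : ∀ g, f (perm R g) = f' (perm R g)) : f = f' := by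
  refine LinearMap.ext fun x => ?_
  rw [eq_sum_perm x]
  simp only [map_sum, map_smul, h]

/-- Elements commuting with all permutations are central. -/
theorem commute_of_perm {x : GroupAlg R n} (h : ∀ g, perm R g * x = x * perm R g)
    (y : GroupAlg R n) : y * x = x * y := by
  rw [eq_sum_perm y, sum_mul, mul_sum]
  refine sum_congr rfl fun g _ => ?_
  rw [smul_mul_assoc, mul_smul_comm, h]

/-- The Jucys–Murphy element `∑_{a < b} (a b)`. -/
def jm (R : Type*) [CommRing R] {n : ℕ} (b : Fin n) : GroupAlg R n :=
  ∑ a with a < b, perm R (swap a b)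

/-- The sum of the elements of a conjugacy class. -/
def classSum (R : Type*) [CommRing R] {n : ℕ} (ρ : n.Partition) : GroupAlg R n :=
  ∑ g with cycleClass g = ρ, perm R g

/-- The embedding of group algebras induced by `S_n → S_{n+1}`. -/
def algSucc (R : Type*) [CommRing R] (n : ℕ) : GroupAlg R n →ₐ[R] GroupAlg R (n + 1) :=
  MonoidAlgebra.mapDomainAlgHom R R (permSucc n)

@[simp]
theorem algSucc_perm (g : Perm (Fin n)) : algSucc R n (perm R g) = perm R (permSucc n g) := by
  simp [algSucc]

theorem jm_castSucc (b : Fin n) : jm R b.castSucc = algSucc R n (jm R b) := by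
  simp only [jm, map_sum, algSucc_perm, permSucc_swap]
  rw [sum_filter, sum_filter, Fin.sum_univ_castSucc]
  simp [Fin.castSucc_lt_castSucc_iff, (Fin.castSucc_lt_last b).not_gt]

theorem jm_last : jm R (Fin.last n) = ∑ a : Fin n, perm R (swap a.castSucc (Fin.last n)) := by
  rw [jm, sum_filter, Fin.sum_univ_castSucc]
  simp [Fin.castSucc_lt_last]

theorem permSucc_mul_swap (g : Perm (Fin n)) (a : Fin n) :
    permSucc n g * swap a.castSucc (Fin.last n) =
      swap (g a).castSucc (Fin.last n) * permSucc n g := by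
  rw [mul_swap_eq_swap_mul, permSucc_castSucc, permSucc_last]

/-- Conjugation by an element of $S_n$ only permutes the transpositions that move the last letter of
$S_{n+1}$. -/
theorem algSucc_mul_jm_last (x : GroupAlg R n) :
    algSucc R n x * jm R (Fin.last n) = jm R (Fin.last n) * algSucc R n x := by
  rw [eq_sum_perm x, map_sum, sum_mul, mul_sum]
  refine sum_congr rfl fun g _ => ?_
  rw [map_smul, smul_mul_assoc, mul_smul_comm, algSucc_perm, jm_last, mul_sum, sum_mul]
  congr 1
  rw [← Equiv.sum_comp g fun a => perm R (swap a.castSucc (Fin.last n)) * perm R (permSucc n g)]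
  refine sum_congr rfl fun a _ => ?_
  rw [← map_mul, permSucc_mul_swap, map_mul]

/-- By induction: all elements but the last lie in the image of the smaller group algebra, which
commutes with the last one. -/
theorem jm_mul_comm (b b' : Fin n) : jm R b * jm R b' = jm R b' * jm R b := by
  induction n with
  | zero => exact b.elim0
  | succ n ih =>
    refine Fin.lastCases ?_ (fun b => ?_) b
    · refine Fin.lastCases rfl (fun b' => ?_) b'
      rw [jm_castSucc, algSucc_mul_jm_last]
    · refine Fin.lastCases ?_ (fun b' => ?_) b'
      · rw [jm_castSucc, algSucc_mul_jm_last]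
      · rw [jm_castSucc, jm_castSucc, ← map_mul, ih, map_mul]

theorem mul_classSum (ρ : n.Partition) (y : GroupAlg R n) :
    y * classSum R ρ = classSum R ρ * y := by
  refine commute_of_perm (fun s => ?_) y
  rw [classSum, mul_sum, sum_mul]
  refine sum_bij (fun g _ => s * g * s⁻¹) ?_ ?_ ?_ ?_
  · intro g hg
    simpa [cycleClass_conj] using hg
  · intro g _ h _ hgh
    simpa using hgh
  · intro g hg
    refine ⟨s⁻¹ * g * s⁻¹⁻¹, ?_, by group⟩
    simpa only [cycleClass_conj, mem_filter, mem_univ, true_and] using hg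
  · intro g _
    rw [← map_mul, ← map_mul]
    congr 1
    group

/-- A commutative subalgebra containing the Jucys–Murphy elements and the class sums. -/
def jmAlg (R : Type*) [CommRing R] (n : ℕ) : Subalgebra R (GroupAlg R n) :=
  Algebra.adjoin R (Set.range (jm R) ∪ Set.range (classSum R))

/-- Commutativity allows polynomials to be evaluated at the Jucys–Murphy elements, and products of
power series with class sum coefficients to be rearranged freely. -/
instance : IsMulCommutative (jmAlg R n) :=
  Algebra.isMulCommutative_adjoin R <| by
    rintro _ (⟨b, rfl⟩ | ⟨ρ, rfl⟩) _ (⟨b', rfl⟩ | ⟨ρ', rfl⟩)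
    · exact jm_mul_comm b b'
    · exact mul_classSum _ _
    · exact (mul_classSum _ _).symm
    · exact mul_classSum _ _

/-- The Jucys–Murphy elements as elements of the commutative subalgebra. -/
def jmC (R : Type*) [CommRing R] {n : ℕ} (b : Fin n) : jmAlg R n :=
  ⟨jm R b, Algebra.subset_adjoin (Or.inl ⟨b, rfl⟩)⟩

/-- The class sums as elements of the commutative subalgebra. -/
def classSumC (R : Type*) [CommRing R] {n : ℕ} (ρ : n.Partition) : jmAlg R n :=
  ⟨classSum R ρ, Algebra.subset_adjoin (Or.inr ⟨ρ, rfl⟩)⟩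

/-- Evaluation of polynomials at the Jucys–Murphy elements. -/
def jmEval (R : Type*) [CommRing R] (n : ℕ) : MvPolynomial (Fin n) R →ₐ[R] jmAlg R n :=
  MvPolynomial.aeval (jmC R)

/-- Evaluation of polynomials at the Jucys–Murphy elements, with values in the group algebra. -/
def jmHom (R : Type*) [CommRing R] (n : ℕ) : MvPolynomial (Fin n) R →ₐ[R] GroupAlg R n :=
  (jmAlg R n).val.comp (jmEval R n)
@[simp]
theorem jmHom_X (b : Fin n) : jmHom R n (MvPolynomial.X b) = jm R b := by
  simp [jmHom, jmEval, jmC]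

theorem jmHom_rename (f : MvPolynomial (Fin n) R) :
    jmHom R (n + 1) (MvPolynomial.rename Fin.castSucc f) = algSucc R n (jmHom R n f) := by
  induction f using MvPolynomial.induction_on with
  | C r => rw [MvPolynomial.rename_C, MvPolynomial.C_eq_algebraMap, MvPolynomial.C_eq_algebraMap, AlgHom.commutes, AlgHom.commutes, AlgHom.commutes]
  | add p q hp hq => simp only [map_add, hp, hq]
  | mul_X p i hp =>
    simp only [map_mul, hp, MvPolynomial.rename_X, jmHom_X, jm_castSucc]

/-- The generating function `∏_b (1 + z X_b)` of the elementary symmetric polynomials. -/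
def elemGen (R : Type*) [CommRing R] (n : ℕ) : (MvPolynomial (Fin n) R)⟦X⟧ :=
  ∏ b, (1 + PowerSeries.X * PowerSeries.C (MvPolynomial.X b))

theorem elemGen_succ : elemGen R (n + 1) =
    PowerSeries.map (MvPolynomial.rename Fin.castSucc).toRingHom (elemGen R n) *
      (1 + PowerSeries.X * PowerSeries.C (MvPolynomial.X (Fin.last n))) := by
  rw [elemGen, elemGen, Fin.prod_univ_castSucc, map_prod]
  congr 1
  refine prod_congr rfl fun b _ => ?_
  simp

/-- Jucys' theorem: the elementary symmetric functions of the Jucys–Murphy elements are the sums of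
all permutations of given colength. -/
theorem jucys (k : ℕ) : jmHom R n (PowerSeries.coeff k (elemGen R n)) =
    ∑ g with colength (cycleClass g) = k, perm R g := by
  induction n generalizing k with
  | zero =>
    rw [elemGen, Finset.univ_eq_empty, Finset.prod_empty, PowerSeries.coeff_one]
    have h : ∀ g : Perm (Fin 0), colength (cycleClass g) = 0 := fun g => by simp [colength]
    by_cases hk : k = 0
    · subst hk
      rw [if_pos rfl, map_one, Finset.filter_true_of_mem (fun g _ => h g), univ_unique, sum_singleton]
      exact (map_one _).symm
    · rw [if_neg hk, map_zero, Finset.filter_false_of_mem, sum_empty]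
      intro g _
      rw [h]
      exact fun h => hk h.symm
  | succ n ih =>
    have hc : ∀ k, PowerSeries.coeff k
        (PowerSeries.map (MvPolynomial.rename Fin.castSucc).toRingHom (elemGen R n)) =
        MvPolynomial.rename Fin.castSucc (PowerSeries.coeff k (elemGen R n)) := fun k => by simp
    rw [elemGen_succ, mul_add, mul_one, map_add, map_add, hc, jmHom_rename, ih, ← mul_assoc,
      PowerSeries.coeff_mul_C, map_mul, jmHom_X]
    -- Split $S_{n+1}$ into cosets $(x\;n)S_n$, where $n$ is the last letter. The trivial coset
    -- keeps the colength and gives $e_k$ of the smaller set of elements; the others raise the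
    -- colength by one and give $e_{k-1}X_n$.
    rw [sum_filter (fun g : Perm (Fin (n + 1)) => colength (cycleClass g) = k) (perm R), ← Equiv.sum_comp (cosetEquiv n), Fintype.sum_prod_type, Fin.sum_univ_castSucc]
    have hl : ∀ g, cosetEquiv n (Fin.last n, g) = permSucc n g := fun g => by
      rw [cosetEquiv_apply, swap_self]
      exact one_mul _
    simp only [hl, cosetEquiv_apply, colength_swap_permSucc, colength_permSucc]
    rw [add_comm (∑ _, _), map_sum, ← sum_filter (fun g : Perm (Fin n) => colength (cycleClass g) = k)
      (fun g => perm R (permSucc n g))]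
    simp only [algSucc_perm]
    congr 1
    cases k with
    | zero =>
      rw [PowerSeries.coeff_zero_mul_X]
      simp
    | succ k =>
      rw [PowerSeries.coeff_succ_mul_X, hc, jmHom_rename, algSucc_mul_jm_last, ih, jm_last, sum_mul]
      refine sum_congr rfl fun a _ => ?_
      rw [map_sum, mul_sum, sum_filter]
      refine sum_congr rfl fun g _ => ?_
      simp only [Nat.add_right_cancel_iff]
      split_ifs with h
      · rw [algSucc_perm, ← map_mul]
      · rfl

theorem jucys_classSum (k : ℕ) : jmHom R n (PowerSeries.coeff k (elemGen R n)) =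
    ∑ ρ : n.Partition with colength ρ = k, classSum R ρ := by
  rw [jucys]
  simp only [classSum]
  rw [sum_filter, sum_filter]
  simp_rw [sum_filter]
  have h : ∀ ρ : n.Partition, (if colength ρ = k then
      ∑ g, if cycleClass g = ρ then perm R g else 0 else 0) =
      ∑ g, if cycleClass g = ρ then (if colength ρ = k then perm R g else 0) else 0 := by
    intro ρ
    split_ifs <;> simp
  simp_rw [h]
  rw [sum_comm]
  refine sum_congr rfl fun g _ => ?_
  rw [sum_ite_eq, if_pos (mem_univ _)]

end GroupAlgebra

end

end QuantumHurwitz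

open scoped PowerSeries Polynomial

namespace QuantumHurwitz

noncomputable section

/-! ### Colouring polynomials, the Vandermonde product and the cut-and-join identity -/

open Equiv Finset
open scoped IsMulCommutative

section Colourings

variable (B : Type*) [CommRing B] (M : ℕ) {n : ℕ}

/-- The generating polynomial of the colourings fixed by `g`; it is the power sum product of the
cycle type of `g`. -/
def colPoly (g : Perm (Fin n)) : MvPolynomial (Fin M) B :=
  ∑ f : Fin n → Fin M with (f ∘ g = f), ∏ j, MvPolynomial.X (f j)

theorem colPoly_eq_prod (g : Perm (Fin n)) : colPoly B M g =
    ((cycleClass g).parts.map fun k => ∑ i, (MvPolynomial.X i : MvPolynomial (Fin M) B) ^ k).prod :=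
  sum_fixed_colourings g _

variable {B M}

/-- The Euler operator `x_i ∂/∂x_i`. -/
def euler (i : Fin M) : Derivation B (MvPolynomial (Fin M) B) (MvPolynomial (Fin M) B) :=
  (MvPolynomial.X i : MvPolynomial (Fin M) B) • MvPolynomial.pderiv i

theorem euler_apply (i : Fin M) (p : MvPolynomial (Fin M) B) :
    euler i p = MvPolynomial.X i * MvPolynomial.pderiv i p := rfl

theorem coeff_euler (i : Fin M) (p : MvPolynomial (Fin M) B) (m : Fin M →₀ ℕ) :
    (euler i p).coeff m = m i * p.coeff m := by
  induction p using MvPolynomial.induction_on' with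
  | monomial u a =>
    rw [euler_apply, MvPolynomial.X_mul_pderiv_monomial, MvPolynomial.coeff_smul,
      MvPolynomial.coeff_monomial]
    split_ifs with h
    · subst h; simp
    · simp
  | add p q hp hq => rw [map_add, MvPolynomial.coeff_add, hp, hq, MvPolynomial.coeff_add, mul_add]

theorem euler_X (i k : Fin M) :
    euler i (MvPolynomial.X k : MvPolynomial (Fin M) B) = if k = i then MvPolynomial.X i else 0 := by
  rw [euler_apply]
  split_ifs with h
  · subst h; simp
  · rw [MvPolynomial.pderiv_X_of_ne h, mul_zero]

theorem prod_X_eq_monomial (f : Fin n → Fin M) :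
    (∏ j, MvPolynomial.X (f j) : MvPolynomial (Fin M) B) =
      MvPolynomial.monomial (∑ j, Finsupp.single (f j) 1) 1 := by
  simp [MvPolynomial.X, MvPolynomial.monomial_sum_one]

theorem sum_single_apply (f : Fin n → Fin M) (i : Fin M) :
    (∑ j, Finsupp.single (f j) 1 : Fin M →₀ ℕ) i = #{j | f j = i} := by
  simp [Finsupp.finsetSum_apply, Finsupp.single_apply]

theorem euler_prod_X (i : Fin M) (f : Fin n → Fin M) :
    euler i (∏ j, MvPolynomial.X (f j) : MvPolynomial (Fin M) B) =
      (#{j | f j = i} : MvPolynomial (Fin M) B) * ∏ j, MvPolynomial.X (f j) := by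
  rw [prod_X_eq_monomial, euler_apply, MvPolynomial.X_mul_pderiv_monomial, sum_single_apply,
    nsmul_eq_mul]

theorem euler_colPoly (i : Fin M) (g : Perm (Fin n)) : euler i (colPoly B M g) =
    ∑ f : Fin n → Fin M with (f ∘ g = f), (#{j | f j = i} : MvPolynomial (Fin M) B) *
      ∏ j, MvPolynomial.X (f j) := by
  rw [colPoly, map_sum]
  exact sum_congr rfl fun f _ => euler_prod_X i f

theorem euler_natCast (i : Fin M) (k : ℕ) : euler i (k : MvPolynomial (Fin M) B) = 0 := by
  exact Derivation.map_natCast _ _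

theorem euler_euler_colPoly (i : Fin M) (g : Perm (Fin n)) : euler i (euler i (colPoly B M g)) =
    ∑ f : Fin n → Fin M with (f ∘ g = f), (#{j | f j = i} : MvPolynomial (Fin M) B) ^ 2 *
      ∏ j, MvPolynomial.X (f j) := by
  rw [euler_colPoly, map_sum]
  refine sum_congr rfl fun f _ => ?_
  rw [Derivation.leibniz, euler_natCast, euler_prod_X, smul_zero, add_zero, smul_eq_mul]
  ring

/-- Generating polynomial of the triples `(f, a, b)` such that `f` becomes `f ∘ h⁻¹` by changing
first the colour `i` of `a` to `j`, then the colour `j` of `b` to `i`. -/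
def recolour (B : Type*) [CommRing B] (i j : Fin M) (h : Perm (Fin n)) : MvPolynomial (Fin M) B :=
  ∑ x : (Fin n → Fin M) × Fin n × Fin n with
    (x.1 x.2.1 = i ∧ Function.update x.1 x.2.1 j x.2.2 = j ∧
      Function.update (Function.update x.1 x.2.1 j) x.2.2 i ∘ h = x.1),
    ∏ k, MvPolynomial.X (x.1 k)

theorem X_mul_prod_update (f : Fin n → Fin M) (a : Fin n) (j : Fin M) :
    (MvPolynomial.X (f a) : MvPolynomial (Fin M) B) *
      ∏ k, MvPolynomial.X (Function.update f a j k) =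
    MvPolynomial.X j * ∏ k, MvPolynomial.X (f k) := by
  rw [← Finset.mul_prod_erase univ (fun k => MvPolynomial.X (Function.update f a j k)) (mem_univ a),
    ← Finset.mul_prod_erase univ (fun k => MvPolynomial.X (f k)) (mem_univ a)]
  rw [Function.update_self, prod_congr rfl (g := fun k => MvPolynomial.X (f k))]
  · ring
  · intro k hk
    rw [Function.update_of_ne (ne_of_mem_erase hk)]

/-- Read the three moves `i → j` at `a`, `j → i` at `b`, relabelling by `h` as a cycle and start it
one move later: the triple becomes `(update f a j, b, h a)`, with the roles of `i` and `j`
exchanged. One letter of colour `i` has turned into one of colour `j`, which the two factors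
compensate. -/
theorem recolour_rotate (i j : Fin M) (h : Perm (Fin n)) :
    MvPolynomial.X j * recolour B i j h = MvPolynomial.X i * recolour B j i h := by
  rw [recolour, recolour, mul_sum, mul_sum]
  refine sum_bij (fun x _ => (Function.update x.1 x.2.1 j, x.2.2, h x.2.1)) ?_ ?_ ?_ ?_
  · rintro ⟨f, a, b⟩ hx
    simp only [mem_filter, mem_univ, true_and] at hx ⊢
    obtain ⟨h1, h2, h3⟩ := hx
    have h4 := congrFun h3 a
    simp only [Function.comp] at h4
    refine ⟨h2, h4.trans h1, ?_⟩
    funext k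
    simp only [Function.comp]
    by_cases hk : k = a
    · subst hk; simp
    · rw [Function.update_of_ne (fun h' => hk (by simpa using h')), Function.update_of_ne hk]
      exact congrFun h3 k
  · rintro ⟨f, a, b⟩ hx ⟨f', a', b'⟩ hx' he
    simp only [mem_filter, mem_univ, true_and] at hx hx'
    simp only [Prod.mk.injEq, EmbeddingLike.apply_eq_iff_eq] at he
    obtain ⟨he1, rfl, rfl⟩ := he
    simp only [Prod.mk.injEq, and_true]
    funext k
    by_cases hk : k = a
    · subst hk; rw [hx.1, hx'.1]
    · have := congrFun he1 k
      rwa [Function.update_of_ne hk, Function.update_of_ne hk] at this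
  · rintro ⟨f, b, c⟩ hx
    simp only [mem_filter, mem_univ, true_and] at hx
    obtain ⟨h1, h2, h3⟩ := hx
    have h4 : f (h.symm c) = j := by
      have := congrFun h3 (h.symm c)
      simpa using this.symm
    have h5 : Function.update (Function.update f (h.symm c) i) (h.symm c) j = f := by
      rw [Function.update_idem, ← h4, Function.update_eq_self]
    refine ⟨(Function.update f (h.symm c) i, h.symm c, b), ?_, ?_⟩
    · simp only [mem_filter, mem_univ, true_and]
      rw [h5]
      refine ⟨by simp, h1, ?_⟩
      funext k
      simp only [Function.comp]
      by_cases hk : k = h.symm c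
      · subst hk; simp [h2]
      · have := congrFun h3 k
        rw [Function.comp, Function.update_of_ne (fun h6 => hk (by rw [← h6]; simp))] at this
        rw [this, Function.update_of_ne hk]
    · simp [h5]
  · rintro ⟨f, a, b⟩ hx
    simp only [mem_filter, mem_univ, true_and] at hx
    rw [← hx.1, X_mul_prod_update]

/-- Generating polynomial of the colourings fixed by `(a b) h` for which `a` has colour `i` and
`b` has colour `j`. -/
def joinPoly (B : Type*) [CommRing B] (i j : Fin M) (h : Perm (Fin n)) : MvPolynomial (Fin M) B :=
  ∑ x : (Fin n → Fin M) × Fin n × Fin n with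
    (x.1 x.2.1 = i ∧ x.1 x.2.2 = j ∧ x.1 ∘ (swap x.2.1 x.2.2 * h : Perm (Fin n)) = x.1),
    ∏ k, MvPolynomial.X (x.1 k)

theorem joinPoly_comm (i j : Fin M) (h : Perm (Fin n)) : joinPoly B i j h = joinPoly B j i h := by
  refine sum_nbij' (fun x => (x.1, x.2.2, x.2.1)) (fun x => (x.1, x.2.2, x.2.1)) ?_ ?_ ?_ ?_ ?_
  · rintro ⟨f, a, b⟩ hx
    simp only [mem_filter, mem_univ, true_and] at hx ⊢
    rw [swap_comm]
    exact ⟨hx.2.1, hx.1, hx.2.2⟩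
  · rintro ⟨f, a, b⟩ hx
    simp only [mem_filter, mem_univ, true_and] at hx ⊢
    rw [swap_comm]
    exact ⟨hx.2.1, hx.1, hx.2.2⟩
  · rintro ⟨f, a, b⟩ _; rfl
  · rintro ⟨f, a, b⟩ _; rfl
  · rintro ⟨f, a, b⟩ _; rfl

theorem comp_swap_eq_update (f : Fin n → Fin M) (a b : Fin n) :
    f ∘ (swap a b : Perm (Fin n)) = Function.update (Function.update f a (f b)) b (f a) := by
  funext k
  simp only [Function.comp]
  by_cases hb : k = b
  · subst hb; simp
  · rw [Function.update_of_ne hb]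
    by_cases ha : k = a
    · subst ha; simp
    · rw [Function.update_of_ne ha, swap_apply_of_ne_of_ne ha hb]

/-- If `a ≠ b`, the two moves exchange the colours of `a` and `b`, so `f` is fixed by `swap a b *
h`. If `a = b`, the second move undoes the first, so `f` is fixed by `h` and `a` is any letter of
colour `i`. -/
theorem recolour_eq {i j : Fin M} (hij : i ≠ j) (h : Perm (Fin n)) :
    recolour B i j h = joinPoly B i j h + euler i (colPoly B M h) := by
  have h1 : euler i (colPoly B M h) = ∑ x : (Fin n → Fin M) × Fin n × Fin n with
      (x.1 x.2.1 = i ∧ x.2.2 = x.2.1 ∧ x.1 ∘ h = x.1), ∏ k, MvPolynomial.X (x.1 k) := by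
    rw [euler_colPoly, sum_filter, sum_filter, Fintype.sum_prod_type]
    refine sum_congr rfl fun f _ => ?_
    rw [Fintype.sum_prod_type]
    split_ifs with hf
    · simp only [hf, and_true, ite_and]
      rw [card_filter, Nat.cast_sum, sum_mul]
      refine sum_congr rfl fun a _ => ?_
      split_ifs <;> simp
    · simp [hf]
  rw [h1, joinPoly, recolour, ← sum_union, ← filter_or]
  · refine sum_congr (filter_congr ?_) fun _ _ => rfl
    rintro ⟨f, a, b⟩ -
    simp only
    by_cases hab : b = a
    · subst hab
      constructor
      · rintro ⟨h1, -, h3⟩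
        right
        refine ⟨h1, rfl, ?_⟩
        rwa [Function.update_idem, ← h1, Function.update_eq_self] at h3
      · rintro (⟨h1, h2, -⟩ | ⟨h1, -, h3⟩)
        · exact absurd (h1.symm.trans h2) hij
        · refine ⟨h1, by simp, ?_⟩
          rwa [Function.update_idem, ← h1, Function.update_eq_self]
    · rw [Function.update_of_ne hab]
      simp only [hab, false_and, and_false, or_false]
      refine and_congr_right fun ha => and_congr_right fun hb => ?_
      rw [Perm.coe_mul, ← Function.comp_assoc, comp_swap_eq_update, ha, hb]
  · rw [disjoint_filter]
    rintro ⟨f, a, b⟩ - ⟨h1, h2, -⟩ ⟨-, h3, -⟩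
    simp only at h1 h2 h3
    subst h3
    exact hij (h1.symm.trans h2)

/-- Insert `recolour_eq` into the rotation identity. This is the division-free form of the join term
$\frac{x_jE_i-x_iE_j}{x_i-x_j}$, where $E_i$ is the Euler operator. -/
theorem sub_mul_joinPoly {i j : Fin M} (hij : i ≠ j) (h : Perm (Fin n)) :
    (MvPolynomial.X i - MvPolynomial.X j) * joinPoly B i j h =
      MvPolynomial.X j * euler i (colPoly B M h) - MvPolynomial.X i * euler j (colPoly B M h) := by
  have h1 := recolour_rotate (B := B) i j h
  rw [recolour_eq hij, recolour_eq hij.symm, joinPoly_comm j i] at h1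
  linear_combination -h1

/-- The cut-and-join identity. -/
theorem sum_swap_colPoly (h : Perm (Fin n)) :
    ∑ a, ∑ b with a ≠ b, colPoly B M (swap a b * h) =
      ∑ i, (euler i (euler i (colPoly B M h)) - euler i (colPoly B M h)) +
        ∑ i, ∑ j with i ≠ j, joinPoly B i j h := by
  let w : (Fin n → Fin M) → MvPolynomial (Fin M) B := fun f => ∏ k, MvPolynomial.X (f k)
  let P : (Fin n → Fin M) → Fin n → Fin n → Prop := fun f a b =>
    f ∘ (swap a b * h : Perm (Fin n)) = f
  have h0 : ∑ a, ∑ b with a ≠ b, colPoly B M (swap a b * h) =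
      ∑ f, ∑ a, ∑ b, if a ≠ b ∧ P f a b then w f else 0 := by
    rw [sum_comm]
    refine sum_congr rfl fun a _ => ?_
    rw [sum_comm, sum_filter]
    refine sum_congr rfl fun b _ => ?_
    by_cases hab : a = b
    · simp [hab]
    · rw [if_pos hab, colPoly, sum_filter]
      refine sum_congr rfl fun f _ => ?_
      exact if_congr (by simp [hab, P]) rfl rfl
  -- Pairs of equal colour: the transposition does not affect `f`, so `f` is fixed by `h`, and `m`
  -- letters of colour `i` give `m ^ 2 - m` ordered pairs.
  have h1 : ∑ i, (euler i (euler i (colPoly B M h)) - euler i (colPoly B M h)) =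
      ∑ f, ∑ a, ∑ b, if a ≠ b ∧ f a = f b ∧ P f a b then w f else 0 := by
    have h2 : ∀ i : Fin M, euler i (euler i (colPoly B M h)) - euler i (colPoly B M h) =
        ∑ f : Fin n → Fin M, if f ∘ h = f then ((#{j | f j = i} : MvPolynomial (Fin M) B) ^ 2 -
          (#{j | f j = i} : MvPolynomial (Fin M) B)) * w f else 0 := by
      intro i
      rw [euler_euler_colPoly, euler_colPoly, ← sum_sub_distrib, ← sum_filter]
      refine sum_congr rfl fun f _ => ?_
      rw [sub_mul]
    simp_rw [h2]
    rw [sum_comm]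
    refine sum_congr rfl fun f _ => ?_
    have hs : ∀ a b, f a = f b → f ∘ (swap a b * h : Perm (Fin n)) = f ∘ h := by
      intro a b hab
      rw [Perm.coe_mul, ← Function.comp_assoc, comp_swap_eq_update, ← hab, Function.update_eq_self,
        hab, Function.update_eq_self]
    have hs' : ∀ a b, (a ≠ b ∧ f a = f b ∧ P f a b) ↔ (f ∘ h = f ∧ (f a = f b ∧ a ≠ b)) := by
      intro a b
      constructor
      · rintro ⟨h1, h2, h3⟩
        exact ⟨by rw [← hs a b h2]; exact h3, h2, h1⟩
      · rintro ⟨h1, h2, h3⟩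
        exact ⟨h3, h2, by change _ = _; rw [hs a b h2]; exact h1⟩
    simp only [hs']
    by_cases hf : f ∘ h = f
    · simp only [hf, true_and, if_true]
      have key : ∀ i : Fin M, (#{j | f j = i} : MvPolynomial (Fin M) B) ^ 2 -
          (#{j | f j = i} : MvPolynomial (Fin M) B) =
          ∑ a, ∑ b, if f a = i ∧ f b = i ∧ a ≠ b then 1 else 0 := by
        intro i
        have e1 : (#{j | f j = i} : MvPolynomial (Fin M) B) = ∑ a, if f a = i then 1 else 0 := by
          rw [card_filter]; push_cast; rfl
        rw [sq, e1, sum_mul, ← sum_sub_distrib]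
        refine sum_congr rfl fun a _ => ?_
        by_cases ha : f a = i
        · simp only [ha, if_true, true_and, one_mul]
          have e2 : (1 : MvPolynomial (Fin M) B) = ∑ b, if a = b then 1 else 0 := by simp
          rw [sub_eq_iff_eq_add]
          refine Eq.trans ?_ (congrArg _ e2.symm)
          rw [← sum_add_distrib]
          refine sum_congr rfl fun b _ => ?_
          by_cases hb : a = b
          · subst hb; simp [ha]
          · simp [hb]
        · simp [ha]
      simp_rw [key, sum_mul]
      rw [sum_comm]
      refine sum_congr rfl fun a _ => ?_
      rw [sum_comm]
      refine sum_congr rfl fun b _ => ?_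
      have : ∀ i, (f a = i ∧ f b = i ∧ a ≠ b) ↔ (f a = i ∧ (f a = f b ∧ a ≠ b)) := by
        intro i
        constructor
        · rintro ⟨h1, h2, h3⟩; exact ⟨h1, h1.trans h2.symm, h3⟩
        · rintro ⟨h1, h2, h3⟩; exact ⟨h1, h2.symm.trans h1, h3⟩
      simp only [this, ite_and, ite_mul, one_mul, zero_mul]
      rw [Fintype.sum_ite_eq]
    · simp [hf]
  -- Pairs of different colours, sorted by the colours of `a` and `b`.
  have h2 : ∑ i, ∑ j with i ≠ j, joinPoly B i j h =
      ∑ f, ∑ a, ∑ b, if a ≠ b ∧ f a ≠ f b ∧ P f a b then w f else 0 := by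
    have h3 : ∀ i j : Fin M, (if i ≠ j then joinPoly B i j h else 0) =
        ∑ x : (Fin n → Fin M) × Fin n × Fin n, if x.1 x.2.1 = i then (if x.1 x.2.2 = j then
          (if x.2.1 ≠ x.2.2 ∧ x.1 x.2.1 ≠ x.1 x.2.2 ∧ P x.1 x.2.1 x.2.2 then w x.1 else 0) else 0)
          else 0 := by
      intro i j
      split_ifs with hij
      · rw [joinPoly, sum_filter]
        refine sum_congr rfl ?_
        rintro ⟨f, a, b⟩ -
        simp only [← ite_and]
        refine if_congr ?_ rfl rfl
        constructor
        · rintro ⟨h1, h2, h3⟩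
          have h4 : f a ≠ f b := by rw [h1, h2]; exact hij
          exact ⟨h1, h2, fun h => h4 (congrArg f h), h4, h3⟩
        · rintro ⟨h1, h2, h3, h4, h5⟩
          exact ⟨h1, h2, h5⟩
      · symm
        refine sum_eq_zero ?_
        rintro ⟨f, a, b⟩ -
        simp only [← ite_and]
        rw [if_neg]
        rintro ⟨h1, h2, h3, h4, h5⟩
        exact hij (by rw [← h1, ← h2]; exact h4)
    simp_rw [sum_filter, h3]
    simp_rw [sum_comm (s := (univ : Finset (Fin M)))
      (t := (univ : Finset ((Fin n → Fin M) × Fin n × Fin n)))]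
    rw [Fintype.sum_prod_type]
    refine sum_congr rfl fun f _ => ?_
    rw [Fintype.sum_prod_type]
    refine sum_congr rfl fun a _ => sum_congr rfl fun b _ => ?_
    simp only [sum_ite_irrel, sum_const_zero]
    rw [Fintype.sum_ite_eq, Fintype.sum_ite_eq]
  rw [h0, h1, h2]
  simp only [← sum_add_distrib]
  refine sum_congr rfl fun f _ => sum_congr rfl fun a _ => sum_congr rfl fun b _ => ?_
  by_cases h1 : f a = f b <;> simp [h1]

end Colourings

end

end QuantumHurwitz

open scoped PowerSeries Polynomial

namespace QuantumHurwitz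

noncomputable section

/-! ### Alternants and the characters `χ_l` -/

open Equiv Finset
open scoped IsMulCommutative

section Alternant

variable (B : Type*) [CommRing B] (M : ℕ) {n : ℕ}

/-- The staircase `(M - 1, …, 1, 0)`. -/
def staircase : Fin M →₀ ℕ := Finsupp.equivFunOnFinite.symm fun i => (Fin.rev i : ℕ)

@[simp]
theorem staircase_apply (i : Fin M) : staircase M i = (Fin.rev i : ℕ) := rfl

/-- The alternant `det (x_i^{M - 1 - j})`. -/
def alternant : MvPolynomial (Fin M) B :=
  Matrix.det (Matrix.of fun i j : Fin M => (MvPolynomial.X i : MvPolynomial (Fin M) B) ^ staircase M j)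

/-- The pairs `i < j` of indices. -/
def ltPairs : Finset (Fin M × Fin M) := {p | p.1 < p.2}

theorem alternant_eq_prod : alternant B M =
    ∏ p ∈ ltPairs M, (MvPolynomial.X p.1 - MvPolynomial.X p.2 : MvPolynomial (Fin M) B) := by
  have h : alternant B M = Matrix.det (Matrix.vandermonde
      fun i : Fin M => (MvPolynomial.X (Fin.rev i) : MvPolynomial (Fin M) B)) := by
    rw [alternant, ← Matrix.det_submatrix_equiv_self Fin.revPerm]
    congr 1
    refine Matrix.ext fun i j => ?_
    have hj : M - (M - ((j : ℕ) + 1) + 1) = j := by omega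
    simp [Matrix.vandermonde, hj]
  rw [h, Matrix.det_vandermonde, Finset.prod_sigma']
  refine prod_nbij' (fun x => (Fin.rev x.2, Fin.rev x.1)) (fun p => ⟨Fin.rev p.2, Fin.rev p.1⟩)
    ?_ ?_ ?_ ?_ ?_
  · rintro ⟨i, j⟩ h
    simpa [ltPairs] using h
  · rintro ⟨i, j⟩ h
    simpa [ltPairs] using h
  · rintro ⟨i, j⟩ _; simp
  · rintro ⟨i, j⟩ _; simp
  · rintro ⟨i, j⟩ _; simp

theorem alternant_eq_sum : alternant B M = ∑ σ : Perm (Fin M),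
    MvPolynomial.monomial (Finsupp.equivMapDomain σ (staircase M)) ((Perm.sign σ : ℤ) : B) := by
  rw [alternant, Matrix.det_apply']
  refine sum_congr rfl fun σ _ => ?_
  rw [MvPolynomial.monomial_eq, Finsupp.prod_fintype _ _ (fun i => pow_zero _)]
  rw [← Equiv.prod_comp σ fun i => (MvPolynomial.X i : MvPolynomial (Fin M) B) ^
    (Finsupp.equivMapDomain σ (staircase M) i)]
  simp [Matrix.of_apply]

variable {B M}

theorem derivation_prod {ι A : Type*} [CommRing A] [Algebra B A] (D : Derivation B A A)
    [DecidableEq ι] (s : Finset ι) (f : ι → A) :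
    D (∏ p ∈ s, f p) = ∑ p ∈ s, (∏ q ∈ s.erase p, f q) * D (f p) := by
  induction s using Finset.induction_on with
  | empty => simp
  | insert a s ha ih =>
    rw [prod_insert ha, Derivation.leibniz, ih, sum_insert ha, erase_insert ha, smul_eq_mul,
      smul_eq_mul, mul_sum, add_comm]
    congr 1
    refine sum_congr rfl fun p hp => ?_
    have hpa : p ≠ a := fun h => ha (h ▸ hp)
    rw [erase_insert_of_ne hpa.symm, prod_insert (fun h => ha (mem_of_mem_erase h)), mul_assoc]

theorem sum_ne_eq_sum_ltPairs {A : Type*} [AddCommMonoid A] (F : Fin M → Fin M → A) :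
    ∑ i, ∑ j with i ≠ j, F i j = ∑ p ∈ ltPairs M, (F p.1 p.2 + F p.2 p.1) := by
  simp only [ltPairs, sum_filter, sum_add_distrib, Fintype.sum_prod_type]
  rw [sum_comm (f := fun i j => if i < j then F j i else 0)]
  simp only [← sum_add_distrib]
  refine sum_congr rfl fun i _ => sum_congr rfl fun j _ => ?_
  rcases lt_trichotomy i j with h | h | h
  · simp [h, h.ne, h.not_gt]
  · simp [h]
  · simp [h, h.ne', h.not_gt]

/-- By Leibniz, the factor $x_i-x_j$ of the alternant contributes
$x_iE_i-x_jE_j=(x_i-x_j)(E_i+E_j)+(x_jE_i-x_iE_j)$, and the last bracket is $x_i-x_j$ times the join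
polynomial. Thus the cross term of the second-order operator absorbs the join terms of the
cut-and-join identity. -/
theorem sum_euler_alternant_mul (h : Perm (Fin n)) :
    ∑ m, euler m (alternant B M) * euler m (colPoly B M h) =
      alternant B M * ∑ p ∈ ltPairs M, (euler p.1 (colPoly B M h) + euler p.2 (colPoly B M h) +
        joinPoly B p.1 p.2 h) := by
  have h1 : ∀ m, euler m (alternant B M) = ∑ p ∈ ltPairs M,
      (∏ q ∈ (ltPairs M).erase p, (MvPolynomial.X q.1 - MvPolynomial.X q.2 : MvPolynomial (Fin M) B)) *
        ((if p.1 = m then MvPolynomial.X p.1 else 0) - (if p.2 = m then MvPolynomial.X p.2 else 0)) := by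
    intro m
    rw [alternant_eq_prod, derivation_prod]
    refine sum_congr rfl fun p _ => ?_
    rw [map_sub, euler_X, euler_X]
    congr 2 <;> (split_ifs with h <;> simp [h])
  simp_rw [h1, sum_mul]
  rw [sum_comm, mul_sum]
  refine sum_congr rfl fun p hp => ?_
  have hne : p.1 ≠ p.2 := (mem_filter.1 hp).2.ne
  simp_rw [mul_assoc]
  rw [← mul_sum, alternant_eq_prod, ← mul_prod_erase _ _ hp]
  simp_rw [sub_mul, ite_mul, zero_mul, sum_sub_distrib]
  rw [Fintype.sum_ite_eq, Fintype.sum_ite_eq]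
  have h2 := sub_mul_joinPoly (B := B) hne h
  linear_combination (-∏ q ∈ (ltPairs M).erase p,
    (MvPolynomial.X q.1 - MvPolynomial.X q.2 : MvPolynomial (Fin M) B)) * h2

theorem sum_euler_colPoly (h : Perm (Fin n)) :
    ∑ i, euler i (colPoly B M h) = (n : MvPolynomial (Fin M) B) * colPoly B M h := by
  simp_rw [euler_colPoly]
  rw [sum_comm, colPoly, mul_sum]
  refine sum_congr rfl fun f _ => ?_
  rw [← sum_mul, ← Nat.cast_sum]
  congr 2
  have := card_eq_sum_card_fiberwise (s := (univ : Finset (Fin n))) (t := (univ : Finset (Fin M)))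
    (f := f) (fun _ _ => mem_coe.2 (mem_univ _))
  rw [card_univ, Fintype.card_fin] at this
  exact this.symm

/-- Every exponent occurring in the alternant is a rearrangement of the staircase, so all have the
same sum of squares. -/
theorem sum_euler_euler_alternant : ∑ i, euler i (euler i (alternant B M)) =
    ((∑ i, staircase M i ^ 2 : ℕ) : MvPolynomial (Fin M) B) * alternant B M := by
  ext m
  rw [MvPolynomial.coeff_sum, ← MvPolynomial.C_eq_coe_nat, MvPolynomial.coeff_C_mul]
  simp_rw [coeff_euler]
  rw [alternant_eq_sum, MvPolynomial.coeff_sum]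
  simp_rw [MvPolynomial.coeff_monomial, ← mul_assoc, ← sum_mul, mul_sum]
  refine sum_congr rfl fun σ _ => ?_
  split_ifs with hm
  · congr 1
    subst hm
    push_cast
    simp_rw [sq]
    rw [← Equiv.sum_comp σ]
    simp
  · simp

/-- The virtual character of `S_n` given by the coefficient of `x^l` in the product of the
alternant with a power sum product. -/
def chi (l : Fin M →₀ ℕ) (g : Perm (Fin n)) : ℤ :=
  (alternant ℤ M * colPoly ℤ M g).coeff l

/-- Twice the eigenvalue of the sum of all transpositions on `χ_l`. -/
def casimir (n : ℕ) (l : Fin M →₀ ℕ) : ℤ :=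
  ∑ i, (l i : ℤ) ^ 2 - (∑ i, staircase M i ^ 2 : ℕ) - n - 2 * (M - 1) * n

/-- After multiplication by the alternant, the cut-and-join operator becomes $\sum_iE_i^2$ minus a
constant. This is diagonal on monomials, with eigenvalue $\sum_il_i^2$ minus that constant at $x^l$.
-/
theorem sum_swap_chi (l : Fin M →₀ ℕ) (h : Perm (Fin n)) :
    ∑ a, ∑ b with a ≠ b, chi l (swap a b * h) = casimir n l * chi l h := by
  have h1 : alternant ℤ M * ∑ a, ∑ b with a ≠ b, colPoly ℤ M (swap a b * h) =
      ∑ i, euler i (euler i (alternant ℤ M * colPoly ℤ M h)) -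
        MvPolynomial.C (((∑ i, staircase M i ^ 2 : ℕ) : ℤ) + n + 2 * (M - 1) * n) *
          (alternant ℤ M * colPoly ℤ M h) := by
    rw [sum_swap_colPoly]
    simp only [Derivation.leibniz, map_add, smul_eq_mul, sum_add_distrib, sum_sub_distrib]
    have e1 := sum_euler_alternant_mul (B := ℤ) (M := M) h
    have e2 := sum_euler_colPoly (B := ℤ) (M := M) h
    have e3 := sum_euler_euler_alternant (B := ℤ) (M := M)
    have e4 : ∑ i, ∑ j with i ≠ j, joinPoly ℤ i j h =
        2 * ∑ p ∈ ltPairs M, joinPoly ℤ p.1 p.2 h := by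
      rw [sum_ne_eq_sum_ltPairs, mul_sum]
      refine sum_congr rfl fun p _ => ?_
      rw [joinPoly_comm p.2 p.1]
      ring
    have e5 : ∑ p ∈ ltPairs M, (euler p.1 (colPoly ℤ M h) + euler p.2 (colPoly ℤ M h)) =
        ((M : MvPolynomial (Fin M) ℤ) - 1) * ∑ i, euler i (colPoly ℤ M h) := by
      rw [← sum_ne_eq_sum_ltPairs (fun i _ => euler i (colPoly ℤ M h)), mul_sum]
      refine sum_congr rfl fun i _ => ?_
      rw [sum_const, filter_ne, card_erase_of_mem (mem_univ _), card_univ, Fintype.card_fin,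
        nsmul_eq_mul, Nat.cast_sub i.pos]
      simp
    rw [sum_add_distrib, e5] at e1
    have e6 : ∑ m, alternant ℤ M * euler m (euler m (colPoly ℤ M h)) =
      alternant ℤ M * ∑ m, euler m (euler m (colPoly ℤ M h)) := by rw [mul_sum]
    have e7 : ∑ m, colPoly ℤ M h * euler m (euler m (alternant ℤ M)) =
      colPoly ℤ M h * ∑ m, euler m (euler m (alternant ℤ M)) := by rw [mul_sum]
    have e8 : ∑ m, euler m (colPoly ℤ M h) * euler m (alternant ℤ M) =
        ∑ m, euler m (alternant ℤ M) * euler m (colPoly ℤ M h) := by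
      simp_rw [mul_comm]
    rw [e4, e6, e7, e8, e1, e3, e2]
    simp only [map_mul, map_sub, map_ofNat, map_natCast, map_one]
    ring
  have h2 := congrArg (MvPolynomial.coeff l) h1
  rw [MvPolynomial.coeff_sub, MvPolynomial.coeff_sum, MvPolynomial.coeff_C_mul] at h2
  simp_rw [coeff_euler, ← mul_assoc, ← sum_mul] at h2
  simp_rw [chi, casimir]
  rw [mul_sum, MvPolynomial.coeff_sum] at h2
  simp_rw [mul_sum, MvPolynomial.coeff_sum] at h2
  rw [h2]
  simp_rw [sq]
  push_cast
  ring

theorem colPoly_permSucc (g : Perm (Fin n)) :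
    colPoly B M (permSucc n g) = colPoly B M g * ∑ i, MvPolynomial.X i := by
  rw [colPoly, colPoly, sum_mul_sum, sum_filter, ← Equiv.sum_comp (Fin.snocEquiv fun _ => Fin M),
    Fintype.sum_prod_type, sum_comm, sum_filter]
  refine sum_congr rfl fun f _ => ?_
  simp only [comp_permSucc_eq_iff]
  by_cases hf : f ∘ g = f
  · rw [if_pos hf]
    refine sum_congr rfl fun i _ => ?_
    rw [if_pos (by simpa [Fin.snocEquiv] using hf), Fin.prod_univ_castSucc]
    simp [Fin.snocEquiv]
  · rw [if_neg hf]
    refine sum_eq_zero fun i _ => if_neg (by simpa [Fin.snocEquiv] using hf)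

/-- The branching rule: a new fixed point multiplies the power sum product by $p_1=\sum_ix_i$. -/
theorem chi_permSucc (l : Fin M →₀ ℕ) (g : Perm (Fin n)) :
    chi l (permSucc n g) = ∑ i ∈ l.support, chi (l - Finsupp.single i 1) g := by
  rw [chi, colPoly_permSucc, ← mul_assoc, mul_sum, MvPolynomial.coeff_sum]
  simp_rw [MvPolynomial.coeff_mul_X']
  rw [sum_ite_mem, univ_inter]
  rfl

theorem rename_alternant (σ : Perm (Fin M)) : MvPolynomial.rename σ (alternant B M) =
    ((Perm.sign σ : ℤ) : MvPolynomial (Fin M) B) * alternant B M := by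
  rw [alternant, AlgHom.map_det, ← Matrix.det_permute]
  congr 1
  ext i j
  simp

theorem rename_colPoly (σ : Perm (Fin M)) (g : Perm (Fin n)) :
    MvPolynomial.rename σ (colPoly B M g) = colPoly B M g := by
  rw [colPoly_eq_prod, map_multiset_prod, Multiset.map_map]
  congr 2
  funext k
  simp only [Function.comp, map_sum, map_pow, MvPolynomial.rename_X]
  exact Equiv.sum_comp σ fun i => (MvPolynomial.X i : MvPolynomial (Fin M) B) ^ k

/-- The alternant times a symmetric polynomial is antisymmetric, so a coefficient whose exponent is
fixed by a transposition equals its own negative. -/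
theorem chi_eq_zero_of_eq (l : Fin M →₀ ℕ) (g : Perm (Fin n)) {i j : Fin M} (hij : i ≠ j)
    (hl : l i = l j) : chi l g = 0 := by
  have h1 : MvPolynomial.rename (swap i j) (alternant ℤ M * colPoly ℤ M g) =
      -(alternant ℤ M * colPoly ℤ M g) := by
    rw [map_mul, rename_alternant, rename_colPoly, Perm.sign_swap hij]
    simp
  have h2 := congrArg (MvPolynomial.coeff (Finsupp.mapDomain (swap i j) l)) h1
  rw [MvPolynomial.coeff_rename_mapDomain _ (swap i j).injective, MvPolynomial.coeff_neg] at h2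
  have h3 : Finsupp.mapDomain (swap i j) l = l := by
    rw [← Finsupp.equivMapDomain_eq_mapDomain]
    ext k
    rw [Finsupp.equivMapDomain_apply, symm_swap]
    by_cases hi : k = i
    · subst hi; simp [hl]
    · by_cases hj : k = j
      · subst hj; simp [hl]
      · rw [swap_apply_of_ne_of_ne hi hj]
  rw [h3] at h2
  rw [chi]
  omega

theorem chi_zero (l : Fin M →₀ ℕ) (g : Perm (Fin 0)) : chi l g = (alternant ℤ M).coeff l := by
  rw [chi, colPoly_eq_prod]
  have : (cycleClass g).parts = 0 := by
    rw [← Multiset.card_eq_zero]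
    exact Nat.le_zero.1 (cycleCount_le g)
  rw [this]
  simp

theorem coeff_alternant_staircase : (alternant B M).coeff (staircase M) = 1 := by
  rw [alternant_eq_sum, MvPolynomial.coeff_sum, sum_eq_single 1]
  · rw [MvPolynomial.coeff_monomial, if_pos]
    · simp
    · ext i; rfl
  · intro σ _ hσ
    rw [MvPolynomial.coeff_monomial, if_neg]
    intro h
    apply hσ
    ext i
    have := DFunLike.congr_fun h (σ i)
    simp only [Finsupp.equivMapDomain_apply, symm_apply_apply, staircase_apply] at this
    rw [← Fin.rev_inj.1 (Fin.ext this)]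
    rfl
  · simp

end Alternant

end

end QuantumHurwitz

open scoped PowerSeries Polynomial

namespace QuantumHurwitz

noncomputable section

/-! ### Evaluation of the characters on polynomials in the Jucys–Murphy elements -/

open Equiv Finset
open scoped IsMulCommutative

section Branching

variable {R : Type*} [CommRing R] {M n : ℕ}

/-- The linear extension of `χ_l` to the group algebra. -/
def chiLin (R : Type*) [CommRing R] {M n : ℕ} (l : Fin M →₀ ℕ) : GroupAlg R n →ₗ[R] R :=
  extendLin fun g => (chi l g : R)

@[simp]
theorem chiLin_perm (l : Fin M →₀ ℕ) (g : Perm (Fin n)) : chiLin R l (perm R g) = chi l g :=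
  extendLin_perm _ _

/-- Twice the sum of all transpositions. -/
def swapSum (R : Type*) [CommRing R] (n : ℕ) : GroupAlg R n :=
  ∑ a, ∑ b with a ≠ b, perm R (swap a b)

theorem chiLin_swapSum_mul (l : Fin M →₀ ℕ) (x : GroupAlg R n) :
    chiLin R l (swapSum R n * x) = casimir n l * chiLin R l x := by
  have : (chiLin R l).comp (LinearMap.mulLeft R (swapSum R n)) =
      (casimir n l : R) • chiLin R l := by
    refine linearMap_ext_perm fun g => ?_
    simp only [LinearMap.comp_apply, LinearMap.mulLeft_apply, LinearMap.smul_apply, chiLin_perm,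
      swapSum, sum_mul, map_sum, smul_eq_mul]
    simp_rw [← map_mul, chiLin_perm]
    have := congrArg (Int.cast : ℤ → R) (sum_swap_chi l g)
    push_cast at this
    exact this
  exact LinearMap.congr_fun this x

theorem chiLin_algSucc (l : Fin M →₀ ℕ) (x : GroupAlg R n) :
    chiLin R l (algSucc R n x) = ∑ i ∈ l.support, chiLin R (l - Finsupp.single i 1) x := by
  have : (chiLin R l).comp (algSucc R n).toLinearMap =
      ∑ i ∈ l.support, chiLin R (l - Finsupp.single i 1) := by
    refine linearMap_ext_perm fun g => ?_
    simp only [LinearMap.comp_apply, AlgHom.toLinearMap_apply, algSucc_perm, chiLin_perm,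
      LinearMap.sum_apply]
    have := congrArg (Int.cast : ℤ → R) (chi_permSucc l g)
    push_cast at this
    exact this
  simpa using LinearMap.congr_fun this x

/-- The last Jucys–Murphy element is the difference of the sums of all transpositions of $S_{n+1}$
and of $S_n$; the factor 2 arises because `swapSum` runs over ordered pairs. -/
theorem two_mul_jm_last :
    2 * jm R (Fin.last n) = swapSum R (n + 1) - algSucc R n (swapSum R n) := by
  rw [jm_last, swapSum, swapSum]
  simp only [sum_filter, Fin.sum_univ_castSucc, map_sum, apply_ite (algSucc R n), algSucc_perm,
    permSucc_swap, map_zero]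
  simp [Fin.castSucc_inj, (Fin.castSucc_lt_last _).ne, (Fin.castSucc_lt_last _).ne',
    sum_add_distrib, two_mul, swap_comm (Fin.last n)]
  abel

/-- For $l=\lambda+\delta$ one has $l_i-M=\lambda_i-1-i$, which is the content of the last box of
row $i$ (rows numbered from 0). -/
theorem casimir_sub (l : Fin M →₀ ℕ) {i : Fin M} (hi : i ∈ l.support) :
    casimir (n + 1) l - casimir n (l - Finsupp.single i 1) = 2 * ((l i : ℤ) - M) := by
  have h1 : ∑ j, (l j : ℤ) ^ 2 - ∑ j, ((l - Finsupp.single i 1 : Fin M →₀ ℕ) j : ℤ) ^ 2 =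
      2 * (l i : ℤ) - 1 := by
    have hpos : 1 ≤ l i := Nat.one_le_iff_ne_zero.2 (Finsupp.mem_support_iff.1 hi)
    rw [← sum_sub_distrib, sum_eq_single i]
    · rw [Finsupp.tsub_apply, Finsupp.single_eq_same, Nat.cast_sub hpos]
      push_cast
      ring
    · intro j _ hj
      rw [Finsupp.tsub_apply, Finsupp.single_eq_of_ne hj]
      simp
    · simp
  simp only [casimir]
  rw [Nat.cast_succ]
  linear_combination h1

/-- Substitution of a constant for the last variable. -/
def evalLast (n : ℕ) (c : R) : MvPolynomial (Fin (n + 1)) R →ₐ[R] MvPolynomial (Fin n) R :=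
  MvPolynomial.aeval (Fin.snoc (α := fun _ => MvPolynomial (Fin n) R) MvPolynomial.X
    (MvPolynomial.C c))

theorem evalLast_rename (c : R) (p : MvPolynomial (Fin n) R) :
    evalLast n c (MvPolynomial.rename Fin.castSucc p) = p := by
  rw [evalLast, MvPolynomial.aeval_rename]
  convert MvPolynomial.aeval_X_left_apply p
  funext i
  simp

variable [IsDomain R] [CharZero R]

/-- On the branch indexed by `i`, twice the last Jucys–Murphy element acts by the difference of the
two Casimir scalars. The factor 2 is cancelled in `R`. -/
theorem chiLin_jm_last_pow_mul (l : Fin M →₀ ℕ) (k : ℕ) (x : GroupAlg R n) :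
    chiLin R l (jm R (Fin.last n) ^ k * algSucc R n x) =
      ∑ i ∈ l.support, ((l i : R) - M) ^ k * chiLin R (l - Finsupp.single i 1) x := by
  induction k generalizing x with
  | zero => simp [chiLin_algSucc]
  | succ k ih =>
    refine mul_left_cancel₀ (two_ne_zero (α := R)) ?_
    -- One factor is replaced by a difference: the large swap sum is moved to the front, where it
    -- acts by its scalar, and the small one commutes through to `x`, where it acts on each branch.
    have h1 : (2 : R) • (jm R (Fin.last n) ^ (k + 1) * algSucc R n x) =
        swapSum R (n + 1) * (jm R (Fin.last n) ^ k * algSucc R n x) -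
          jm R (Fin.last n) ^ k * algSucc R n (swapSum R n * x) := by
      have hc : algSucc R n (swapSum R n) * jm R (Fin.last n) ^ k =
          jm R (Fin.last n) ^ k * algSucc R n (swapSum R n) :=
        (show Commute _ _ from algSucc_mul_jm_last (swapSum R n)).pow_right k
      rw [map_mul, ← mul_assoc (jm R (Fin.last n) ^ k), ← hc, mul_assoc (algSucc R n _), ← sub_mul,
        ← two_mul_jm_last, pow_succ', two_smul, two_mul, add_mul, mul_assoc]
    rw [← smul_eq_mul, ← map_smul, h1, map_sub, chiLin_swapSum_mul, ih, ih, mul_sum, mul_sum,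
      ← sum_sub_distrib]
    refine sum_congr rfl fun i hi => ?_
    rw [chiLin_swapSum_mul]
    have h2 := congrArg (Int.cast : ℤ → R) (casimir_sub (n := n) l hi)
    push_cast at h2
    linear_combination ((l i : R) - M) ^ k * chiLin R (l - Finsupp.single i 1) x * h2

/-- On each branch the last variable becomes a scalar, and the others remain Jucys–Murphy elements
of $S_n$. -/
theorem chiLin_jmHom_succ (l : Fin M →₀ ℕ) (f : MvPolynomial (Fin (n + 1)) R) :
    chiLin R l (jmHom R (n + 1) f) = ∑ i ∈ l.support,
      chiLin R (l - Finsupp.single i 1) (jmHom R n (evalLast n ((l i : R) - M) f)) := by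
  -- Strengthened for the induction on `f`: variables stripped from `f` are collected in the power
  -- of the last variable or in `p`.
  suffices h : ∀ (p : MvPolynomial (Fin n) R) (k : ℕ),
      chiLin R l (jmHom R (n + 1) (f * (MvPolynomial.X (Fin.last n) ^ k *
        MvPolynomial.rename Fin.castSucc p))) =
      ∑ i ∈ l.support, chiLin R (l - Finsupp.single i 1) (jmHom R n (evalLast n ((l i : R) - M)
        (f * (MvPolynomial.X (Fin.last n) ^ k * MvPolynomial.rename Fin.castSucc p)))) by
    simpa using h 1 0
  induction f using MvPolynomial.induction_on with
  | C r =>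
    intro p k
    simp_rw [MvPolynomial.C_mul', map_smul]
    rw [← smul_sum]
    congr 1
    rw [map_mul, map_pow, jmHom_X, jmHom_rename, chiLin_jm_last_pow_mul]
    refine sum_congr rfl fun i _ => ?_
    rw [map_mul, map_pow, evalLast_rename]
    simp only [evalLast, MvPolynomial.aeval_X, Fin.snoc_last]
    rw [← MvPolynomial.C_pow, MvPolynomial.C_mul', map_smul, map_smul, smul_eq_mul]
  | add p q hp hq =>
    intro p' k
    simp only [add_mul, map_add, hp, hq, sum_add_distrib]
  | mul_X f i hf =>
    intro p k
    refine Fin.lastCases ?_ (fun i => ?_) i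
    · have e : f * MvPolynomial.X (Fin.last n) * (MvPolynomial.X (Fin.last n) ^ k *
          MvPolynomial.rename Fin.castSucc p) = f * (MvPolynomial.X (Fin.last n) ^ (k + 1) *
          MvPolynomial.rename Fin.castSucc p) := by ring
      rw [e]
      exact hf _ _
    · have e : f * MvPolynomial.X i.castSucc * (MvPolynomial.X (Fin.last n) ^ k *
          MvPolynomial.rename Fin.castSucc p) = f * (MvPolynomial.X (Fin.last n) ^ k *
          MvPolynomial.rename Fin.castSucc (MvPolynomial.X i * p)) := by
        rw [map_mul (MvPolynomial.rename Fin.castSucc), MvPolynomial.rename_X]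
        ring
      rw [e]
      exact hf _ _

end Branching

/-! ### Diagrams, removal of boxes, and evaluation at contents. -/

section Partitions

variable {M n : ℕ}

/-- The exponent `λ + δ`. -/
def shifted (lam : Fin M → ℕ) : Fin M →₀ ℕ := Finsupp.equivFunOnFinite.symm lam + staircase M

theorem shifted_apply (lam : Fin M → ℕ) (i : Fin M) :
    shifted lam i = lam i + (Fin.rev i : ℕ) := rfl

/-- The multiset of contents of a diagram with given row lengths. -/
def contents (lam : Fin M → ℕ) : Multiset ℤ :=
  ∑ i, (Multiset.range (lam i)).map fun j : ℕ => (j : ℤ) - (i : ℕ)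

theorem card_contents (lam : Fin M → ℕ) : (contents lam).card = ∑ i, lam i := by
  simp [contents, Multiset.card_sum]

/-- Removing a box from a diagram yields a diagram unless the next row has the same length. -/
theorem remove_box {lam : Fin M → ℕ} (hl : Antitone lam) (hs : ∑ i, lam i = n + 1) {i : Fin M}
    (hpos : 0 < lam i) (h : ∀ j : Fin M, (j : ℕ) = i + 1 → lam j ≠ lam i) :
    ∃ lam' : Fin M → ℕ, Antitone lam' ∧ ∑ i, lam' i = n ∧
      shifted lam - Finsupp.single i 1 = shifted lam' ∧
      contents lam = ((shifted lam i : ℤ) - M) ::ₘ contents lam' := by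
  refine ⟨Function.update lam i (lam i - 1), ?_, ?_, ?_, ?_⟩
  · intro a b hab
    by_cases ha : a = i
    · subst ha
      by_cases hb : b = a
      · subst hb; simp
      · rw [Function.update_self, Function.update_of_ne hb]
        have hab' : (a : ℕ) < b := lt_of_le_of_ne hab (fun h => hb (Fin.ext h.symm))
        have hlt : (a : ℕ) + 1 < M := by have := b.2; omega
        have h1 : lam b ≤ lam ⟨a + 1, hlt⟩ := hl (by rw [Fin.le_def]; exact hab')
        have h2 : lam ⟨a + 1, hlt⟩ ≤ lam a := hl (by rw [Fin.le_def]; simp)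
        have h3 := h ⟨a + 1, hlt⟩ rfl
        omega
    · rw [Function.update_of_ne ha]
      by_cases hb : b = i
      · subst hb
        rw [Function.update_self]
        exact (Nat.sub_le _ _).trans (hl hab)
      · rw [Function.update_of_ne hb]
        exact hl hab
  · have h1 := Finset.sum_update_of_mem (mem_univ i) lam (lam i - 1)
    have h2 := Finset.add_sum_erase univ lam (mem_univ i)
    rw [sdiff_singleton_eq_erase] at h1
    omega
  · ext j
    by_cases hj : j = i
    · subst hj
      rw [Finsupp.tsub_apply, Finsupp.single_eq_same, shifted_apply, shifted_apply,
        Function.update_self]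
      omega
    · rw [Finsupp.tsub_apply, Finsupp.single_eq_of_ne hj, shifted_apply, shifted_apply,
        Function.update_of_ne hj]
      rfl
  · have h3 : (shifted lam i : ℤ) - M = ((lam i - 1 : ℕ) : ℤ) - (i : ℕ) := by
      rw [shifted_apply, Fin.val_rev]
      have := i.2
      omega
    have h4 : lam i = (lam i - 1) + 1 := by omega
    rw [h3, contents, contents, ← Finset.add_sum_erase univ _ (mem_univ i),
      ← Finset.add_sum_erase univ (fun k => (Multiset.range (Function.update lam i (lam i - 1) k)).map
        fun j : ℕ => (j : ℤ) - (k : ℕ)) (mem_univ i), Function.update_self]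
    conv_lhs => rw [h4, Multiset.range_succ, Multiset.map_cons]
    rw [Multiset.cons_add]
    congr 2
    refine sum_congr rfl fun k hk => ?_
    rw [Function.update_of_ne (ne_of_mem_erase hk)]

/-- If the next row has the same length, the removal makes two entries of the shifted exponent
equal, and the character vanishes by antisymmetry. So only removable boxes survive in the branching
rule. -/
theorem remove_box_or {lam : Fin M → ℕ} (hl : Antitone lam) (hs : ∑ i, lam i = n + 1) {i : Fin M}
    (hi : i ∈ (shifted lam).support) :
    (∀ g : Perm (Fin n), chi (shifted lam - Finsupp.single i 1) g = 0) ∨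
    ∃ lam' : Fin M → ℕ, Antitone lam' ∧ ∑ i, lam' i = n ∧
      shifted lam - Finsupp.single i 1 = shifted lam' ∧
      contents lam = ((shifted lam i : ℤ) - M) ::ₘ contents lam' := by
  by_cases h : ∃ j : Fin M, (j : ℕ) = i + 1 ∧ lam j = lam i
  · left
    obtain ⟨j, hj, hji⟩ := h
    intro g
    have hne : i ≠ j := fun h => by rw [← h] at hj; omega
    refine chi_eq_zero_of_eq _ g hne ?_
    rw [Finsupp.tsub_apply, Finsupp.tsub_apply, Finsupp.single_eq_same,
      Finsupp.single_eq_of_ne hne.symm, shifted_apply, shifted_apply, hji, Fin.val_rev, Fin.val_rev]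
    have := j.2
    omega
  · right
    push Not at h
    refine remove_box hl hs ?_ h
    -- An empty row in the support is not the last row, and the row below it is empty too, so the
    -- two have equal length, against `h`.
    by_contra h0
    have h0 : lam i = 0 := by omega
    rw [Finsupp.mem_support_iff, shifted_apply, h0, Fin.val_rev] at hi
    have hlt : (i : ℕ) + 1 < M := by omega
    have h1 : lam ⟨i + 1, hlt⟩ ≤ lam i := hl (by rw [Fin.le_def]; simp)
    exact h ⟨i + 1, hlt⟩ rfl (by omega)

/-- In the branching rule every term is zero or, inductively, positive, and the last nonempty row
always has a removable box. -/
theorem chi_one_pos {lam : Fin M → ℕ} (hl : Antitone lam) (hs : ∑ i, lam i = n) :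
    0 < chi (shifted lam) (1 : Perm (Fin n)) := by
  induction n generalizing lam with
  | zero =>
    have h0 : shifted lam = staircase M := by
      ext i
      have := (Finset.sum_eq_zero_iff.1 hs) i (mem_univ _)
      rw [shifted_apply, this, zero_add]
      rfl
    rw [chi_zero, h0, coeff_alternant_staircase]
    exact one_pos
  | succ n ih =>
    rw [← map_one (permSucc n), chi_permSucc]
    have hnn : ∀ i ∈ (shifted lam).support,
        0 ≤ chi (shifted lam - Finsupp.single i 1) (1 : Perm (Fin n)) := by
      intro i hi
      rcases remove_box_or hl hs hi with h | ⟨lam', h1, h2, h3, -⟩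
      · rw [h]
      · rw [h3]; exact (ih h1 h2).le
    have hne : (univ.filter fun i => 0 < lam i).Nonempty := by
      by_contra hne
      rw [not_nonempty_iff_eq_empty, filter_eq_empty_iff] at hne
      have : ∑ i, lam i = 0 := sum_eq_zero fun i hi => by have := hne hi; omega
      omega
    obtain ⟨i, hi, hmax⟩ := exists_max_image _ (fun i => i) hne
    have hipos := (mem_filter.1 hi).2
    have his : i ∈ (shifted lam).support := by
      rw [Finsupp.mem_support_iff, shifted_apply]; omega
    refine sum_pos' hnn ⟨i, his, ?_⟩
    obtain ⟨lam', h1, h2, h3, -⟩ := remove_box hl hs hipos (fun j hj hji => by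
      have := hmax j (mem_filter.2 ⟨mem_univ _, by omega⟩)
      have : (j : ℕ) ≤ i := this
      omega)
    rw [h3]
    exact ih h1 h2

theorem exists_fin_map_eq {A : Type*} (s : Multiset A) (h : s.card = n) :
    ∃ c : Fin n → A, univ.val.map c = s := by
  subst h
  obtain ⟨l, rfl⟩ := Quot.exists_rep s
  refine ⟨l.get, ?_⟩
  change Multiset.map (fun i : Fin l.length => l.get i) univ.val = (l : Multiset A)
  rw [Fin.univ_val_map, List.ofFn_get]

theorem exists_perm_comp_eq {r : ℕ} {A : Type*} [DecidableEq A] {f f' : Fin r → A}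
    (h : univ.val.map f = univ.val.map f') : ∃ σ : Perm (Fin r), f ∘ σ = f' := by
  have e : ∀ a, Nonempty ({i // f' i = a} ≃ {i // f i = a}) := by
    intro a
    have h1 := congrArg (Multiset.count a) h.symm
    rw [Multiset.count_map, Multiset.count_map] at h1
    refine ⟨Fintype.equivOfCardEq ?_⟩
    rw [Fintype.card_subtype, Fintype.card_subtype]
    simp only [eq_comm (a := a)] at h1
    exact h1
  exact ⟨Equiv.ofFiberEquiv (fun a => (e a).some),
    funext fun i => Equiv.ofFiberEquiv_map (fun a => (e a).some) i⟩

theorem eval_eq_of_map_eq {R : Type*} [CommRing R] {f : MvPolynomial (Fin n) R} (hf : f.IsSymmetric)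
    {c c' : Fin n → R} (h : (univ.val.map c : Multiset R) = univ.val.map c') :
    MvPolynomial.eval c f = MvPolynomial.eval c' f := by
  classical
  obtain ⟨σ, rfl⟩ := exists_perm_comp_eq h
  rw [← MvPolynomial.eval_rename, hf σ]

theorem evalLast_isSymmetric {R : Type*} [CommRing R] {f : MvPolynomial (Fin (n + 1)) R}
    (hf : f.IsSymmetric) (c : R) : (evalLast n c f).IsSymmetric := by
  intro e
  conv_rhs => rw [← hf (permSucc n e)]
  rw [evalLast, MvPolynomial.aeval_rename, ← AlgHom.comp_apply]
  congr 1
  ext i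
  refine Fin.lastCases ?_ (fun i => ?_) i <;> simp

theorem eval_evalLast {R : Type*} [CommRing R] (f : MvPolynomial (Fin (n + 1)) R) (a : R)
    (c : Fin n → R) : MvPolynomial.eval c (evalLast n a f) =
      MvPolynomial.eval (Fin.snoc (α := fun _ => R) c a) f := by
  have : (MvPolynomial.aeval c).comp (evalLast n a) =
      (MvPolynomial.aeval (Fin.snoc (α := fun _ => R) c a) : MvPolynomial (Fin (n + 1)) R →ₐ[R] R) := by
    ext i
    refine Fin.lastCases ?_ (fun i => ?_) i <;> simp [evalLast]
  exact DFunLike.congr_fun this f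

/-- The normalized characters evaluate symmetric polynomials in the Jucys–Murphy elements at the
contents of the diagram. -/
theorem chiLin_jmHom {R : Type*} [CommRing R] [IsDomain R] [CharZero R] {lam : Fin M → ℕ}
    (hl : Antitone lam) (hs : ∑ i, lam i = n) {f : MvPolynomial (Fin n) R} (hf : f.IsSymmetric)
    (c : Fin n → R) (hc : univ.val.map c = (contents lam).map (Int.cast : ℤ → R)) :
    chiLin R (shifted lam) (jmHom R n f) =
      MvPolynomial.eval c f * chi (shifted lam) (1 : Perm (Fin n)) := by
  induction n generalizing lam with
  | zero =>
    obtain ⟨r, rfl⟩ := MvPolynomial.C_surjective (Fin 0) f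
    rw [MvPolynomial.eval_C, MvPolynomial.C_eq_algebraMap, AlgHom.commutes,
      Algebra.algebraMap_eq_smul_one, map_smul, ← map_one (MonoidAlgebra.of R (Perm (Fin 0))),
      chiLin_perm, smul_eq_mul]
  | succ n ih =>
    rw [chiLin_jmHom_succ, ← map_one (permSucc n), chi_permSucc, Int.cast_sum, mul_sum]
    refine sum_congr rfl fun i hi => ?_
    rcases remove_box_or hl hs hi with h | ⟨lam', h1, h2, h3, h4⟩
    · have h0 : chiLin R (n := n) (shifted lam - Finsupp.single i 1) = 0 :=
        linearMap_ext_perm fun g => by rw [chiLin_perm, h]; simp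
      rw [h0, h]
      simp
    -- The value substituted for the last variable is the content of the removed box, so appending
    -- it to the contents of the smaller diagram gives those of `lam`; by symmetry of `f` their
    -- order is irrelevant.
    · obtain ⟨c', hc'⟩ := exists_fin_map_eq ((contents lam').map (Int.cast : ℤ → R))
        (n := n) (by rw [Multiset.card_map, card_contents, h2])
      rw [h3, ih h1 h2 (evalLast_isSymmetric hf _) c' hc', eval_evalLast]
      congr 1
      refine eval_eq_of_map_eq hf ?_
      rw [hc, h4, Multiset.map_cons, ← hc', Fin.univ_val_map, Fin.univ_val_map, List.ofFn_succ']
      simp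

end Partitions

end

end QuantumHurwitz

open scoped PowerSeries Polynomial

namespace QuantumHurwitz

noncomputable section

/-! ### Complete symmetric functions in the flow parameters -/

open Equiv Finset
open scoped IsMulCommutative

/-! ### Sizes of conjugacy classes. -/

section ClassSize

variable {n : ℕ}

/-- The size formula for `Perm.cycleType` treats fixed points separately, so the parts equal to 1
are split off and then put back into the product of factorials. -/
theorem card_class_mul (μ : n.Partition) : #{g : Perm (Fin n) | cycleClass g = μ} *
    (μ.parts.prod * ∏ i ∈ μ.parts.toFinset, (μ.parts.count i).factorial) = n.factorial := by
  set m := μ.parts.filter (2 ≤ ·) with hm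
  have h2 : μ.parts.filter (2 ≤ ·) + μ.parts.filter (fun a => ¬ 2 ≤ a) = μ.parts :=
    Multiset.filter_add_not (2 ≤ ·) μ.parts
  have h3 : μ.parts.filter (fun a => ¬ 2 ≤ a) = Multiset.replicate (μ.parts.count 1) 1 := by
    rw [← Multiset.filter_eq']
    refine Multiset.filter_congr fun b hb => ?_
    have := μ.parts_pos hb
    constructor <;> intro h <;> omega
  rw [h3, ← hm] at h2
  have hsum : m.sum + μ.parts.count 1 = n := by
    conv_rhs => rw [← μ.parts_sum, ← h2]
    simp
  have hprod : m.prod = μ.parts.prod := by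
    conv_rhs => rw [← h2]
    simp
  have hfac : (∏ i ∈ m.toFinset, (m.count i).factorial) * (μ.parts.count 1).factorial =
      ∏ i ∈ μ.parts.toFinset, (μ.parts.count i).factorial := by
    have h4 : m.toFinset = μ.parts.toFinset.erase 1 := by
      ext i
      simp only [hm, Multiset.mem_toFinset, Multiset.mem_filter, mem_erase]
      constructor
      · rintro ⟨h5, h6⟩; exact ⟨by omega, h5⟩
      · rintro ⟨h5, h6⟩
        have := μ.parts_pos h6
        exact ⟨h6, by omega⟩
    have h5 : ∏ i ∈ m.toFinset, (m.count i).factorial =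
        ∏ i ∈ m.toFinset, (μ.parts.count i).factorial := by
      refine prod_congr rfl fun i hi => ?_
      rw [hm, Multiset.count_filter_of_pos]
      exact (Multiset.mem_filter.1 (Multiset.mem_toFinset.1 hi)).2
    rw [h5, h4]
    by_cases h6 : 1 ∈ μ.parts.toFinset
    · rw [prod_erase_mul _ _ h6]
    · rw [erase_eq_of_notMem h6, Multiset.count_eq_zero_of_notMem (fun h => h6 (by simpa using h))]
      simp
  have h := Perm.card_of_cycleType_mul_eq (Fin n) m
  rw [if_pos, Fintype.card_fin] at h
  · rw [← h, ← hprod, ← hfac, show n - m.sum = μ.parts.count 1 by omega]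
    have h7 : (univ.filter fun g : Perm (Fin n) => cycleClass g = μ) =
        univ.filter fun g : Perm (Fin n) => g.cycleType = m := by
      refine filter_congr fun g _ => ?_
      obtain ⟨g', rfl⟩ := cycleClass_surjective μ
      have h8 : m = g'.cycleType := Perm.filter_parts_partition_eq_cycleType
      rw [cycleClass_eq_iff, Perm.isConj_iff_cycleType_eq, h8]
    rw [h7]
    ring
  · rw [Fintype.card_fin]
    exact ⟨by omega, fun a ha => (Multiset.mem_filter.1 ha).2⟩

end ClassSize

/-! ### The generating function of the complete symmetric functions. -/

section Complete

variable {A : Type*} [CommRing A]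

theorem prod_map_pow_eq (y : A) (s : Multiset ℕ) : (s.map fun k => y ^ k).prod = y ^ s.sum := by
  induction s using Multiset.induction_on with
  | empty => simp
  | cons a s ih => rw [Multiset.map_cons, Multiset.prod_cons, ih, Multiset.sum_cons, pow_add]

theorem powerSum_eq (x : ℕ → A) {n : ℕ} (μ : n.Partition) : powerSum x μ =
    (μ.parts.prod : A) * ∏ i ∈ μ.parts.toFinset, x i ^ μ.parts.count i := by
  rw [powerSum, Multiset.prod_map_mul, Finset.prod_multiset_map_count μ.parts x,
    Nat.cast_multiset_prod]

theorem powerSum_mul_pow (x : ℕ → A) (y : A) {n : ℕ} (μ : n.Partition) :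
    powerSum (fun k => x k * y ^ k) μ = y ^ n * powerSum x μ := by
  have h : y ^ n = (μ.parts.map fun k => y ^ k).prod := by
    rw [prod_map_pow_eq, μ.parts_sum]
  rw [h, powerSum, powerSum, ← Multiset.prod_map_mul]
  congr 2
  funext k
  ring

variable [Algebra ℚ A]

/-- The generating function of the complete symmetric functions. -/
def completeGen (x : ℕ → A) : A⟦X⟧ := PowerSeries.mk fun n => completeSym x n

theorem completeSym_natCast (x : ℕ → A) (n : ℕ) : completeSym x (n : ℤ) =
    ∑ μ : n.Partition, ∏ i ∈ μ.parts.toFinset,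
      ((μ.parts.count i).factorial : ℚ)⁻¹ • x i ^ μ.parts.count i := rfl

/-- The cycle index formula: the summand of a partition, times $n!$, is its power sum product times
its class size. -/
theorem completeSym_eq_sum_perm (x : ℕ → A) (n : ℕ) : completeSym x (n : ℤ) =
    ((n.factorial : ℚ)⁻¹) • ∑ g : Perm (Fin n), powerSum x (cycleClass g) := by
  rw [completeSym_natCast, ← sum_fiberwise univ (cycleClass (n := n)), smul_sum]
  refine sum_congr rfl fun μ _ => ?_
  rw [sum_congr rfl (g := fun _ => powerSum x μ)
    (fun g hg => by rw [(mem_filter.1 hg).2]), sum_const, ← Nat.cast_smul_eq_nsmul ℚ, smul_smul,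
    powerSum_eq, prod_smul, ← card_class_mul μ]
  rw [← map_natCast (algebraMap ℚ A), ← Algebra.smul_def, smul_smul]
  congr 1
  have h := card_class_mul μ
  have h1 : (#{g : Perm (Fin n) | cycleClass g = μ} : ℚ) ≠ 0 := by
    intro h0
    rw [Nat.cast_eq_zero] at h0
    rw [h0, zero_mul] at h
    exact (Nat.factorial_pos n).ne h
  have h2 : (μ.parts.prod : ℚ) ≠ 0 := by
    intro h0
    rw [Nat.cast_eq_zero] at h0
    rw [h0, zero_mul, mul_zero] at h
    exact (Nat.factorial_pos n).ne h
  have h3 : ∏ i ∈ μ.parts.toFinset, ((μ.parts.count i).factorial : ℚ) ≠ 0 :=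
    prod_ne_zero_iff.2 fun i _ => Nat.cast_ne_zero.2 (Nat.factorial_ne_zero _)
  push_cast
  rw [prod_inv_distrib]
  push_cast at h2
  field_simp

theorem completeGen_eq_genFun (x : ℕ → A) : completeGen x =
    Nat.Partition.genFun fun i c => ((c.factorial : ℚ)⁻¹) • x i ^ c := by
  ext n
  rw [completeGen, PowerSeries.coeff_mk, completeSym_natCast, Nat.Partition.coeff_genFun]
  refine sum_congr rfl fun μ _ => ?_
  simp [Finsupp.prod]

-- The factor of the parts equal to $i+1$ in the partition generating function is $\exp(az^{i+1})$.
open scoped PowerSeries.WithPiTopology in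
theorem genFun_factor [TopologicalSpace A] [DiscreteTopology A] (a : A) (i : ℕ) :
    (1 : A⟦X⟧) + ∑' j : ℕ, (((j + 1).factorial : ℚ)⁻¹ • a ^ (j + 1)) •
      (PowerSeries.X : A⟦X⟧) ^ ((i + 1) * (j + 1)) =
    PowerSeries.expand (i + 1) i.succ_ne_zero (PowerSeries.rescale a (PowerSeries.exp A)) := by
  have hs := Nat.Partition.summable_genFun_term (R := A)
    (fun _ c => ((c.factorial : ℚ)⁻¹) • a ^ c) i
  ext m
  rw [map_add, hs.map_tsum _ (PowerSeries.WithPiTopology.continuous_coeff _ _)]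
  simp only [map_smul, PowerSeries.coeff_X_pow, smul_eq_mul, mul_ite, mul_one, mul_zero]
  rw [PowerSeries.coeff_expand, PowerSeries.coeff_one]
  by_cases hm : i + 1 ∣ m
  · obtain ⟨k, rfl⟩ := hm
    rw [if_pos (dvd_mul_right _ _), Nat.mul_div_cancel_left _ i.succ_pos]
    cases k with
    | zero => simp
    | succ k =>
      rw [if_neg (by positivity), tsum_eq_single k, if_pos rfl, zero_add, PowerSeries.coeff_rescale,
        PowerSeries.coeff_exp, Algebra.smul_def, one_div, mul_comm]
      intro j hj
      rw [if_neg]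
      intro h
      have := Nat.eq_of_mul_eq_mul_left i.succ_pos h
      omega
  · have h0 : ∀ j, m ≠ (i + 1) * (j + 1) := fun j h => hm ⟨j + 1, h⟩
    rw [if_neg hm, if_neg (fun h : m = 0 => hm (h ▸ dvd_zero _))]
    simp [h0]

/-- The generating function is the infinite product of the $\exp(x_iz^i)$, and the exponential turns
sums into products. The discrete topology on `A` gives the infinite product a meaning. -/
theorem completeGen_add (x x' : ℕ → A) :
    completeGen (x + x') = completeGen x * completeGen x' := by
  let _ : TopologicalSpace A := ⊥
  have : DiscreteTopology A := ⟨rfl⟩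
  open scoped PowerSeries.WithPiTopology in
  have h : ∀ x : ℕ → A, HasProd (fun i => PowerSeries.expand (i + 1) i.succ_ne_zero
      (PowerSeries.rescale (x (i + 1)) (PowerSeries.exp A))) (completeGen x) := by
    intro x
    rw [completeGen_eq_genFun]
    simp only [← genFun_factor]
    exact Nat.Partition.hasProd_genFun (R := A) fun i c => ((c.factorial : ℚ)⁻¹) • x i ^ c
  have h1 := (h x).mul (h x')
  simp only [← map_mul, PowerSeries.exp_mul_exp_eq_exp_add] at h1
  exact (h (x + x')).unique h1

theorem completeGen_zero : completeGen (0 : ℕ → A) = 1 := by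
  ext n
  rw [completeGen, PowerSeries.coeff_mk, completeSym_eq_sum_perm, PowerSeries.coeff_one]
  cases n with
  | zero =>
    have : (cycleClass (1 : Perm (Fin 0))).parts = 0 := by
      rw [← Multiset.card_eq_zero]
      exact Nat.le_zero.1 (cycleCount_le _)
    rw [univ_unique, sum_singleton]
    rw [show (default : Perm (Fin 0)) = 1 from Subsingleton.elim _ _, powerSum, this]
    simp
  | succ n =>
    rw [if_neg (Nat.succ_ne_zero n), sum_eq_zero, smul_zero]
    intro g _
    rw [powerSum]
    refine Multiset.prod_eq_zero ?_
    have : (cycleClass g).parts ≠ 0 := by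
      intro h
      have := (cycleClass g).parts_sum
      rw [h] at this
      simp at this
    obtain ⟨a, ha⟩ := Multiset.exists_mem_of_ne_zero this
    exact Multiset.mem_map.2 ⟨a, ha, by simp⟩

theorem completeGen_sum {ι : Type*} (s : Finset ι) (x : ι → ℕ → A) :
    completeGen (∑ i ∈ s, x i) = ∏ i ∈ s, completeGen (x i) := by
  classical
  induction s using Finset.induction_on with
  | empty => simp [completeGen_zero]
  | insert a s ha ih => rw [sum_insert ha, prod_insert ha, completeGen_add, ih]

theorem completeGen_mul_pow (x : ℕ → A) (y : A) :
    completeGen (fun k => x k * y ^ k) = PowerSeries.rescale y (completeGen x) := by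
  ext n
  rw [PowerSeries.coeff_rescale, completeGen, completeGen, PowerSeries.coeff_mk,
    PowerSeries.coeff_mk, completeSym_eq_sum_perm, completeSym_eq_sum_perm]
  simp_rw [powerSum_mul_pow]
  rw [← mul_sum, mul_smul_comm]

/-- `h_n` at the product of the flow parameters with power sums. -/
theorem completeGen_mul_psum {ι : Type*} [Fintype ι] (x : ℕ → A) (y : ι → A) :
    completeGen (fun k => x k * ∑ i, y i ^ k) = ∏ i, PowerSeries.rescale (y i) (completeGen x) := by
  simp_rw [← completeGen_mul_pow]
  rw [← completeGen_sum]
  congr 1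
  funext k
  simp [mul_sum, Finset.sum_apply]

/-- With $x_k=y^k/k$ every power sum product of degree $n$ equals $y^n$, so the average over $S_n$
is $y^n$. -/
theorem completeGen_geometric (y : A) :
    completeGen (fun k => (k : ℚ)⁻¹ • y ^ k) = PowerSeries.mk fun n => y ^ n := by
  ext n
  rw [completeGen, PowerSeries.coeff_mk, PowerSeries.coeff_mk, completeSym_eq_sum_perm]
  have : ∀ μ : n.Partition, powerSum (fun k => (k : ℚ)⁻¹ • y ^ k) μ = y ^ n := by
    intro μ
    conv_rhs => rw [← μ.parts_sum, ← prod_map_pow_eq]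
    rw [powerSum]
    congr 1
    refine Multiset.map_congr rfl fun k hk => ?_
    have : (k : ℚ) ≠ 0 := Nat.cast_ne_zero.2 (μ.parts_pos hk).ne'
    rw [← map_natCast (algebraMap ℚ A), ← Algebra.smul_def, smul_smul, mul_inv_cancel₀ this, one_smul]
  simp_rw [this]
  rw [sum_const, card_univ, Fintype.card_perm, Fintype.card_fin, ← Nat.cast_smul_eq_nsmul ℚ,
    smul_smul, inv_mul_cancel₀ (Nat.cast_ne_zero.2 (Nat.factorial_ne_zero n)), one_smul]

end Complete

end

end QuantumHurwitz

open scoped PowerSeries Polynomial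

namespace QuantumHurwitz

noncomputable section

/-! ### The Jacobi–Trudi determinants and the orthogonality relations -/

open Equiv Finset
open scoped IsMulCommutative

section JacobiTrudi

variable {A : Type*} [CommRing A] {M n : ℕ}

theorem coeff_alternant_mul_colPoly (l : Fin M →₀ ℕ) (g : Perm (Fin n)) :
    (alternant A M * colPoly A M g).coeff l = (chi l g : A) := by
  have h : alternant A M * colPoly A M g =
      MvPolynomial.map (Int.castRingHom A) (alternant ℤ M * colPoly ℤ M g) := by
    rw [map_mul]
    congr 1
    · rw [alternant, alternant, RingHom.map_det]
      congr 1
      ext i j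
      simp
    · simp [colPoly, map_sum, map_prod]
  rw [h, MvPolynomial.coeff_map, chi]
  rfl

theorem chi_congr (l : Fin M →₀ ℕ) {g h : Perm (Fin n)} (hgh : cycleClass g = cycleClass h) :
    chi l g = chi l h := by
  rw [chi, chi, colPoly_eq_prod, colPoly_eq_prod, hgh]

theorem mk_pow_mul (y : A) :
    (PowerSeries.mk fun n => y ^ n) * (1 - PowerSeries.C y * PowerSeries.X) = 1 := by
  ext n
  rw [mul_sub, mul_one, mul_left_comm, map_sub, PowerSeries.coeff_C_mul, PowerSeries.coeff_one]
  cases n with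
  | zero => simp
  | succ n => simp [PowerSeries.coeff_succ_mul_X, pow_succ']

variable [Algebra ℚ A]

theorem completeSym_of_neg (x : ℕ → A) {k : ℤ} (hk : k < 0) : completeSym x k = 0 := by
  obtain ⟨m, rfl⟩ := Int.eq_negSucc_of_lt_zero hk
  rfl

theorem coeff_completeGen (x : ℕ → A) (n : ℕ) :
    PowerSeries.coeff n (completeGen x) = completeSym x n := by
  rw [completeGen, PowerSeries.coeff_mk]

theorem completeSym_map {A' : Type*} [CommRing A'] [Algebra ℚ A'] (φ : A →ₐ[ℚ] A') (x : ℕ → A)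
    (k : ℤ) : φ (completeSym x k) = completeSym (fun i => φ (x i)) k := by
  cases k with
  | ofNat k => simp [completeSym, map_sum, map_prod]
  | negSucc k => simp [completeSym]

/-- The determinants of complete symmetric functions in terms of the characters `χ_l`. -/
theorem det_completeSym (x : ℕ → A) (l : Fin M →₀ ℕ) (hl : ∑ i, l i = n + ∑ i, staircase M i) :
    Matrix.det (Matrix.of fun i j : Fin M => completeSym x ((l i : ℤ) - (staircase M j : ℤ))) =
      ((n.factorial : ℚ)⁻¹) • ∑ g : Perm (Fin n), (chi l g : A) * powerSum x (cycleClass g) := by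
  let y : Fin M → MvPolynomial (Fin M) A := MvPolynomial.X
  let x' : ℕ → MvPolynomial (Fin M) A := fun k => MvPolynomial.C (x k)
  have hx' : ∀ k, completeSym x' k = MvPolynomial.C (completeSym x k) := fun k =>
    (completeSym_map ((Algebra.ofId A (MvPolynomial (Fin M) A)).restrictScalars ℚ) x k).symm
  -- The degree $n$ part of $\prod_iH(y_iz)$ is computed twice: factor by factor here, and through
  -- power sums in `h2`. Multiplying both by the alternant and taking the coefficient of $y^l$ gives
  -- the determinant on one side and the $\chi_l$ on the other.
  have h1 : PowerSeries.coeff n (completeGen fun k => x' k * ∑ i, y i ^ k) =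
      ∑ k ∈ finsuppAntidiag univ n, MvPolynomial.monomial k (∏ i, completeSym x (k i)) := by
    rw [completeGen_mul_psum, PowerSeries.coeff_prod]
    refine sum_congr rfl fun k _ => ?_
    rw [MvPolynomial.monomial_eq, Finsupp.prod_fintype _ _ (fun i => pow_zero _), map_prod,
      ← prod_mul_distrib]
    refine prod_congr rfl fun i _ => ?_
    rw [PowerSeries.coeff_rescale, coeff_completeGen, hx', mul_comm]
  have h2 : PowerSeries.coeff n (completeGen fun k => x' k * ∑ i, y i ^ k) =
      ((n.factorial : ℚ)⁻¹) • ∑ g : Perm (Fin n),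
        MvPolynomial.C (powerSum x (cycleClass g)) * colPoly A M g := by
    rw [coeff_completeGen, completeSym_eq_sum_perm]
    congr 1
    refine sum_congr rfl fun g _ => ?_
    rw [colPoly_eq_prod, powerSum, powerSum, map_multiset_prod, Multiset.map_map,
      ← Multiset.prod_map_mul]
    congr 2
    funext k
    simp [x', y, mul_assoc]
  have h3 := congrArg (fun p => (alternant A M * p).coeff l) (h1.symm.trans h2)
  beta_reduce at h3
  have h4 : (alternant A M * ((n.factorial : ℚ)⁻¹) • ∑ g : Perm (Fin n),
        MvPolynomial.C (powerSum x (cycleClass g)) * colPoly A M g).coeff l =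
      ((n.factorial : ℚ)⁻¹) • ∑ g : Perm (Fin n), (chi l g : A) * powerSum x (cycleClass g) := by
    rw [mul_smul_comm, MvPolynomial.coeff_smul, mul_sum, MvPolynomial.coeff_sum]
    congr 1
    refine sum_congr rfl fun g _ => ?_
    rw [mul_left_comm, MvPolynomial.coeff_C_mul, coeff_alternant_mul_colPoly, mul_comm]
  rw [← h4, ← h3, alternant_eq_sum, sum_mul, MvPolynomial.coeff_sum, Matrix.det_apply']
  refine sum_congr rfl fun σ _ => ?_
  rw [MvPolynomial.coeff_monomial_mul', MvPolynomial.coeff_sum]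
  simp_rw [MvPolynomial.coeff_monomial]
  rw [← Equiv.prod_comp σ.symm]
  simp only [apply_symm_apply, Matrix.of_apply]
  split_ifs with hle
  · congr 1
    rw [sum_ite_eq', if_pos]
    · refine prod_congr rfl fun i _ => ?_
      have := hle i
      rw [Finsupp.equivMapDomain_apply] at this
      rw [Finsupp.tsub_apply, Finsupp.equivMapDomain_apply, Nat.cast_sub this]
    · rw [mem_finsuppAntidiag]
      refine ⟨?_, subset_univ _⟩
      have h5 : ∑ i, (l - Finsupp.equivMapDomain σ (staircase M) : Fin M →₀ ℕ) i +
          ∑ i, Finsupp.equivMapDomain σ (staircase M) i = ∑ i, l i := by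
        rw [← sum_add_distrib]
        refine sum_congr rfl fun i _ => ?_
        rw [Finsupp.tsub_apply, Nat.sub_add_cancel (hle i)]
      have h6 : ∑ i, Finsupp.equivMapDomain σ (staircase M) i = ∑ i, staircase M i := by
        rw [← Equiv.sum_comp σ.symm (fun i => staircase M i)]
        rfl
      change ∑ i, (l - Finsupp.equivMapDomain σ (staircase M) : Fin M →₀ ℕ) i = n
      omega
  -- A permutation whose exponent does not fit under `l` contributes nothing to the coefficient; in
  -- the determinant its term has a factor of negative index, which is 0.
  · rw [Finsupp.le_def] at hle
    push Not at hle
    obtain ⟨i, hi⟩ := hle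
    rw [prod_eq_zero (mem_univ i), mul_zero]
    refine completeSym_of_neg _ ?_
    rw [Finsupp.equivMapDomain_apply] at hi
    omega

/-- The flow parameters given by finitely many variables. -/
def powerFlow (y : Fin M → A) (k : ℕ) : A := (k : ℚ)⁻¹ • ∑ i, y i ^ k

theorem completeGen_powerFlow (y : Fin M → A) :
    completeGen (powerFlow y) = ∏ i, PowerSeries.mk fun n => y i ^ n := by
  simp_rw [← completeGen_geometric]
  rw [← completeGen_sum]
  congr 1
  funext k
  simp [powerFlow, Finset.sum_apply, smul_sum]

theorem powerSum_powerFlow (y : Fin M → A) (μ : n.Partition) :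
    powerSum (powerFlow y) μ = (μ.parts.map fun k => ∑ i, y i ^ k).prod := by
  rw [powerSum]
  congr 1
  refine Multiset.map_congr rfl fun k hk => ?_
  have : (k : ℚ) ≠ 0 := Nat.cast_ne_zero.2 (μ.parts_pos hk).ne'
  rw [powerFlow, ← map_natCast (algebraMap ℚ A), ← Algebra.smul_def, smul_smul,
    mul_inv_cancel₀ this, one_smul]

/-- The bialternant formula. -/
theorem det_completeSym_mul (y : Fin M → A) (l : Fin M → ℕ) :
    Matrix.det (Matrix.of fun i j : Fin M =>
      completeSym (powerFlow y) ((l i : ℤ) - (staircase M j : ℤ))) *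
      Matrix.det (Matrix.of fun j i : Fin M => y j ^ staircase M i) =
    Matrix.det (Matrix.of fun i j : Fin M => y j ^ l i) := by
  classical
  -- $E_j=\prod_{k\ne j}(1-y_kz)$ cancels all factors of $H(z)=\prod_k(1-y_kz)^{-1}$ but the one
  -- with $y_j$. Comparing coefficients, the matrix of complete functions times the matrix of
  -- coefficients of the $E_j$ is $(y_j^{l_i})$; since $\deg E_j<M$, an inner size of $M$ suffices.
  let E : Fin M → A[X] := fun j => ∏ k ∈ univ.erase j, (1 - Polynomial.C (y k) * Polynomial.X)
  have hdeg : ∀ j m, M ≤ m → (E j).coeff m = 0 := by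
    intro j m hm
    refine Polynomial.coeff_eq_zero_of_natDegree_lt (lt_of_lt_of_le ?_ hm)
    refine lt_of_le_of_lt (Polynomial.natDegree_prod_le _ _) ?_
    refine lt_of_le_of_lt (sum_le_card_nsmul _ _ 1 fun k _ => ?_) ?_
    · compute_degree
    · rw [card_erase_of_mem (mem_univ j), card_univ, Fintype.card_fin]
      have := j.2
      simp only [smul_eq_mul, mul_one]
      omega
  have hprod : ∀ j, completeGen (powerFlow y) * (E j : A⟦X⟧) = PowerSeries.mk fun n => y j ^ n := by
    intro j
    rw [completeGen_powerFlow, ← mul_prod_erase _ _ (mem_univ j)]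
    have h1 : (E j : A⟦X⟧) = ∏ k ∈ univ.erase j, (1 - PowerSeries.C (y k) * PowerSeries.X) := by
      rw [← Polynomial.coeToPowerSeries.ringHom_apply, map_prod]
      simp
    rw [h1, mul_assoc, ← prod_mul_distrib, prod_congr rfl (fun k _ => mk_pow_mul (y k)),
      prod_const_one, mul_one]
  have key : ∀ (m : ℕ) j, ∑ k : Fin M, completeSym (powerFlow y) ((m : ℤ) - (staircase M k : ℤ)) *
      (E j).coeff (staircase M k) = y j ^ m := by
    intro m j
    have h1 := congrArg (PowerSeries.coeff m) (hprod j)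
    rw [PowerSeries.coeff_mk, mul_comm, PowerSeries.coeff_mul,
      Finset.Nat.sum_antidiagonal_eq_sum_range_succ_mk] at h1
    simp only [Polynomial.coeff_coe, coeff_completeGen] at h1
    rw [← h1, ← Equiv.sum_comp Fin.revPerm]
    simp only [Fin.revPerm_apply, staircase_apply, Fin.rev_rev]
    rw [Fin.sum_univ_eq_sum_range (fun k => completeSym (powerFlow y) ((m : ℤ) - (k : ℤ)) *
      (E j).coeff k)]
    have h2 : ∀ k, k ∉ range (m + 1) → completeSym (powerFlow y) ((m : ℤ) - (k : ℤ)) *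
        (E j).coeff k = 0 := by
      intro k hk
      rw [mem_range] at hk
      rw [completeSym_of_neg _ (by omega), zero_mul]
    have h3 : ∀ k, k ∉ range M → completeSym (powerFlow y) ((m : ℤ) - (k : ℤ)) *
        (E j).coeff k = 0 := by
      intro k hk
      rw [mem_range] at hk
      rw [hdeg j k (by omega), mul_zero]
    rw [← sum_inter_add_sum_sdiff (range M) (range (m + 1)),
      sum_eq_zero (s := range M \ range (m + 1)) (fun k hk => h2 k (mem_sdiff.1 hk).2), add_zero,
      inter_comm]
    have h4 : ∑ k ∈ range (m + 1), (E j).coeff k * completeSym (powerFlow y) ((m - k : ℕ) : ℤ) =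
        ∑ k ∈ range (m + 1), completeSym (powerFlow y) ((m : ℤ) - (k : ℤ)) * (E j).coeff k := by
      refine sum_congr rfl fun k hk => ?_
      rw [Nat.cast_sub (Nat.lt_succ_iff.1 (mem_range.1 hk)), mul_comm]
    rw [h4, ← sum_inter_add_sum_sdiff (range (m + 1)) (range M),
      sum_eq_zero (s := range (m + 1) \ range M) (fun k hk => h3 k (mem_sdiff.1 hk).2), add_zero]
  have hmat : ∀ l : Fin M → ℕ, (Matrix.of fun i j : Fin M =>
      completeSym (powerFlow y) ((l i : ℤ) - (staircase M j : ℤ))) *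
      (Matrix.of fun k j : Fin M => (E j).coeff (staircase M k)) =
      Matrix.of fun i j : Fin M => y j ^ l i := by
    intro l
    ext i j
    rw [Matrix.mul_apply]
    exact key (l i) j
  have h1 := congrArg Matrix.det (hmat l)
  have h2 := congrArg Matrix.det (hmat fun i => staircase M i)
  rw [Matrix.det_mul] at h1 h2
  -- For `l` the staircase the matrix of complete functions is unitriangular, so the determinant of
  -- the coefficients of the $E_j$ is the alternant.
  rw [Matrix.det_of_isUpperTriangular, prod_eq_one, one_mul] at h2
  · rw [← h1, h2, ← Matrix.det_transpose (Matrix.of fun i j : Fin M => y j ^ staircase M i)]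
    rfl
  · intro i _
    rw [Matrix.of_apply, sub_self]
    have := coeff_completeGen (powerFlow y) 0
    rw [completeGen_powerFlow, PowerSeries.coeff_zero_eq_constantCoeff_apply, map_prod,
      prod_eq_one] at this
    · exact this.symm
    · intro i _
      rw [← PowerSeries.coeff_zero_eq_constantCoeff_apply, PowerSeries.coeff_mk, pow_zero]
  · intro i j hij
    rw [Matrix.of_apply]
    refine completeSym_of_neg _ ?_
    simp only [id] at hij
    have : (j : ℕ) < i := hij
    simp only [staircase_apply, Fin.val_rev]
    omega

end JacobiTrudi

/-! ### First orthogonality relation and shifted exponents. -/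

section Orthogonality

variable {M n : ℕ}

/-- First orthogonality relation. -/
theorem sum_chi_mul_chi {l l' : Fin M →₀ ℕ} (hl : StrictAnti l) (hl' : StrictAnti l')
    (hs : ∑ i, l i = n + ∑ i, staircase M i) :
    ((n.factorial : ℚ)⁻¹) * ∑ g : Perm (Fin n), (chi l g : ℚ) * (chi l' g : ℚ) =
      if l = l' then 1 else 0 := by
  let y : Fin M → MvPolynomial (Fin M) ℚ := MvPolynomial.X
  -- At the flow parameters of the polynomial variables the Jacobi–Trudi determinant is an average
  -- of the $\chi_l(g)$ times power sum products. Times the alternant, its coefficient at `l'` is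
  -- the scalar product; by the bialternant formula the same polynomial is $\det(y_j^{l_i})$.
  have h1 := det_completeSym_mul y l
  have h2 : ∀ g : Perm (Fin n), powerSum (powerFlow y) (cycleClass g) = colPoly ℚ M g := fun g => by
    rw [powerSum_powerFlow, colPoly_eq_prod]
  rw [det_completeSym (powerFlow y) l hs] at h1
  simp_rw [h2] at h1
  have h3 : Matrix.det (Matrix.of fun j i : Fin M => y j ^ staircase M i) = alternant ℚ M := rfl
  rw [h3] at h1
  have h4 := congrArg (MvPolynomial.coeff l') h1
  rw [smul_mul_assoc, MvPolynomial.coeff_smul, sum_mul, MvPolynomial.coeff_sum, smul_eq_mul] at h4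
  have h5 : ∀ g : Perm (Fin n), MvPolynomial.coeff l'
      (((chi l g : ℤ) : MvPolynomial (Fin M) ℚ) * colPoly ℚ M g * alternant ℚ M) =
      (chi l g : ℚ) * (chi l' g : ℚ) := by
    intro g
    rw [mul_assoc, mul_comm (colPoly ℚ M g), ← map_intCast (MvPolynomial.C (σ := Fin M) (R := ℚ)),
      MvPolynomial.coeff_C_mul, coeff_alternant_mul_colPoly]
  simp_rw [h5] at h4
  rw [h4, ← Matrix.det_transpose, Matrix.det_apply', MvPolynomial.coeff_sum]
  have h6 : ∀ σ : Perm (Fin M), MvPolynomial.coeff l' (((Perm.sign σ : ℤ) : MvPolynomial (Fin M) ℚ) *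
      ∏ i, (Matrix.of fun i j : Fin M => y j ^ l i).transpose (σ i) i) =
      if Finsupp.equivMapDomain σ l = l' then ((Perm.sign σ : ℤ) : ℚ) else 0 := by
    intro σ
    have : (∏ i, (Matrix.of fun i j : Fin M => y j ^ l i).transpose (σ i) i) =
        MvPolynomial.monomial (Finsupp.equivMapDomain σ l) 1 := by
      rw [MvPolynomial.monomial_eq, Finsupp.prod_fintype _ _ (fun i => pow_zero _),
        ← Equiv.prod_comp σ fun i => MvPolynomial.X i ^ (Finsupp.equivMapDomain σ l) i]
      simp [y]
    rw [this, ← map_intCast (MvPolynomial.C (σ := Fin M) (R := ℚ)), MvPolynomial.coeff_C_mul,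
      MvPolynomial.coeff_monomial]
    split_ifs <;> simp
  simp_rw [h6]
  rw [sum_eq_single 1]
  · have h7 : Finsupp.equivMapDomain (1 : Perm (Fin M)) l = l := by
      ext i
      rfl
    simp [h7]
  · intro σ _ hσ
    rw [if_neg]
    intro h
    apply hσ
    -- A rearrangement of a strictly decreasing exponent that is again strictly decreasing comes
    -- from the identity.
    have h7 : StrictMono σ.symm := by
      intro a b hab
      have h8 := hl' hab
      rw [← h, Finsupp.equivMapDomain_apply, Finsupp.equivMapDomain_apply] at h8
      exact hl.lt_iff_gt.1 h8
    have h9 : (σ.symm : Fin M → Fin M) = id := by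
      have := Subsingleton.elim (h7.orderIsoOfSurjective _ σ.symm.surjective) (OrderIso.refl _)
      funext i
      exact congrArg (fun e : Fin M ≃o Fin M => e i) this
    ext i
    have := congrFun h9 (σ i)
    simp only [symm_apply_apply, id] at this
    rw [← this]
    rfl
  · simp

theorem shifted_strictAnti {lam : Fin M → ℕ} (h : Antitone lam) : StrictAnti (shifted lam) := by
  intro a b hab
  rw [shifted_apply, shifted_apply, Fin.val_rev, Fin.val_rev]
  have := h hab.le
  have := a.2
  have := b.2
  have : (a : ℕ) < b := hab
  omega

theorem shifted_injective : Function.Injective (shifted : (Fin M → ℕ) → Fin M →₀ ℕ) := by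
  intro a b h
  funext i
  have := DFunLike.congr_fun h i
  rw [shifted_apply, shifted_apply] at this
  omega

theorem sum_shifted (lam : Fin M → ℕ) :
    ∑ i, shifted lam i = ∑ i, lam i + ∑ i, staircase M i := by
  rw [← sum_add_distrib]
  rfl

end Orthogonality

end

end QuantumHurwitz

open scoped PowerSeries Polynomial

namespace QuantumHurwitz

noncomputable section

/-! ### Partitions as diagrams and the characters of the symmetric group -/

open Equiv Finset
open scoped IsMulCommutative

section Rows

variable {n : ℕ}

theorem row_eq_zero (μ : n.Partition) {i : ℕ} (h : μ.parts.card ≤ i) : row μ i = 0 := by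
  rw [row, List.getD_eq_default]
  rwa [Multiset.length_sort]

theorem row_antitone (μ : n.Partition) : Antitone (row μ) := by
  intro i j hij
  rcases lt_or_ge j μ.parts.card with h | h
  · have hj : j < (μ.parts.sort (· ≥ ·)).length := by rwa [Multiset.length_sort]
    rw [row, row, List.getD_eq_getElem _ _ hj, List.getD_eq_getElem _ _ (hij.trans_lt hj)]
    rcases hij.eq_or_lt with rfl | hij
    · exact le_rfl
    · exact List.pairwise_iff_getElem.1 (μ.parts.pairwise_sort (· ≥ ·)) i j (hij.trans hj) hj hij
  · rw [row_eq_zero μ h]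
    exact Nat.zero_le _

theorem map_row_range (μ : n.Partition) :
    (Multiset.range μ.parts.card).map (row μ) = μ.parts := by
  conv_rhs => rw [← μ.parts.sort_eq (· ≥ ·)]
  rw [← Multiset.coe_range, Multiset.map_coe]
  congr 1
  refine List.ext_getElem (by simp) fun i h1 h2 => ?_
  rw [List.getElem_map, List.getElem_range, row, List.getD_eq_getElem]

theorem card_parts_le (μ : n.Partition) : μ.parts.card ≤ n := by
  obtain ⟨g, rfl⟩ := cycleClass_surjective μ
  exact cycleCount_le g

/-- The `n` first row lengths of the diagram of a partition of `n`. -/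
def rowFin (μ : n.Partition) (i : Fin n) : ℕ := row μ i

theorem rowFin_antitone (μ : n.Partition) : Antitone (rowFin μ) := fun _ _ h => row_antitone μ h

/-- Padding the diagram with empty rows is harmless when an empty row contributes 1. With
`Multiplicative ℕ` this also covers sums. -/
theorem prod_rowFin {B : Type*} [CommMonoid B] (μ : n.Partition) (f : ℕ → ℕ → B)
    (hf : ∀ i, f i 0 = 1) :
    ∏ i : Fin n, f i (rowFin μ i) = ∏ i ∈ range μ.parts.card, f i (row μ i) := by
  refine (Fin.prod_univ_eq_prod_range (fun i => f i (row μ i)) n).trans ?_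
  refine (prod_subset (range_subset_range.2 (card_parts_le μ)) fun i _ hi => ?_).symm
  rw [row_eq_zero μ (by simpa using hi), hf]

theorem sum_rowFin (μ : n.Partition) : ∑ i, rowFin μ i = n := by
  have h := prod_rowFin (B := Multiplicative ℕ) μ (fun _ k => Multiplicative.ofAdd k) fun _ => rfl
  rw [← ofAdd_sum, ← ofAdd_sum] at h
  rw [Multiplicative.ofAdd.injective h]
  conv_rhs => rw [← μ.parts_sum, ← map_row_range μ]
  rfl

theorem rowFin_injective : Function.Injective (rowFin : n.Partition → Fin n → ℕ) := by
  intro μ ν h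
  have key : ∀ μ : n.Partition, μ.parts = (Multiset.range n).bind fun i =>
      if row μ i = 0 then 0 else {row μ i} := by
    intro μ
    have h1 : (Multiset.range n).bind (fun i => if row μ i = 0 then 0 else {row μ i}) =
        ∑ i ∈ range n, (if row μ i = 0 then 0 else {row μ i} : Multiset ℕ) := rfl
    have h2 : ∑ i ∈ range μ.parts.card, (if row μ i = 0 then 0 else {row μ i} : Multiset ℕ) =
        ∑ i ∈ range n, (if row μ i = 0 then 0 else {row μ i} : Multiset ℕ) :=
      sum_subset (range_subset_range.2 (card_parts_le μ)) fun i _ hi => by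
        rw [row_eq_zero μ (by simpa using hi), if_pos rfl]
    rw [h1, ← h2]
    conv_lhs => rw [← map_row_range μ, ← Multiset.sum_map_singleton ((Multiset.range μ.parts.card).map (row μ)),
      Multiset.map_map]
    change ∑ i ∈ range μ.parts.card, ({row μ i} : Multiset ℕ) = _
    refine sum_congr rfl fun i hi => ?_
    rw [if_neg]
    refine (μ.parts_pos ?_).ne'
    have : row μ i ∈ (Multiset.range μ.parts.card).map (row μ) := Multiset.mem_map_of_mem _ hi
    rwa [map_row_range] at this
  refine Nat.Partition.ext ?_
  rw [key μ, key ν]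
  refine Multiset.bind_congr fun i hi => ?_
  have := congrFun h ⟨i, Multiset.mem_range.1 hi⟩
  simp only [rowFin] at this
  rw [this]

/-- The shifted row lengths of the diagram of a partition. -/
def shiftedRows (μ : n.Partition) : Fin n →₀ ℕ := shifted (rowFin μ)

theorem shiftedRows_injective : Function.Injective (shiftedRows : n.Partition → Fin n →₀ ℕ) :=
  shifted_injective.comp rowFin_injective

/-- The contents of row $i$ form the interval from $-i$ up to, but excluding, $\lambda_i-i$.
Shifting it by one and adding the old left end is the same as adding the new right end. -/
theorem contents_add {M : ℕ} (lam : Fin M → ℕ) :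
    (contents lam).map (· + 1) + univ.val.map (fun i : Fin M => -((i : ℕ) : ℤ)) =
      contents lam + univ.val.map (fun i : Fin M => (lam i : ℤ) - (i : ℕ)) := by
  have h : ∀ f : Fin M → ℤ, univ.val.map f = ∑ i, ({f i} : Multiset ℤ) := fun f =>
    by
      rw [Finset.sum, ← Multiset.sum_map_singleton (univ.val.map f), Multiset.map_map]
      rfl
  rw [h, h, contents, ← Multiset.coe_mapAddMonoidHom, map_sum, ← sum_add_distrib,
    ← sum_add_distrib]
  refine sum_congr rfl fun i _ => ?_
  rw [Multiset.coe_mapAddMonoidHom, Multiset.map_map]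
  have h1 : (Multiset.range (lam i + 1)).map (fun j : ℕ => (j : ℤ) - (i : ℕ)) =
      (Multiset.range (lam i)).map (fun j : ℕ => (j : ℤ) - (i : ℕ)) + {(lam i : ℤ) - (i : ℕ)} := by
    rw [Multiset.range_succ, Multiset.map_cons, ← Multiset.singleton_add, add_comm]
  rw [← h1, ← Multiset.coe_range, ← Multiset.coe_range, List.range_succ_eq_map]
  simp only [Multiset.map_coe, ← Multiset.cons_coe]
  rw [add_comm, Multiset.singleton_add, Multiset.map_cons]
  simp only [Multiset.map_coe, List.map_map]
  congr 1
  · simp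
  · refine congrArg (fun l : List ℤ => (l : Multiset ℤ)) (List.map_congr_left fun j _ => ?_)
    simp
    ring

/-- By `contents_add` the contents determine the set of numbers $\lambda_i-i$, and these strictly
decrease in $i$. -/
theorem contents_injective {M : ℕ} {lam lam' : Fin M → ℕ} (h : Antitone lam) (h' : Antitone lam')
    (hc : contents lam = contents lam') : lam = lam' := by
  have h1 := contents_add lam
  rw [hc, contents_add lam'] at h1
  have h2 := add_left_cancel h1
  have h3 : ∀ {lam : Fin M → ℕ}, Antitone lam → StrictAnti fun i : Fin M => (lam i : ℤ) - (i : ℕ) := by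
    intro lam h a b hab
    have h4 : (a : ℕ) < b := hab
    have h5 := h hab.le
    simp only
    omega
  have h4 : (fun i : Fin M => (lam i : ℤ) - (i : ℕ)) = fun i : Fin M => (lam' i : ℤ) - (i : ℕ) := by
    refine (StrictAnti.range_inj (h3 h) (h3 h')).1 ?_
    ext x
    have := congrArg (x ∈ ·) h2
    simpa [eq_comm] using this
  funext i
  have := congrFun h4 i
  simp only [sub_left_inj, Nat.cast_inj] at this
  exact this

end Rows

section SecondOrthogonality

variable {n : ℕ}

/-- Second orthogonality relation. -/
theorem sum_chi_mul_chi' (g h : Perm (Fin n)) :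
    (∑ lam : n.Partition, chi (shiftedRows lam) g * chi (shiftedRows lam) h) *
      #{k : Perm (Fin n) | cycleClass k = cycleClass h} =
    if cycleClass g = cycleClass h then (n.factorial : ℤ) else 0 := by
  choose p hp using (cycleClass_surjective : Function.Surjective (cycleClass (n := n)))
  have hchi : ∀ (l : Fin n →₀ ℕ) g, chi l (p (cycleClass g)) = chi l g := fun l g =>
    chi_congr l (hp _)
  let X : Matrix n.Partition n.Partition ℚ := Matrix.of fun lam μ => (chi (shiftedRows lam) (p μ) : ℚ)
  let Y : Matrix n.Partition n.Partition ℚ := Matrix.of fun μ lam =>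
    (n.factorial : ℚ)⁻¹ * #{k : Perm (Fin n) | cycleClass k = μ} * (chi (shiftedRows lam) (p μ) : ℚ)
  have hXY : X * Y = 1 := by
    ext lam lam'
    rw [Matrix.mul_apply, Matrix.one_apply]
    have h1 := sum_chi_mul_chi (n := n) (shifted_strictAnti (rowFin_antitone lam))
      (shifted_strictAnti (rowFin_antitone lam')) (by rw [sum_shifted, sum_rowFin])
    have h2 : (shifted (rowFin lam) = shifted (rowFin lam')) ↔ lam = lam' :=
      shiftedRows_injective.eq_iff
    simp only [h2] at h1
    rw [← h1, ← sum_fiberwise univ (cycleClass (n := n)), mul_sum]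
    refine sum_congr rfl fun μ _ => ?_
    rw [sum_congr rfl (g := fun _ => (chi (shiftedRows lam) (p μ) : ℚ) * chi (shiftedRows lam') (p μ)),
      sum_const, nsmul_eq_mul]
    · simp only [X, Y, Matrix.of_apply]
      ring
    · intro g hg
      rw [← (mem_filter.1 hg).2, hchi, hchi]
      rfl
  -- The character table is square, with rows and columns indexed by the partitions of `n`, so the
  -- right inverse given by the first relation is also a left inverse.
  have hYX := _root_.mul_eq_one_comm.1 hXY
  have h1 := congrFun (congrFun hYX (cycleClass h)) (cycleClass g)
  rw [Matrix.mul_apply, Matrix.one_apply] at h1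
  simp only [X, Y, Matrix.of_apply, hchi] at h1
  have hn : (n.factorial : ℚ) ≠ 0 := Nat.cast_ne_zero.2 n.factorial_ne_zero
  have h2 : ((∑ lam : n.Partition, (chi (shiftedRows lam) g : ℚ) * chi (shiftedRows lam) h) *
      (#{k : Perm (Fin n) | cycleClass k = cycleClass h} : ℚ)) =
      (n.factorial : ℚ) * if cycleClass h = cycleClass g then 1 else 0 := by
    rw [← h1, mul_sum, sum_mul]
    refine sum_congr rfl fun lam _ => ?_
    field_simp
  have h3 : (((∑ lam : n.Partition, chi (shiftedRows lam) g * chi (shiftedRows lam) h) *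
      #{k : Perm (Fin n) | cycleClass k = cycleClass h} : ℤ) : ℚ) =
      ((if cycleClass g = cycleClass h then (n.factorial : ℤ) else 0 : ℤ) : ℚ) := by
    push_cast
    rw [h2]
    simp [eq_comm]
  exact_mod_cast h3

end SecondOrthogonality

end

end QuantumHurwitz

open scoped PowerSeries Polynomial

namespace QuantumHurwitz

noncomputable section

/-! ### The Frobenius formula -/

open Equiv Finset
open scoped IsMulCommutative

/-! ### Centrality of symmetric polynomials in the Jucys–Murphy elements. -/

section Center

variable {R : Type*} [CommRing R] {n : ℕ}

theorem coeff_elemGen (k : ℕ) :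
    PowerSeries.coeff k (elemGen R n) = MvPolynomial.esymm (Fin n) R k := by
  rw [elemGen, prod_one_add, map_sum, MvPolynomial.esymm, ← sum_filter_add_sum_filter_not _
    (fun s : Finset (Fin n) => #s = k)]
  have h : ∀ s : Finset (Fin n), PowerSeries.coeff k (∏ i ∈ s, (PowerSeries.X *
      PowerSeries.C (MvPolynomial.X i : MvPolynomial (Fin n) R))) =
      if k = #s then ∏ i ∈ s, MvPolynomial.X i else 0 := by
    intro s
    rw [prod_mul_distrib, prod_const, ← map_prod, PowerSeries.coeff_mul_C, PowerSeries.coeff_X_pow]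
    simp
  simp_rw [h]
  rw [sum_eq_zero (s := filter (fun s => ¬ #s = k) _), add_zero, powersetCard_eq_filter]
  · refine sum_congr rfl fun s hs => ?_
    rw [if_pos (mem_filter.1 hs).2.symm]
  · intro s hs
    rw [if_neg fun h => (mem_filter.1 hs).2 h.symm]

/-- Symmetric polynomials in the Jucys–Murphy elements are central. -/
theorem mul_jmHom {f : MvPolynomial (Fin n) R} (hf : f.IsSymmetric) (y : GroupAlg R n) :
    y * jmHom R n f = jmHom R n f * y := by
  -- Symmetric polynomials are polynomials in the elementary ones, which by Jucys' theorem evaluate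
  -- to sums of class sums.
  obtain ⟨p, hp⟩ := MvPolynomial.esymmAlgHom_fin_surjective R le_rfl
    (⟨f, hf⟩ : MvPolynomial.symmetricSubalgebra (Fin n) R)
  have hp' : f = ((MvPolynomial.esymmAlgHom (Fin n) R n p : _) : MvPolynomial (Fin n) R) := by
    rw [hp]
  rw [hp']
  clear hp hp' hf
  induction p using MvPolynomial.induction_on with
  | C r =>
    rw [MvPolynomial.C_eq_algebraMap, AlgHom.commutes, Subalgebra.coe_algebraMap, AlgHom.commutes]
    exact (Algebra.commutes r y).symm
  | add p q hp hq => rw [map_add, Subalgebra.coe_add, map_add, mul_add, add_mul, hp, hq]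
  | mul_X p i hp =>
    rw [map_mul, Subalgebra.coe_mul, map_mul, ← mul_assoc, hp, mul_assoc, mul_assoc]
    congr 1
    rw [MvPolynomial.esymmAlgHom_apply, MvPolynomial.aeval_X]
    rw [← coeff_elemGen, jucys_classSum, mul_sum, sum_mul]
    exact sum_congr rfl fun ρ _ => mul_classSum ρ y

theorem coeff_jmHom_conj {f : MvPolynomial (Fin n) R} (hf : f.IsSymmetric) (s g : Perm (Fin n)) :
    (jmHom R n f).coeff (s * g * s⁻¹) = (jmHom R n f).coeff g := by
  have h := congrArg (fun x : GroupAlg R n => x.coeff (s * g)) (mul_jmHom hf (perm R s))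
  simp only [perm, MonoidAlgebra.of_apply, MonoidAlgebra.coeff_single_mul_apply,
    MonoidAlgebra.coeff_mul_single_apply, one_mul, mul_one, inv_mul_cancel_left] at h
  exact h.symm

theorem coeff_jmHom_congr {f : MvPolynomial (Fin n) R} (hf : f.IsSymmetric) {g h : Perm (Fin n)}
    (hgh : cycleClass g = cycleClass h) : (jmHom R n f).coeff g = (jmHom R n f).coeff h := by
  obtain ⟨s, hs⟩ := isConj_iff.1 ((cycleClass_eq_iff g h).1 hgh)
  rw [← hs, coeff_jmHom_conj hf]

end Center

/-! ### Interpolation at contents and the Frobenius formula. -/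

section Frobenius

variable {R : Type*} [Field R] {n : ℕ}

/-- The contents of the diagram of a partition of `n`, as a family indexed by `Fin n`. -/
def contentFin (R : Type*) [Field R] (lam : n.Partition) : Fin n → R :=
  (exists_fin_map_eq ((contents (rowFin lam)).map (Int.cast : ℤ → R)) (n := n)
    (by rw [Multiset.card_map, card_contents, sum_rowFin])).choose

theorem map_contentFin (lam : n.Partition) : univ.val.map (contentFin R lam) =
    (contents (rowFin lam)).map (Int.cast : ℤ → R) :=
  (exists_fin_map_eq ((contents (rowFin lam)).map (Int.cast : ℤ → R)) (n := n)
    (by rw [Multiset.card_map, card_contents, sum_rowFin])).choose_spec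

variable [CharZero R]

theorem chi_one_ne_zero (lam : n.Partition) :
    ((chi (shiftedRows lam) (1 : Perm (Fin n)) : ℤ) : R) ≠ 0 :=
  Int.cast_ne_zero.2 (chi_one_pos (rowFin_antitone lam) (sum_rowFin lam)).ne'

/-- The coefficients of a symmetric polynomial in the Jucys–Murphy elements. -/
theorem coeff_jmHom {f : MvPolynomial (Fin n) R} (hf : f.IsSymmetric) (g : Perm (Fin n)) :
    (jmHom R n f).coeff g = (n.factorial : R)⁻¹ * ∑ lam : n.Partition,
      MvPolynomial.eval (contentFin R lam) f * chi (shiftedRows lam) (1 : Perm (Fin n)) *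
        chi (shiftedRows lam) g := by
  have hn : (n.factorial : R) ≠ 0 := Nat.cast_ne_zero.2 n.factorial_ne_zero
  -- The evaluation at contents is undone: it is the value of the linear extension of $\chi_\lambda$
  -- at the element. Then the second orthogonality relation isolates the class of `g`, on which the
  -- coefficients are constant.
  have h1 : ∀ lam : n.Partition, MvPolynomial.eval (contentFin R lam) f *
      chi (shiftedRows lam) (1 : Perm (Fin n)) =
      ∑ h, (jmHom R n f).coeff h * (chi (shiftedRows lam) h : R) := fun lam =>
    (chiLin_jmHom (rowFin_antitone lam) (sum_rowFin lam) hf _ (map_contentFin lam)).symm.trans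
      (extendLin_apply _ _)
  simp_rw [h1, sum_mul]
  rw [sum_comm]
  have h2 : ∀ h : Perm (Fin n), ∑ lam : n.Partition, (jmHom R n f).coeff h *
      (chi (shiftedRows lam) h : R) * (chi (shiftedRows lam) g : R) =
      if cycleClass h = cycleClass g then (jmHom R n f).coeff g * (n.factorial : R) *
        (#{k : Perm (Fin n) | cycleClass k = cycleClass g} : R)⁻¹ else 0 := by
    intro h
    have h3 := congrArg (Int.cast : ℤ → R) (sum_chi_mul_chi' h g)
    push_cast at h3
    have h4 : (#{k : Perm (Fin n) | cycleClass k = cycleClass g} : R) ≠ 0 :=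
      Nat.cast_ne_zero.2 (card_ne_zero_of_mem (mem_filter.2 ⟨mem_univ g, rfl⟩))
    simp_rw [mul_assoc, ← mul_sum]
    rw [← eq_mul_inv_iff_mul_eq₀ h4] at h3
    rw [h3]
    split_ifs with h5
    · rw [coeff_jmHom_congr hf h5]
    · simp
  simp_rw [h2]
  rw [← sum_filter, sum_const, nsmul_eq_mul]
  have h4 : (#{k : Perm (Fin n) | cycleClass k = cycleClass g} : R) ≠ 0 :=
    Nat.cast_ne_zero.2 (card_ne_zero_of_mem (mem_filter.2 ⟨mem_univ g, rfl⟩))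
  field_simp

/-- Otherwise all $\prod_b(T-X_b)$ would agree at the two families of contents; the contents would
then be the roots of one polynomial, and they determine the diagram. -/
theorem exists_symmetric_ne {lam kap : n.Partition} (h : lam ≠ kap) :
    ∃ f : MvPolynomial (Fin n) R, f.IsSymmetric ∧
      MvPolynomial.eval (contentFin R lam) f ≠ MvPolynomial.eval (contentFin R kap) f := by
  by_contra! H
  apply h
  apply rowFin_injective
  refine contents_injective (rowFin_antitone lam) (rowFin_antitone kap) ?_
  refine Multiset.map_injective (Int.cast_injective (α := R)) ?_
  rw [← map_contentFin, ← map_contentFin]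
  have h1 : ∏ b, (Polynomial.X - Polynomial.C (contentFin R lam b)) =
      ∏ b, (Polynomial.X - Polynomial.C (contentFin R kap b)) := by
    refine Polynomial.funext fun T => ?_
    have := H (∏ b, (MvPolynomial.C T - MvPolynomial.X b)) fun e => by
      rw [map_prod]
      exact Fintype.prod_equiv e _ _ fun b => by simp
    simpa [Polynomial.eval_prod] using this
  have h2 := congrArg Polynomial.roots h1
  have h3 : ∀ c : Fin n → R, (∏ b, (Polynomial.X - Polynomial.C (c b))).roots = univ.val.map c := by
    intro c
    have := Polynomial.roots_multiset_prod_X_sub_C (univ.val.map c)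
    rw [Multiset.map_map] at this
    exact this
  rwa [h3, h3] at h2

/-- Lagrange interpolation, with the separating symmetric polynomials in place of differences of a
single variable. -/
theorem exists_symmetric_eval (v : n.Partition → R) :
    ∃ f : MvPolynomial (Fin n) R, f.IsSymmetric ∧
      ∀ lam, MvPolynomial.eval (contentFin R lam) f = v lam := by
  classical
  choose! s hs hs' using fun (lam kap : n.Partition) => exists_symmetric_ne (R := R) (lam := lam) (kap := kap)
  let S := MvPolynomial.symmetricSubalgebra (Fin n) R
  let L : n.Partition → MvPolynomial (Fin n) R := fun lam => ∏ kap ∈ univ.erase lam,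
    MvPolynomial.C (MvPolynomial.eval (contentFin R lam) (s lam kap) -
      MvPolynomial.eval (contentFin R kap) (s lam kap))⁻¹ *
      (s lam kap - MvPolynomial.C (MvPolynomial.eval (contentFin R kap) (s lam kap)))
  refine ⟨∑ lam, MvPolynomial.C (v lam) * L lam, ?_, ?_⟩
  · refine Subalgebra.sum_mem S fun lam _ => Subalgebra.mul_mem S (Subalgebra.algebraMap_mem S _) ?_
    refine Subalgebra.prod_mem S fun kap hk => Subalgebra.mul_mem S (Subalgebra.algebraMap_mem S _) ?_
    exact Subalgebra.sub_mem S (hs lam kap (ne_of_mem_erase hk).symm) (Subalgebra.algebraMap_mem S _)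
  · intro lam
    rw [map_sum, sum_eq_single lam]
    · simp only [L, map_mul, map_prod, MvPolynomial.eval_C, map_sub]
      rw [prod_eq_one, mul_one]
      intro kap hk
      exact inv_mul_cancel₀ (sub_ne_zero.2 (hs' lam kap (ne_of_mem_erase hk).symm))
    · intro kap _ hk
      simp only [L, map_mul, map_prod, MvPolynomial.eval_C, map_sub]
      rw [prod_eq_zero (mem_erase.2 ⟨hk.symm, mem_univ lam⟩), mul_zero]
      rw [sub_self, mul_zero]
    · simp

/-- The class sums are symmetric polynomials in the Jucys–Murphy elements. -/
theorem exists_symmetric_classSum (μ : n.Partition) :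
    ∃ f : MvPolynomial (Fin n) R, f.IsSymmetric ∧ jmHom R n f = classSum R μ ∧
      ∀ lam, MvPolynomial.eval (contentFin R lam) f * chi (shiftedRows lam) (1 : Perm (Fin n)) =
        ∑ g with cycleClass g = μ, (chi (shiftedRows lam) g : R) := by
  -- The prescribed values are those of the central characters on the class sum; `coeff_jmHom` and
  -- the second orthogonality relation then identify all coefficients.
  obtain ⟨f, hf, hv⟩ := exists_symmetric_eval (R := R) fun lam : n.Partition =>
    (∑ g with cycleClass g = μ, (chi (shiftedRows lam) g : R)) *
      ((chi (shiftedRows lam) (1 : Perm (Fin n)) : ℤ) : R)⁻¹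
  have hv' : ∀ lam, MvPolynomial.eval (contentFin R lam) f *
      chi (shiftedRows lam) (1 : Perm (Fin n)) =
      ∑ g with cycleClass g = μ, (chi (shiftedRows lam) g : R) := fun lam => by
    rw [hv, inv_mul_cancel_right₀ (chi_one_ne_zero lam)]
  refine ⟨f, hf, ?_, hv'⟩
  have hn : (n.factorial : R) ≠ 0 := Nat.cast_ne_zero.2 n.factorial_ne_zero
  rw [eq_sum_perm (jmHom R n f), classSum, sum_filter]
  refine sum_congr rfl fun g _ => ?_
  rw [coeff_jmHom hf]
  simp_rw [hv', sum_mul]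
  rw [sum_comm]
  have h3 : ∀ h ∈ filter (fun h : Perm (Fin n) => cycleClass h = μ) univ,
      ∑ lam : n.Partition, (chi (shiftedRows lam) h : R) * (chi (shiftedRows lam) g : R) =
      if cycleClass g = μ then (n.factorial : R) *
        (#{k : Perm (Fin n) | cycleClass k = μ} : R)⁻¹ else 0 := by
    intro h hh
    have h3 := congrArg (Int.cast : ℤ → R) (sum_chi_mul_chi' g h)
    push_cast at h3
    rw [(mem_filter.1 hh).2] at h3
    have h4 : (#{k : Perm (Fin n) | cycleClass k = μ} : R) ≠ 0 :=
      Nat.cast_ne_zero.2 (card_ne_zero_of_mem hh)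
    rw [← eq_mul_inv_iff_mul_eq₀ h4] at h3
    simp_rw [mul_comm ((chi _ h : ℤ) : R)]
    rw [h3]
    split_ifs <;> simp
  rw [sum_congr rfl h3, sum_const, nsmul_eq_mul]
  split_ifs with h5
  · have h4 : (#{k : Perm (Fin n) | cycleClass k = μ} : R) ≠ 0 :=
      Nat.cast_ne_zero.2 (card_ne_zero_of_mem (mem_filter.2 ⟨mem_univ g, h5⟩))
    rw [mul_left_comm, inv_mul_cancel_left₀ hn, mul_inv_cancel₀ h4, one_smul]
  · simp

/-- The pairing `∑_{h ∈ cyc(μ), h' ∈ cyc(ν)} x(h' h⁻¹)`. -/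
def classPairing (R : Type*) [CommRing R] {n : ℕ} (μ ν : n.Partition) : GroupAlg R n →ₗ[R] R :=
  ∑ h with cycleClass h = μ, ∑ h' with cycleClass h' = ν, extendLin (Pi.single (h' * h⁻¹) 1)

theorem classPairing_apply {R : Type*} [CommRing R] {n : ℕ} (μ ν : n.Partition) (x : GroupAlg R n) :
    classPairing R μ ν x = ∑ h with cycleClass h = μ, ∑ h' with cycleClass h' = ν,
      x.coeff (h' * h⁻¹) := by
  simp [classPairing, LinearMap.sum_apply, extendLin_apply, Pi.single_apply]

/-- The inverse on `h'` disappears because conjugacy classes of symmetric groups are closed under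
inversion. -/
theorem classPairing_eq {R : Type*} [CommRing R] {n : ℕ} (μ ν : n.Partition) (x : GroupAlg R n) :
    classPairing R μ ν x = (x * (classSum R μ * classSum R ν)).coeff 1 := by
  rw [classPairing_apply, classSum, classSum, sum_mul_sum, mul_sum]
  rw [MonoidAlgebra.coeff_sum, Finset.sum_apply']
  refine sum_congr rfl fun h _ => ?_
  rw [mul_sum, MonoidAlgebra.coeff_sum, Finset.sum_apply']
  refine sum_bij (fun h' _ => h'⁻¹) ?_ ?_ ?_ ?_
  · intro h' hh'
    simpa [cycleClass_inv] using hh'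
  · intro a _ b _ hab
    exact inv_injective hab
  · intro h' hh'
    exact ⟨h'⁻¹, by simpa [cycleClass_inv] using hh', inv_inv _⟩
  · intro h' _
    rw [← map_mul, MonoidAlgebra.of_apply, MonoidAlgebra.coeff_mul_single_apply]
    simp

/-- The Frobenius formula. -/
theorem classPairing_jmHom {f : MvPolynomial (Fin n) R} (hf : f.IsSymmetric) (μ ν : n.Partition) :
    classPairing R μ ν (jmHom R n f) = (n.factorial : R)⁻¹ * ∑ lam : n.Partition,
      MvPolynomial.eval (contentFin R lam) f *
        (∑ g with cycleClass g = μ, (chi (shiftedRows lam) g : R)) *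
        ∑ g with cycleClass g = ν, (chi (shiftedRows lam) g : R) := by
  obtain ⟨a, ha, hac, hav⟩ := exists_symmetric_classSum (R := R) μ
  obtain ⟨b, hb, hbc, hbv⟩ := exists_symmetric_classSum (R := R) ν
  -- The product with both class sums is again a symmetric polynomial in the Jucys–Murphy elements.
  -- In its coefficient at the identity $\chi_\lambda(1)$ occurs twice, one factor for each class
  -- sum.
  have hfab : (f * (a * b)).IsSymmetric := hf.mul (ha.mul hb)
  rw [classPairing_eq, ← hac, ← hbc, ← map_mul, ← map_mul, coeff_jmHom hfab]
  congr 1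
  refine sum_congr rfl fun lam _ => ?_
  rw [← hav, ← hbv, map_mul, map_mul]
  ring

end Frobenius

end

end QuantumHurwitz

open scoped PowerSeries Polynomial

namespace QuantumHurwitz

noncomputable section

/-! ### The hypergeometric `τ`-function in the basis of power sums -/

open Equiv Finset
open scoped IsMulCommutative

section Schur

variable {A : Type*} [CommRing A] [Algebra ℚ A] {n : ℕ}

theorem completeSym_zero (x : ℕ → A) : completeSym x 0 = 1 := by
  have h := completeSym_eq_sum_perm x 0
  have h1 : powerSum x (cycleClass (1 : Perm (Fin 0))) = 1 := by
    rw [powerSum, Multiset.eq_zero_of_forall_notMem (s := (cycleClass (1 : Perm (Fin 0))).parts),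
      Multiset.map_zero, Multiset.prod_zero]
    intro k hk
    have h1 := (cycleClass (1 : Perm (Fin 0))).parts_pos hk
    have h2 := Multiset.le_sum_of_mem hk
    rw [(cycleClass (1 : Perm (Fin 0))).parts_sum] at h2
    omega
  rw [univ_unique, sum_singleton] at h
  rw [show (default : Perm (Fin 0)) = 1 from rfl, h1] at h
  simpa using h

/-- An empty last row contributes the matrix row $(0,\dots,0,1)$. So the determinant may be taken of
size `n`, as needed to compare it with $\chi_\lambda$. -/
theorem det_rows_succ (x : ℕ → A) (r : ℕ → ℕ) {M : ℕ} (h : r M = 0) :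
    Matrix.det (Matrix.of fun i j : Fin (M + 1) =>
      completeSym x ((r i : ℤ) - (i : ℕ) + (j : ℕ))) =
    Matrix.det (Matrix.of fun i j : Fin M => completeSym x ((r i : ℤ) - (i : ℕ) + (j : ℕ))) := by
  rw [Matrix.det_succ_row _ (Fin.last M), Fin.sum_univ_castSucc, sum_eq_zero, zero_add]
  · rw [Matrix.of_apply, Fin.val_last, h]
    have h0 : ((0 : ℕ) : ℤ) - (M : ℤ) + (M : ℤ) = 0 := by ring
    rw [h0, completeSym_zero, mul_one, ← two_mul, pow_mul, neg_one_sq, one_pow, one_mul]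
    congr 1
    ext i j
    simp
  · intro j _
    rw [Matrix.of_apply, completeSym_of_neg, mul_zero, zero_mul]
    simp only [Fin.val_last, Fin.val_castSucc, h]
    have := j.2
    omega

theorem schur_eq_det (x : ℕ → A) (lam : n.Partition) : schur x lam =
    Matrix.det (Matrix.of fun i j : Fin n =>
      completeSym x ((row lam i : ℤ) - (i : ℕ) + (j : ℕ))) := by
  obtain ⟨k, hk⟩ := Nat.exists_eq_add_of_le (card_parts_le lam)
  have h : ∀ k, schur x lam = Matrix.det (Matrix.of fun i j : Fin (lam.parts.card + k) =>
      completeSym x ((row lam i : ℤ) - (i : ℕ) + (j : ℕ))) := by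
    intro k
    induction k with
    | zero => rfl
    | succ k ih =>
      rw [ih]
      exact (det_rows_succ x (row lam) (row_eq_zero lam (Nat.le_add_right _ _))).symm
  rw [h k, ← hk]

/-- The Schur functions as combinations of power sums. -/
theorem schur_eq_sum (x : ℕ → A) (lam : n.Partition) : schur x lam =
    ((n.factorial : ℚ)⁻¹) • ∑ μ : n.Partition,
      ((∑ g with cycleClass g = μ, chi (shiftedRows lam) g : ℤ) : A) * powerSum x μ := by
  rw [schur_eq_det]
  have h1 := det_completeSym x (shiftedRows lam) (n := n)
    (by rw [shiftedRows, sum_shifted, sum_rowFin])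
  have h2 : (Matrix.of fun i j : Fin n => completeSym x ((row lam i : ℤ) - (i : ℕ) + (j : ℕ))) =
      Matrix.of fun i j : Fin n =>
        completeSym x ((shiftedRows lam i : ℤ) - (staircase n j : ℤ)) := by
    ext i j
    rw [Matrix.of_apply, Matrix.of_apply]
    congr 1
    rw [shiftedRows, shifted_apply, staircase_apply, Fin.val_rev, Fin.val_rev, rowFin]
    have := i.2
    have := j.2
    omega
  rw [h2, h1, ← sum_fiberwise univ (cycleClass (n := n))]
  congr 1
  refine sum_congr rfl fun μ _ => ?_
  rw [Int.cast_sum, sum_mul]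
  refine sum_congr rfl fun g hg => ?_
  rw [(mem_filter.1 hg).2]

end Schur

/-! ### Content products as evaluations of symmetric polynomials. -/

section Content

variable {𝕜 : Type*} [NormedField 𝕜] {n : ℕ}

/-- The coefficient of `z^d` in `∏_b G(z X_b)`. -/
def weightPoly {R : Type*} [CommRing R] (G : R⟦X⟧) (d n : ℕ) : MvPolynomial (Fin n) R :=
  PowerSeries.coeff d (∏ b : Fin n, PowerSeries.mk fun k =>
    MvPolynomial.C (PowerSeries.coeff k G) * MvPolynomial.X b ^ k)

theorem weightPoly_isSymmetric {R : Type*} [CommRing R] (G : R⟦X⟧) (d n : ℕ) :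
    (weightPoly G d n).IsSymmetric := by
  intro e
  have h := PowerSeries.coeff_map (MvPolynomial.rename e : MvPolynomial (Fin n) R →ₐ[R] _).toRingHom
    d (∏ b : Fin n, PowerSeries.mk fun k =>
      MvPolynomial.C (PowerSeries.coeff k G) * MvPolynomial.X b ^ k)
  refine h.symm.trans ?_
  rw [weightPoly, map_prod]
  congr 1
  refine Fintype.prod_equiv e _ _ fun b => ?_
  ext1 k
  simp

theorem eval_weightPoly {R : Type*} [CommRing R] (G : R⟦X⟧) (d n : ℕ) (c : Fin n → R) :
    MvPolynomial.eval c (weightPoly G d n) =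
      PowerSeries.coeff d (∏ b, PowerSeries.rescale (c b) G) := by
  refine (PowerSeries.coeff_map (MvPolynomial.eval c) d _).symm.trans ?_
  rw [map_prod]
  congr 1
  refine prod_congr rfl fun b _ => ?_
  ext k
  simp [PowerSeries.coeff_rescale, mul_comm]

theorem contentProduct_eq (G : 𝕜⟦X⟧) (lam : n.Partition) :
    contentProduct G lam = ∏ b, PowerSeries.rescale (contentFin 𝕜 lam b) G := by
  have h1 : ∏ b, PowerSeries.rescale (contentFin 𝕜 lam b) G =
      ((univ.val.map (contentFin 𝕜 lam)).map fun a => PowerSeries.rescale a G).prod := by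
    rw [Multiset.map_map]
    rfl
  rw [h1, map_contentFin, contents, Multiset.map_map, ← Multiset.coe_mapAddMonoidHom, map_sum,
    Multiset.prod_sum, contentProduct]
  rw [← prod_rowFin lam (fun i k => ∏ j ∈ range k, PowerSeries.rescale ((j : 𝕜) - (i : 𝕜)) G)
    fun _ => prod_range_zero _]
  refine prod_congr rfl fun i _ => ?_
  rw [Multiset.coe_mapAddMonoidHom, Multiset.map_map]
  refine prod_congr rfl fun j _ => ?_
  simp

end Content

/-! ### Expansion of the τ-function. -/

section Tau

variable {𝕜 : Type*} [NormedField 𝕜] {n : ℕ}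

/-- The weight of an exponent with respect to the first sequence of flow parameters. -/
def flowWeight : (ℕ ⊕ ℕ →₀ ℕ) →+ ℕ :=
  Finsupp.liftAddHom fun s => AddMonoidHom.mulLeft (Sum.elim id (fun _ => 0) s)

theorem flowWeight_single (s : ℕ ⊕ ℕ) (k : ℕ) :
    flowWeight (Finsupp.single s k) = Sum.elim id (fun _ => 0) s * k := by
  simp [flowWeight]

theorem powerSum_X (v : ℕ → ℕ ⊕ ℕ) (μ : n.Partition) :
    powerSum (fun k => (MvPowerSeries.X (v k) : TauSeries 𝕜)) μ =
      MvPowerSeries.monomial (μ.parts.map fun k => Finsupp.single (v k) 1).sum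
        (μ.parts.map fun k : ℕ => (k : 𝕜⟦X⟧)).prod := by
  rw [powerSum]
  induction μ.parts using Multiset.induction_on with
  | empty => simp
  | cons a s ih =>
    rw [Multiset.map_cons, Multiset.prod_cons, ih, Multiset.map_cons, Multiset.map_cons,
      Multiset.sum_cons, Multiset.prod_cons, ← MvPowerSeries.monomial_mul_monomial,
      ← map_natCast (MvPowerSeries.C (σ := ℕ ⊕ ℕ) (R := 𝕜⟦X⟧)), MvPowerSeries.X,
      ← MvPowerSeries.monomial_zero_eq_C_apply, MvPowerSeries.monomial_mul_monomial, zero_add,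
      mul_one]

/-- The product is homogeneous of weight $n$ in the first variables, where $t_i$ has weight $i$;
this grading makes the formal sums locally finite. -/
theorem coeff_powerSum_mul (a : 𝕜⟦X⟧) (μ ν : n.Partition) {m : ℕ ⊕ ℕ →₀ ℕ} (h : flowWeight m ≠ n) :
    MvPowerSeries.coeff m
      (MvPowerSeries.C a * powerSum (tVar 𝕜) μ * powerSum (sVar 𝕜) ν) = 0 := by
  have h1 := powerSum_X (𝕜 := 𝕜) Sum.inl μ
  have h2 := powerSum_X (𝕜 := 𝕜) Sum.inr ν
  change powerSum (tVar 𝕜) μ = _ at h1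
  change powerSum (sVar 𝕜) ν = _ at h2
  rw [h1, h2, mul_assoc, MvPowerSeries.monomial_mul_monomial, MvPowerSeries.coeff_C_mul,
    MvPowerSeries.coeff_monomial, if_neg, mul_zero]
  rintro rfl
  apply h
  rw [map_add, map_multiset_sum, map_multiset_sum, Multiset.map_map, Multiset.map_map]
  simp only [Function.comp_def, flowWeight_single, Sum.elim_inl, Sum.elim_inr, id, mul_one,
    Multiset.map_id', μ.parts_sum]
  simp

/-- If the members are homogeneous for a grading with finite pieces, each coefficient sees a single
piece, and the formal sum is finite there. -/
theorem coeff_formalSum {T : ℕ → Type*} [∀ n, Fintype (T n)]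
    {σ R : Type*} [CommRing R] (f : (Σ n, T n) → MvPowerSeries σ R) (w : (σ →₀ ℕ) → ℕ)
    (hf : ∀ n x m, w m ≠ n → MvPowerSeries.coeff m (f ⟨n, x⟩) = 0) (m : σ →₀ ℕ) :
    MvPowerSeries.coeff m (formalSum f) =
      MvPowerSeries.coeff m (∑ x : T (w m), f ⟨w m, x⟩) := by
  classical
  change ∑ᶠ i, MvPowerSeries.coeff m (f i) = _
  rw [map_sum, finsum_eq_sum_of_support_subset
    (s := univ.map (Function.Embedding.sigmaMk (β := T) (w m)))]
  · rw [sum_map]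
    rfl
  · rintro ⟨n, x⟩ h
    by_cases hn : w m = n
    · subst hn
      simp
    · exact absurd (hf n x m hn) h

variable [CharZero 𝕜]

theorem smul_tauSeries (r : ℚ) (x : TauSeries 𝕜) :
    r • x = MvPowerSeries.C (PowerSeries.C (r : 𝕜)) * x := by
  rw [Algebra.smul_def]
  congr 1
  have := RingHom.ext_rat (algebraMap ℚ (TauSeries 𝕜))
    ((MvPowerSeries.C (σ := ℕ ⊕ ℕ) (R := 𝕜⟦X⟧)).comp
      ((PowerSeries.C (R := 𝕜)).comp (Rat.castHom 𝕜)))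
  exact congrArg (fun φ : ℚ →+* TauSeries 𝕜 => φ r) this

/-- Expand both Schur functions in power sums; the coefficient of $p_\mu p_\nu$ is the Frobenius
formula for the symmetric polynomial whose values at contents are the coefficients of the content
product. -/
theorem sum_schur_mul_schur (G : 𝕜⟦X⟧) (n : ℕ) :
    ∑ lam : n.Partition,
      MvPowerSeries.C (contentProduct G lam) * schur (tVar 𝕜) lam * schur (sVar 𝕜) lam =
    ∑ x : n.Partition × n.Partition,
      MvPowerSeries.C (PowerSeries.mk fun d => (n.factorial : 𝕜)⁻¹ *
        classPairing 𝕜 x.1 x.2 (jmHom 𝕜 n (weightPoly G d n))) *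
      powerSum (tVar 𝕜) x.1 * powerSum (sVar 𝕜) x.2 := by
  let a : n.Partition → n.Partition → 𝕜 := fun lam μ =>
    ∑ g with cycleClass g = μ, (chi (shiftedRows lam) g : 𝕜)
  have hs : ∀ (x : ℕ → TauSeries 𝕜) (lam : n.Partition), schur x lam = ∑ μ : n.Partition,
      MvPowerSeries.C (PowerSeries.C ((n.factorial : 𝕜)⁻¹ * a lam μ)) * powerSum x μ := by
    intro x lam
    rw [schur_eq_sum, smul_tauSeries, mul_sum]
    refine sum_congr rfl fun μ _ => ?_
    rw [← mul_assoc, map_mul, map_mul]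
    congr 2
    · simp
    · simp [a]
  have hc : ∀ μ ν : n.Partition, (PowerSeries.mk fun d => (n.factorial : 𝕜)⁻¹ *
        classPairing 𝕜 μ ν (jmHom 𝕜 n (weightPoly G d n))) =
      ∑ lam : n.Partition, contentProduct G lam *
        PowerSeries.C ((n.factorial : 𝕜)⁻¹ * a lam μ) *
        PowerSeries.C ((n.factorial : 𝕜)⁻¹ * a lam ν) := by
    intro μ ν
    ext d
    rw [PowerSeries.coeff_mk, classPairing_jmHom (weightPoly_isSymmetric G d n), map_sum, mul_sum,
      mul_sum]
    refine sum_congr rfl fun lam _ => ?_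
    rw [PowerSeries.coeff_mul_C, PowerSeries.coeff_mul_C, contentProduct_eq, eval_weightPoly]
    ring
  simp_rw [hs, hc, mul_assoc, sum_mul_sum, Fintype.sum_prod_type, map_sum, sum_mul, mul_sum]
  rw [sum_comm]
  refine sum_congr rfl fun μ _ => ?_
  rw [sum_comm]
  refine sum_congr rfl fun ν _ => sum_congr rfl fun lam _ => ?_
  simp only [map_mul]
  ring

theorem tau_eq (G : 𝕜⟦X⟧) : tau G = formalSum fun x : (Σ n : ℕ, n.Partition × n.Partition) =>
      MvPowerSeries.C (PowerSeries.mk fun d => (x.1.factorial : 𝕜)⁻¹ *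
        classPairing 𝕜 x.2.1 x.2.2 (jmHom 𝕜 x.1 (weightPoly G d x.1))) *
      powerSum (tVar 𝕜) x.2.1 * powerSum (sVar 𝕜) x.2.2 := by
  ext1 m
  rw [tau, coeff_formalSum _ flowWeight, coeff_formalSum _ flowWeight, sum_schur_mul_schur]
  · intro n x m h
    exact coeff_powerSum_mul _ _ _ h
  · intro n lam m h
    simp only [schur_eq_sum, smul_tauSeries, mul_sum, sum_mul, map_sum]
    refine sum_eq_zero fun μ _ => sum_eq_zero fun ν _ => ?_
    rw [← map_intCast (MvPowerSeries.C (σ := ℕ ⊕ ℕ) (R := 𝕜⟦X⟧)),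
      ← map_intCast (MvPowerSeries.C (σ := ℕ ⊕ ℕ) (R := 𝕜⟦X⟧))]
    refine Eq.trans (congrArg _ ?_) (coeff_powerSum_mul
      (contentProduct G lam * PowerSeries.C (((n.factorial : ℚ)⁻¹ : ℚ) : 𝕜) *
      PowerSeries.C (((n.factorial : ℚ)⁻¹ : ℚ) : 𝕜) *
      ((∑ g with cycleClass g = ν, chi (shiftedRows lam) g : ℤ) : 𝕜⟦X⟧) *
      ((∑ g with cycleClass g = μ, chi (shiftedRows lam) g : ℤ) : 𝕜⟦X⟧)) ν μ h)
    simp only [map_mul]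
    ring

end Tau

end

end QuantumHurwitz

open scoped PowerSeries Polynomial

namespace QuantumHurwitz

noncomputable section

/-! ### Combinatorial Hurwitz numbers and Jucys–Murphy elements -/

open Equiv Finset
open scoped IsMulCommutative

/-! ### Distributivity for ordered products in a noncommutative ring. -/

section Expansion

variable {ι B : Type*} [Fintype ι] [Semiring B]

theorem sum_prod_ofFn {d : ℕ} (f : Fin d → ι → B) :
    ∑ a : Fin d → ι, (List.ofFn fun i => f i (a i)).prod = (List.ofFn fun i => ∑ x, f i x).prod := by
  induction d with
  | zero => simp
  | succ d ih =>
    rw [← Equiv.sum_comp (Fin.consEquiv fun _ => ι), Fintype.sum_prod_type]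
    simp only [Fin.consEquiv_apply, List.ofFn_succ, Fin.cons_zero, Fin.cons_succ, List.prod_cons]
    rw [← ih fun i => f i.succ, sum_mul_sum]

theorem sum_prod_reverse_ofFn {d : ℕ} (f : Fin d → ι → B) :
    ∑ a : Fin d → ι, (List.ofFn fun i => f i (a i)).reverse.prod =
      (List.ofFn fun i => ∑ x, f i x).reverse.prod := by
  induction d with
  | zero => simp
  | succ d ih =>
    rw [← Equiv.sum_comp (Fin.consEquiv fun _ => ι), Fintype.sum_prod_type]
    simp only [Fin.consEquiv_apply, List.ofFn_succ, Fin.cons_zero, Fin.cons_succ,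
      List.reverse_cons, List.prod_append, List.prod_singleton]
    rw [← ih fun i => f i.succ, sum_mul_sum, sum_comm]

theorem sum_filter_prod_ofFn [DecidableEq ι] {d : ℕ} (s : Fin d → Finset ι) (f : Fin d → ι → B) :
    ∑ a : Fin d → ι with ∀ i, a i ∈ s i, (List.ofFn fun i => f i (a i)).prod =
      (List.ofFn fun i => ∑ x ∈ s i, f i x).prod := by
  have h := sum_prod_ofFn fun i x => if x ∈ s i then f i x else 0
  simp_rw [← sum_filter, filter_mem_eq_inter, univ_inter] at h
  rw [← h, sum_filter]
  refine sum_congr rfl fun a _ => ?_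
  split_ifs with hs
  · simp [hs]
  · push Not at hs
    obtain ⟨i, hi⟩ := hs
    refine (List.prod_eq_zero ?_).symm
    rw [List.mem_ofFn]
    exact ⟨i, if_neg hi⟩

theorem sum_filter_prod_reverse_ofFn [DecidableEq ι] {d : ℕ} (s : Fin d → Finset ι)
    (f : Fin d → ι → B) :
    ∑ a : Fin d → ι with ∀ i, a i ∈ s i, (List.ofFn fun i => f i (a i)).reverse.prod =
      (List.ofFn fun i => ∑ x ∈ s i, f i x).reverse.prod := by
  have h := sum_prod_reverse_ofFn fun i x => if x ∈ s i then f i x else 0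
  simp_rw [← sum_filter, filter_mem_eq_inter, univ_inter] at h
  rw [← h, sum_filter]
  refine sum_congr rfl fun a _ => ?_
  split_ifs with hs
  · simp [hs]
  · push Not at hs
    obtain ⟨i, hi⟩ := hs
    refine (List.prod_eq_zero ?_).symm
    rw [List.mem_reverse, List.mem_ofFn]
    exact ⟨i, if_neg hi⟩

end Expansion

/-! ### Monotone sequences and their multiplicities. -/

section Monotone

variable {n d : ℕ}

/-- The numbers of occurrences of the values of a function. -/
def multiplicity (b : Fin d → Fin n) : Fin n →₀ ℕ :=
  Finsupp.equivFunOnFinite.symm fun x => #{i | b i = x}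

theorem multiplicity_apply (b : Fin d → Fin n) (x : Fin n) : multiplicity b x = #{i | b i = x} := rfl

theorem count_ofFn (b : Fin d → Fin n) (x : Fin n) :
    (List.ofFn b).count x = multiplicity b x := by
  rw [multiplicity_apply, ← Multiset.coe_count, ← Fin.univ_val_map, Multiset.count_map]
  simp only [eq_comm (a := x)]
  rfl

theorem multiplicity_mem (b : Fin d → Fin n) :
    multiplicity b ∈ finsuppAntidiag univ d := by
  rw [mem_finsuppAntidiag]
  refine ⟨?_, subset_univ _⟩
  change ∑ x, #{i | b i = x} = d
  rw [← card_eq_sum_card_fiberwise fun _ _ => mem_coe.2 (mem_univ _), card_univ, Fintype.card_fin]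

theorem multiplicity_injOn : Set.InjOn (multiplicity : (Fin d → Fin n) → _) {b | Monotone b} := by
  intro b hb b' hb' h
  refine List.ofFn_injective (List.Perm.eq_of_pairwise (le := (· ≤ ·))
    (fun _ _ _ _ h1 h2 => le_antisymm h1 h2) (List.sortedLE_ofFn_iff.2 hb).pairwise
    (List.sortedLE_ofFn_iff.2 hb').pairwise ?_)
  rw [List.perm_iff_count]
  intro x
  rw [count_ofFn, count_ofFn, h]

theorem exists_monotone_multiplicity {k : Fin n →₀ ℕ} (hk : k ∈ finsuppAntidiag univ d) :
    ∃ b : Fin d → Fin n, Monotone b ∧ multiplicity b = k := by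
  set l := (Finsupp.toMultiset k).sort (· ≤ ·) with hl
  have hlen : l.length = d := by
    rw [hl, Multiset.length_sort, Finsupp.card_toMultiset, Finsupp.sum_fintype _ _ fun _ => rfl]
    exact (mem_finsuppAntidiag.1 hk).1
  subst hlen
  have h1 : List.ofFn l.get = l := List.ofFn_get l
  refine ⟨l.get, ?_, ?_⟩
  · rw [← List.sortedLE_ofFn_iff, h1]
    exact (Multiset.pairwise_sort (Finsupp.toMultiset k) (· ≤ ·)).sortedLE
  · ext x
    rw [← count_ofFn, h1, ← Multiset.coe_count, hl, Multiset.sort_eq, Finsupp.count_toMultiset]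

/-- The signature of a sequence of transpositions as a partition. -/
def signaturePartition (b : Fin d → Fin n) : d.Partition where
  parts := signature b
  parts_pos {i} hi := by
    obtain ⟨x, hx, rfl⟩ := Multiset.mem_map.1 hi
    obtain ⟨j, -, rfl⟩ := mem_image.1 (mem_def.2 hx)
    exact card_pos.2 ⟨j, mem_filter.2 ⟨mem_univ _, rfl⟩⟩
  parts_sum := by
    refine Eq.trans ?_ (Fintype.card_fin d)
    rw [← card_univ, card_eq_sum_card_image b]
    rfl

/-- The signature lists only values that occur; `F 0 = 1` lets the product run over all values. This
is where a weight generating function must have constant term 1. -/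
theorem prod_signature {B : Type*} [CommMonoid B] (F : ℕ → B) (h0 : F 0 = 1) (b : Fin d → Fin n) :
    ((signature b).map F).prod = ∏ x, F (multiplicity b x) := by
  rw [signature, Multiset.map_map]
  refine (prod_subset (subset_univ (univ.image b)) fun x _ hx => ?_ :
    ∏ x ∈ univ.image b, F (multiplicity b x) = _)
  rw [multiplicity_apply, filter_false_of_mem, card_empty, h0]
  intro i _ hi
  exact hx (mem_image.2 ⟨i, mem_univ _, hi⟩)

end Monotone

/-! ### Monotone paths as products of Jucys–Murphy elements. -/

section Paths

variable {n d : ℕ}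

theorem pathCount_eq (lam : d.Partition) (μ ν : n.Partition) : pathCount lam μ ν =
    ∑ b : Fin d → Fin n with Monotone b, if signaturePartition b = lam then
      ∑ a : Fin d → Fin n with ∀ i, a i ∈ filter (· < b i) univ,
        #{h : Perm (Fin n) | cycleClass h = μ ∧
          cycleClass ((List.ofFn fun i => swap (a i) (b i)).reverse.prod * h) = ν} else 0 := by
  classical
  let e : MonotonePath lam μ ν ≃ {x : (Fin d → Fin n) × (Fin d → Fin n) × Perm (Fin n) //
      Monotone x.1 ∧ signaturePartition x.1 = lam ∧ (∀ i, x.2.1 i ∈ filter (· < x.1 i) univ) ∧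
      cycleClass x.2.2 = μ ∧
        cycleClass ((List.ofFn fun i => swap (x.2.1 i) (x.1 i)).reverse.prod * x.2.2) = ν} :=
    { toFun := fun p => ⟨(p.b, p.a, p.start), p.monotone, Nat.Partition.ext p.signature_eq,
        fun i => by simpa using p.lt i, (inClass_iff _ _).1 p.start_mem, (inClass_iff _ _).1 p.end_mem⟩
      invFun := fun x =>
        { start := x.1.2.2
          a := x.1.2.1
          b := x.1.1
          lt := fun i => by simpa using x.2.2.2.1 i
          monotone := x.2.1
          signature_eq := congrArg Nat.Partition.parts x.2.2.1
          start_mem := (inClass_iff _ _).2 x.2.2.2.2.1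
          end_mem := (inClass_iff _ _).2 x.2.2.2.2.2 }
      left_inv := fun p => rfl
      right_inv := fun x => rfl }
  rw [pathCount, Nat.card_congr e, Nat.card_eq_fintype_card, Fintype.card_subtype, card_filter,
    Fintype.sum_prod_type, sum_filter]
  refine sum_congr rfl fun b _ => ?_
  rw [Fintype.sum_prod_type]
  by_cases hb : Monotone b
  · by_cases hs : signaturePartition b = lam
    · simp only [hb, hs, true_and, if_true]
      rw [sum_filter]
      refine sum_congr rfl fun a _ => ?_
      split_ifs with ha
      · simp only [ha, card_filter, true_and, implies_true]
      · simp only [ha, false_and, if_false, sum_const_zero]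
    · simp [hs]
  · simp [hb]

theorem classPairing_perm {R : Type*} [CommRing R] (μ ν : n.Partition) (w : Perm (Fin n)) :
    classPairing R μ ν (perm R w) =
      #{h : Perm (Fin n) | cycleClass h = μ ∧ cycleClass (w * h) = ν} := by
  rw [classPairing_apply, card_filter, Nat.cast_sum, sum_filter]
  refine sum_congr rfl fun h _ => ?_
  by_cases hh : cycleClass h = μ
  · rw [if_pos hh, sum_filter, sum_eq_single (w * h)]
    · simp [hh]
    · intro h' _ hne
      have : w ≠ h' * h⁻¹ := fun e => hne (by rw [e, inv_mul_cancel_right])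
      simp [this]
    · simp
  · simp [hh]

/-- A monomial in the Jucys–Murphy elements is a monotone sequence of second letters, and expanding
each element chooses the first letters. -/
theorem jmHom_weightPoly {R : Type*} [CommRing R] (G : R⟦X⟧) : jmHom R n (weightPoly G d n) =
    ∑ b : Fin d → Fin n with Monotone b, (∏ x, PowerSeries.coeff (multiplicity b x) G) •
      ∑ a : Fin d → Fin n with ∀ i, a i ∈ filter (· < b i) univ,
        perm R (List.ofFn fun i => swap (a i) (b i)).reverse.prod := by
  have h1 : weightPoly G d n = ∑ k ∈ finsuppAntidiag univ d,
      (∏ x, PowerSeries.coeff (k x) G) • ∏ x, MvPolynomial.X x ^ k x := by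
    rw [weightPoly, PowerSeries.coeff_prod]
    refine sum_congr rfl fun k _ => ?_
    simp_rw [PowerSeries.coeff_mk]
    rw [prod_mul_distrib, ← map_prod, MvPolynomial.C_mul']
  -- The variables commute, so the product may be written in reverse order, to match paths that
  -- multiply on the left.
  have h2 : ∀ b : Fin d → Fin n, (∏ x, MvPolynomial.X x ^ multiplicity b x : MvPolynomial (Fin n) R) =
      (List.ofFn fun i => MvPolynomial.X (b i)).reverse.prod := by
    intro b
    rw [List.prod_reverse, List.prod_ofFn]
    simp_rw [multiplicity_apply]
    rw [← prod_fiberwise univ b]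
    refine prod_congr rfl fun x _ => ?_
    rw [prod_congr rfl (g := fun _ => MvPolynomial.X x) fun i hi => by rw [(mem_filter.1 hi).2],
      prod_const]
  rw [h1, map_sum]
  symm
  refine sum_bij (fun b _ => multiplicity b) (fun b _ => multiplicity_mem b) ?_ ?_ ?_
  · intro b hb b' hb' h
    exact multiplicity_injOn (mem_filter.1 hb).2 (mem_filter.1 hb').2 h
  · intro k hk
    obtain ⟨b, hb, rfl⟩ := exists_monotone_multiplicity hk
    exact ⟨b, mem_filter.2 ⟨mem_univ _, hb⟩, rfl⟩
  · intro b _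
    rw [map_smul, h2, map_list_prod, List.map_reverse, List.map_ofFn]
    congr 1
    have h3 := sum_filter_prod_reverse_ofFn (fun i => filter (· < b i) univ)
      fun i x => perm R (swap x (b i))
    refine Eq.trans (sum_congr rfl fun a _ => ?_) (h3.trans ?_)
    · refine (map_list_prod (MonoidAlgebra.of R (Perm (Fin n))) _).trans ?_
      rw [List.map_reverse, List.map_ofFn]
      rfl
    · congr 3
      funext i
      simp [jm]

theorem combinatorialHurwitz_eq {𝕜 : Type*} [NormedField 𝕜] (G : 𝕜⟦X⟧)
    (hG : PowerSeries.coeff 0 G = 1) (d : ℕ) (μ ν : n.Partition) :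
    combinatorialHurwitz G d μ ν =
      (n.factorial : 𝕜)⁻¹ * classPairing 𝕜 μ ν (jmHom 𝕜 n (weightPoly G d n)) := by
  rw [combinatorialHurwitz, jmHom_weightPoly]
  congr 1
  simp_rw [pathCount_eq, map_sum, map_smul, map_sum, classPairing_perm, Nat.cast_sum, mul_sum]
  rw [sum_comm]
  refine sum_congr rfl fun b _ => ?_
  rw [sum_eq_single (signaturePartition b)]
  · rw [if_pos rfl, Nat.cast_sum, smul_eq_mul]
    congr 1
    exact prod_signature (fun k => PowerSeries.coeff k G) hG b
  · intro lam _ h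
    rw [if_neg h.symm]
    simp
  · simp

end Paths

end

end QuantumHurwitz

open scoped PowerSeries Polynomial

namespace QuantumHurwitz

noncomputable section

/-! ### Geometric Hurwitz numbers and class sums -/

open Equiv Finset
open scoped IsMulCommutative

section Covers

variable {n : ℕ}

theorem Monodromy.ext' {L : List n.Partition} {x y : Monodromy L} (h : x.g = y.g) : x = y := by
  cases x
  cases y
  cases h
  rfl

instance (L : List n.Partition) : Finite (Monodromy L) :=
  Finite.of_injective (fun x : Monodromy L => x.g) fun _ _ h => Monodromy.ext' h

instance monodromyAction (L : List n.Partition) : MulAction (Perm (Fin n)) (Monodromy L) where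
  smul s x :=
    { g := fun i => s * x.g i * s⁻¹
      profile := fun i => by
        have := x.profile i
        rw [inClass_iff] at this ⊢
        rw [cycleClass_conj, this]
      prod_eq_one := by
        have h := congrArg (MulAut.conj s) x.prod_eq_one
        rw [map_list_prod, List.map_ofFn, map_one] at h
        exact h }
  one_smul x := Monodromy.ext' (funext fun i => by
    change 1 * x.g i * 1⁻¹ = x.g i
    group)
  mul_smul s t x := Monodromy.ext' (funext fun i => by
    change (s * t) * x.g i * (s * t)⁻¹ = s * (t * x.g i * t⁻¹) * s⁻¹
    group)
-- Orbit–stabilizer for conjugation: the automorphism groups are the stabilizers, so each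
-- isomorphism class contains $n!/|\mathrm{Aut}|$ monodromies.
theorem factorial_mul_hurwitz (L : List n.Partition) :
    (n.factorial : ℚ) * hurwitz L = Nat.card (Monodromy L) := by
  classical
  have hset : Monodromy.setoid L = MulAction.orbitRel (Perm (Fin n)) (Monodromy L) := by
    ext x y
    constructor
    · rintro ⟨s, hs⟩
      refine ⟨s⁻¹, Monodromy.ext' (funext fun i => ?_)⟩
      change s⁻¹ * y.g i * s⁻¹⁻¹ = x.g i
      rw [← hs]
      group
    · rintro ⟨s, hs⟩
      refine ⟨s⁻¹, fun i => ?_⟩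
      rw [← hs]
      change s⁻¹ * (s * y.g i * s⁻¹) * s⁻¹⁻¹ = y.g i
      group
  have := Fintype.ofFinite (Monodromy L)
  have := Fintype.ofFinite (Quotient (MulAction.orbitRel (Perm (Fin n)) (Monodromy L)))
  have haut : ∀ x : Monodromy L, x.autCard =
      Fintype.card (MulAction.stabilizer (Perm (Fin n)) x) := by
    intro x
    rw [Monodromy.autCard, ← Nat.card_eq_fintype_card]
    refine Nat.card_congr (Equiv.subtypeEquivRight fun s => ?_)
    rw [MulAction.mem_stabilizer_iff]
    exact ⟨fun h => Monodromy.ext' (funext h), fun h i => congrArg (fun y => y.g i) h⟩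
  rw [hurwitz, hset, finsum_eq_sum_of_fintype, mul_sum, Nat.card_eq_fintype_card,
    MulAction.card_eq_sum_card_group_div_card_stabilizer' (Perm (Fin n)) (Monodromy L)
      (φ := Quotient.out) Quotient.out_eq', Nat.cast_sum]
  refine sum_congr rfl fun x _ => ?_
  rw [Nat.cast_div, Fintype.card_perm, Fintype.card_fin, haut, div_eq_mul_inv]
  · rw [← Nat.card_eq_fintype_card, ← Nat.card_eq_fintype_card]
    exact Subgroup.card_subgroup_dvd_card _
  · exact Nat.cast_ne_zero.2 Fintype.card_ne_zero

theorem coeff_prod_classSum {R : Type*} [CommRing R] (L : List n.Partition) :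
    (L.map (classSum R)).prod.coeff 1 = Nat.card (Monodromy L) := by
  classical
  let e : Monodromy L ≃ {g : Fin L.length → Perm (Fin n) //
      (∀ i, g i ∈ filter (fun h => cycleClass h = L.get i) univ) ∧ (List.ofFn g).prod = 1} :=
    { toFun := fun x => ⟨x.g, fun i => by simpa using (inClass_iff _ _).1 (x.profile i),
        x.prod_eq_one⟩
      invFun := fun g => ⟨g.1, fun i => (inClass_iff _ _).2 (by simpa using g.2.1 i), g.2.2⟩
      left_inv := fun _ => rfl
      right_inv := fun _ => rfl }
  have h1 : L.map (classSum R) = List.ofFn fun i => classSum R (L.get i) := by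
    conv_lhs => rw [← List.ofFn_get L]
    rw [List.map_ofFn]
    rfl
  have h2 := sum_filter_prod_ofFn (fun i => filter (fun h => cycleClass h = L.get i) univ)
    fun (_ : Fin L.length) g => perm R g
  rw [h1, Nat.card_congr e, Nat.card_eq_fintype_card, Fintype.card_subtype]
  refine (congrArg (fun x : GroupAlg R n => x.coeff 1) h2.symm).trans ?_
  rw [MonoidAlgebra.coeff_sum, Finset.sum_apply', ← filter_filter, card_filter, Nat.cast_sum]
  refine sum_congr rfl fun g _ => ?_
  have h3 : (List.ofFn fun i => perm R (g i)).prod = perm R (List.ofFn g).prod := by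
    refine Eq.trans ?_ (map_list_prod (MonoidAlgebra.of R (Perm (Fin n))) _).symm
    rw [List.map_ofFn]
    rfl
  rw [h3]
  simp [Finsupp.single_apply]

theorem factorial_mul_hurwitz_append {𝕜 : Type*} [Field 𝕜] [CharZero 𝕜] (L : List n.Partition)
    (μ ν : n.Partition) : (n.factorial : 𝕜) * (hurwitz (L ++ [μ, ν]) : 𝕜) =
      classPairing 𝕜 μ ν (L.map (classSum 𝕜)).prod := by
  have h := congrArg (Rat.cast : ℚ → 𝕜) (factorial_mul_hurwitz (L ++ [μ, ν]))
  push_cast at h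
  rw [h, ← coeff_prod_classSum, classPairing_eq]
  simp

end Covers

end

end QuantumHurwitz

open scoped PowerSeries Polynomial

namespace QuantumHurwitz

noncomputable section

/-! ### Expansion of finite products of generating functions -/

open Equiv Finset
open scoped IsMulCommutative

section Words

variable {R : Type*} [CommSemiring R]

/-- The sum `∑_{N > i₁ > ⋯ > i_r ≥ 0} ∏_u x_{i_u}^{w_u}`. -/
def strictSum (N : ℕ) (x : ℕ → R) {r : ℕ} (w : Fin r → ℕ) : R :=
  ∑ i ∈ Fintype.piFinset (fun _ : Fin r => range N) with StrictAnti i, ∏ u, x (i u) ^ w u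

/-- The sum `∑_{N > i₁ ≥ ⋯ ≥ i_r ≥ 0} ∏_u x_{i_u}^{w_u}`. -/
def weakSum (N : ℕ) (x : ℕ → R) {r : ℕ} (w : Fin r → ℕ) : R :=
  ∑ i ∈ Fintype.piFinset (fun _ : Fin r => range N) with Antitone i, ∏ u, x (i u) ^ w u

theorem strictSum_nil (N : ℕ) (x : ℕ → R) (w : Fin 0 → ℕ) : strictSum N x w = 1 := by
  rw [strictSum, filter_true_of_mem fun i _ => Subsingleton.strictAnti i]
  simp

theorem weakSum_nil (N : ℕ) (x : ℕ → R) (w : Fin 0 → ℕ) : weakSum N x w = 1 := by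
  rw [weakSum, filter_true_of_mem fun i _ => Subsingleton.antitone i]
  simp

theorem strictSum_zero (x : ℕ → R) {r : ℕ} (w : Fin (r + 1) → ℕ) : strictSum 0 x w = 0 := by
  rw [strictSum, filter_false_of_mem, sum_empty]
  intro i hi
  simpa using Fintype.mem_piFinset.1 hi 0

theorem weakSum_zero (x : ℕ → R) {r : ℕ} (w : Fin (r + 1) → ℕ) : weakSum 0 x w = 0 := by
  rw [weakSum, filter_false_of_mem, sum_empty]
  intro i hi
  simpa using Fintype.mem_piFinset.1 hi 0

/-- The first index is the largest: either all indices are below `N`, or the first equals `N` and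
the rest are below it. In the weak version `N` may be repeated, so there the tail keeps the bound `N
+ 1`. -/
theorem strictSum_cons (N : ℕ) (x : ℕ → R) {r : ℕ} (w : Fin (r + 1) → ℕ) :
    strictSum (N + 1) x w = strictSum N x w + x N ^ w 0 * strictSum N x (Fin.tail w) := by
  rw [strictSum, ← sum_filter_not_add_sum_filter _ (fun i => i 0 = N), strictSum, strictSum, mul_sum]
  congr 1
  · refine sum_congr ?_ fun _ _ => rfl
    ext i
    simp only [mem_filter, Fintype.mem_piFinset, mem_range]
    constructor
    · rintro ⟨⟨h1, h2⟩, h3⟩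
      refine ⟨fun a => ?_, h2⟩
      have := h2.antitone (Fin.zero_le a)
      have := h1 0
      omega
    · rintro ⟨h1, h2⟩
      exact ⟨⟨fun a => (h1 a).trans (Nat.lt_succ_self N), h2⟩, (h1 0).ne⟩
  · symm
    refine sum_bij (fun j _ => Fin.cons (α := fun _ => ℕ) N j) ?_ ?_ ?_ ?_
    · intro j hj
      simp only [mem_filter, Fintype.mem_piFinset, mem_range] at hj ⊢
      refine ⟨⟨fun a => ?_, fun a b hab => ?_⟩, Fin.cons_zero _ _⟩
      · refine Fin.cases ?_ (fun a => ?_) a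
        · simp
        · simpa using (hj.1 a).trans (Nat.lt_succ_self N)
      · revert hab
        refine Fin.cases ?_ (fun b => ?_) b
        · intro h
          exact absurd h (Fin.not_lt_zero a)
        · refine Fin.cases ?_ (fun a => ?_) a
          · intro _
            simpa using hj.1 b
          · intro h
            simpa using hj.2 (Fin.succ_lt_succ_iff.1 h)
    · intro j _ j' _ h
      exact (Fin.cons_inj.1 h).2
    · intro i hi
      simp only [mem_filter, Fintype.mem_piFinset, mem_range] at hi
      refine ⟨Fin.tail i, ?_, ?_⟩
      · simp only [mem_filter, Fintype.mem_piFinset, mem_range]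
        refine ⟨fun a => ?_, fun a b hab => hi.1.2 (Fin.succ_lt_succ_iff.2 hab)⟩
        have := hi.1.2 (Fin.succ_pos a)
        rwa [hi.2] at this
      · conv_lhs => rw [← hi.2]
        exact Fin.cons_self_tail i
    · intro j _
      rw [Fin.prod_univ_succ]
      simp [Fin.tail]

theorem weakSum_cons (N : ℕ) (x : ℕ → R) {r : ℕ} (w : Fin (r + 1) → ℕ) :
    weakSum (N + 1) x w = weakSum N x w + x N ^ w 0 * weakSum (N + 1) x (Fin.tail w) := by
  rw [weakSum, ← sum_filter_not_add_sum_filter _ (fun i => i 0 = N), weakSum, weakSum, mul_sum]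
  congr 1
  · refine sum_congr ?_ fun _ _ => rfl
    ext i
    simp only [mem_filter, Fintype.mem_piFinset, mem_range]
    constructor
    · rintro ⟨⟨h1, h2⟩, h3⟩
      refine ⟨fun a => ?_, h2⟩
      have := h2 (Fin.zero_le a)
      have := h1 0
      omega
    · rintro ⟨h1, h2⟩
      exact ⟨⟨fun a => (h1 a).trans (Nat.lt_succ_self N), h2⟩, (h1 0).ne⟩
  · symm
    refine sum_bij (fun j _ => Fin.cons (α := fun _ => ℕ) N j) ?_ ?_ ?_ ?_
    · intro j hj
      simp only [mem_filter, Fintype.mem_piFinset, mem_range] at hj ⊢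
      refine ⟨⟨fun a => ?_, fun a b hab => ?_⟩, Fin.cons_zero _ _⟩
      · refine Fin.cases ?_ (fun a => ?_) a
        · simp
        · simpa using hj.1 a
      · revert hab
        refine Fin.cases ?_ (fun a => ?_) a
        · refine Fin.cases ?_ (fun b => ?_) b
          · intro _
            exact le_rfl
          · intro _
            simpa using Nat.lt_succ_iff.1 (hj.1 b)
        · refine Fin.cases ?_ (fun b => ?_) b
          · intro h
            exact absurd h (Fin.succ_pos a).not_ge
          · intro h
            simpa using hj.2 (Fin.succ_le_succ_iff.1 h)
    · intro j _ j' _ h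
      exact (Fin.cons_inj.1 h).2
    · intro i hi
      simp only [mem_filter, Fintype.mem_piFinset, mem_range] at hi
      refine ⟨Fin.tail i, ?_, ?_⟩
      · simp only [mem_filter, Fintype.mem_piFinset, mem_range]
        exact ⟨fun a => hi.1.1 _, fun a b hab => hi.1.2 (Fin.succ_le_succ_iff.2 hab)⟩
      · conv_lhs => rw [← hi.2]
        exact Fin.cons_self_tail i
    · intro j _
      rw [Fin.prod_univ_succ]
      simp [Fin.tail]

end Words

/-! ### Products of power series as sums over compositions. -/

section Compositions

/-- The lists of positive integers of sum `d`. -/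
def posLists (d : ℕ) : Finset (List ℕ) := univ.image (Composition.blocks : Composition d → List ℕ)

theorem mem_posLists {d : ℕ} {w : List ℕ} : w ∈ posLists d ↔ (∀ b ∈ w, 0 < b) ∧ w.sum = d := by
  simp only [posLists, mem_image, mem_univ, true_and]
  constructor
  · rintro ⟨c, rfl⟩
    exact ⟨fun b hb => c.blocks_pos hb, c.blocks_sum⟩
  · rintro ⟨h1, h2⟩
    exact ⟨⟨w, fun {b} hb => h1 b hb, h2⟩, rfl⟩

theorem sum_posLists {B : Type*} [AddCommMonoid B] (d : ℕ) (F : List ℕ → B) :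
    ∑ w ∈ posLists d, F w = (if d = 0 then F [] else 0) +
      ∑ p ∈ antidiagonal d, if p.1 = 0 then 0 else ∑ w ∈ posLists p.2, F (p.1 :: w) := by
  classical
  have h : posLists d = (if d = 0 then {[]} else ∅) ∪ ((antidiagonal d).filter (fun p => p.1 ≠ 0)).biUnion
      fun p => (posLists p.2).map ⟨fun w => p.1 :: w, List.cons_injective⟩ := by
    ext w
    simp only [mem_union, mem_biUnion, mem_filter, HasAntidiagonal.mem_antidiagonal, mem_map,
      Function.Embedding.coeFn_mk, mem_posLists]
    cases w with
    | nil =>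
      by_cases hd : d = 0
      · simp [hd]
      · simp [hd, Ne.symm hd]
    | cons b w =>
      constructor
      · rintro ⟨h1, h2⟩
        refine Or.inr ⟨(b, w.sum), ⟨by simpa using h2, (h1 b (by simp)).ne'⟩, w, ⟨fun a ha => h1 a (by simp [ha]), rfl⟩, rfl⟩
      · rintro (h | ⟨⟨b', e⟩, ⟨h1, h2⟩, w', ⟨h3, h4⟩, h5⟩)
        · split_ifs at h <;> simp at h
        · simp only [List.cons.injEq] at h5
          obtain ⟨rfl, rfl⟩ := h5
          refine ⟨fun a ha => ?_, by simpa [h4] using h1⟩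
          rcases List.mem_cons.1 ha with rfl | ha
          · exact Nat.pos_of_ne_zero h2
          · exact h3 a ha
  rw [h, sum_union, sum_biUnion, sum_filter]
  · congr 1
    · split_ifs <;> simp
    · refine sum_congr rfl fun p _ => ?_
      by_cases hp : p.1 = 0
      · simp [hp]
      · simp [hp]
  · intro p hp p' hp' hne
    refine disjoint_left.2 fun w hw hw' => hne ?_
    simp only [mem_map, Function.Embedding.coeFn_mk] at hw hw'
    obtain ⟨v, hv, rfl⟩ := hw
    obtain ⟨v', hv', h5⟩ := hw'
    simp only [List.cons.injEq] at h5
    obtain ⟨h6, rfl⟩ := h5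
    exact Prod.ext h6.symm ((mem_posLists.1 hv).2.symm.trans (mem_posLists.1 hv').2)
  · refine disjoint_left.2 fun w hw hw' => ?_
    split_ifs at hw
    · rw [mem_singleton] at hw
      subst hw
      simp at hw'
    · simp at hw

variable {𝕜 B : Type*} [CommRing 𝕜] [CommRing B] [Algebra 𝕜 B] (Y : ℕ → B) (x : ℕ → 𝕜)

/-- The series `1 + ∑_{m ≥ 1} Y_m z^m`. -/
def onePlus (Y : ℕ → B) : B⟦X⟧ := PowerSeries.mk fun m => if m = 0 then 1 else Y m

/-- The substitution `z ↦ a z`. -/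
def scale (a : 𝕜) : B⟦X⟧ →+* B⟦X⟧ := PowerSeries.rescale (algebraMap 𝕜 B a)

theorem coeff_scale (a : 𝕜) (f : B⟦X⟧) (m : ℕ) :
    PowerSeries.coeff m (scale a f) = a ^ m • PowerSeries.coeff m f := by
  rw [scale, PowerSeries.coeff_rescale, ← map_pow, Algebra.smul_def]

theorem coeff_scale_onePlus_mul (a : 𝕜) (f : B⟦X⟧) (d : ℕ) :
    PowerSeries.coeff d (scale a (onePlus Y) * f) = PowerSeries.coeff d f +
      ∑ p ∈ antidiagonal d, if p.1 = 0 then 0 else (a ^ p.1 • Y p.1) * PowerSeries.coeff p.2 f := by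
  have h : scale a (onePlus Y) = 1 + PowerSeries.mk fun m => if m = 0 then 0 else a ^ m • Y m := by
    ext m
    rw [coeff_scale, onePlus, PowerSeries.coeff_mk, map_add, PowerSeries.coeff_one,
      PowerSeries.coeff_mk]
    split_ifs with hm <;> simp [hm]
  rw [h, add_mul, one_mul, map_add, PowerSeries.coeff_mul]
  congr 1
  refine sum_congr rfl fun p _ => ?_
  rw [PowerSeries.coeff_mk, ite_mul, zero_mul]

theorem coeff_prod_onePlus (N d : ℕ) :
    PowerSeries.coeff d (∏ k ∈ range N, scale (x k) (onePlus Y)) =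
      ∑ w ∈ posLists d, strictSum N x w.get • (w.map Y).prod := by
  induction N generalizing d with
  | zero =>
    rw [prod_range_zero, sum_posLists, PowerSeries.coeff_one, sum_eq_zero, add_zero]
    · simp [strictSum_nil]
    · intro p _
      split_ifs
      · rfl
      · refine sum_eq_zero fun w _ => ?_
        rw [show strictSum 0 x (p.1 :: w).get = 0 from strictSum_zero x _, zero_smul]
  | succ N ih =>
    rw [prod_range_succ, mul_comm, coeff_scale_onePlus_mul, ih, sum_posLists d, sum_posLists d,
      add_assoc, ← sum_add_distrib]
    congr 1
    refine sum_congr rfl fun p _ => ?_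
    split_ifs
    · rw [add_zero]
    · rw [ih, mul_sum, ← sum_add_distrib]
      refine sum_congr rfl fun w _ => ?_
      rw [show strictSum (N + 1) x (p.1 :: w).get =
        strictSum N x (p.1 :: w).get + x N ^ p.1 * strictSum N x w.get from strictSum_cons N x _,
        add_smul, List.map_cons, List.prod_cons, smul_mul_smul_comm]

/-- The inverse of a product $\prod_kY(x_kz)$ has weakly ordered indices and one sign per letter,
generalizing the relation between elementary and complete functions. -/
theorem prod_onePlus_mul (N : ℕ) :
    (∏ k ∈ range N, scale (x k) (onePlus Y)) * (PowerSeries.mk fun d =>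
      ∑ w ∈ posLists d, ((-1) ^ w.length * weakSum N x w.get) • (w.map Y).prod) = 1 := by
  induction N with
  | zero =>
    rw [prod_range_zero, one_mul]
    ext d
    rw [PowerSeries.coeff_mk, sum_posLists, PowerSeries.coeff_one, sum_eq_zero, add_zero]
    · simp [weakSum_nil]
    · intro p _
      split_ifs
      · rfl
      · refine sum_eq_zero fun w _ => ?_
        rw [show weakSum 0 x (p.1 :: w).get = 0 from weakSum_zero x _, mul_zero, zero_smul]
  | succ N ih =>
    rw [prod_range_succ, mul_assoc]
    -- It remains to see that the last factor turns the series for `N + 1` into that for `N`: the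
    -- term of `weakSum_cons` with first index `N` cancels against the product, by the sign of the
    -- extra letter.
    convert ih using 2
    ext d
    rw [coeff_scale_onePlus_mul, PowerSeries.coeff_mk, PowerSeries.coeff_mk, sum_posLists d,
      sum_posLists d, add_assoc, ← sum_add_distrib]
    congr 1
    refine sum_congr rfl fun p _ => ?_
    split_ifs
    · rw [add_zero]
    · rw [PowerSeries.coeff_mk, mul_sum, ← sum_add_distrib]
      refine sum_congr rfl fun w _ => ?_
      rw [show weakSum (N + 1) x (p.1 :: w).get =
        weakSum N x (p.1 :: w).get + x N ^ p.1 * weakSum (N + 1) x w.get from weakSum_cons N x _,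
        List.map_cons, List.prod_cons, smul_mul_smul_comm, ← add_smul,
        show (-1 : 𝕜) ^ (p.1 :: w).length = -(-1) ^ w.length by rw [List.length_cons, pow_succ]; ring]
      congr 1
      ring

end Compositions

end

end QuantumHurwitz

open scoped PowerSeries Polynomial

namespace QuantumHurwitz

noncomputable section

/-! ### Monomial and forgotten sums, and products over letters -/

open Equiv Finset
open scoped IsMulCommutative

section Rearrangements

theorem card_stabilizer_get (l : List ℕ) :
    #{σ : Perm (Fin l.length) | l.get ∘ σ = l.get} = autOrder l := by
  rw [← Fintype.card_subtype, DomMulAct.stabilizer_card', autOrder]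
  have h : univ.image l.get = l.toFinset := by
    ext a
    simp [List.mem_iff_get]
  rw [h]
  refine prod_congr rfl fun a _ => ?_
  rw [Fintype.card_subtype, ← Multiset.coe_count]
  congr 1
  conv_rhs => rw [← List.ofFn_get l, ← Fin.univ_val_map, Multiset.count_map]
  simp only [eq_comm (a := a)]
  rfl

/-- The permutations producing `w` form a coset of the stabilizer of `l`. -/
theorem card_rearrangement {l w : List ℕ} (h : l.Perm w) :
    #{σ : Perm (Fin l.length) | List.ofFn (l.get ∘ σ) = w} = autOrder l := by
  have hw : ∃ g : Fin l.length → ℕ, List.ofFn g = w := by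
    rw [h.length_eq]
    exact ⟨w.get, List.ofFn_get w⟩
  obtain ⟨g, rfl⟩ := hw
  obtain ⟨τ, rfl⟩ := exists_perm_comp_eq (f := l.get) (f' := g) (by
    rw [Fin.univ_val_map, Fin.univ_val_map, List.ofFn_get]
    exact Multiset.coe_eq_coe.2 h)
  rw [← card_stabilizer_get]
  refine card_bij (fun σ _ => σ * τ⁻¹) ?_ ?_ ?_
  · intro σ hσ
    have h1 := List.ofFn_injective (mem_filter.1 hσ).2
    refine mem_filter.2 ⟨mem_univ _, funext fun i => ?_⟩
    have := congrFun h1 (τ⁻¹ i)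
    simpa using this
  · intro σ _ σ' _ h
    exact mul_right_cancel h
  · intro σ hσ
    refine ⟨σ * τ, mem_filter.2 ⟨mem_univ _, ?_⟩, by simp⟩
    congr 1
    funext i
    have := congrFun (mem_filter.1 hσ).2 (τ i)
    simpa using this

theorem autOrder_ne_zero (l : List ℕ) : autOrder l ≠ 0 :=
  prod_ne_zero_iff.2 fun _ _ => Nat.factorial_ne_zero _

/-- The parts of a partition in weakly decreasing order. -/
def sortedParts {d : ℕ} (lam : d.Partition) : List ℕ := lam.parts.sort (· ≥ ·)

theorem coe_sortedParts {d : ℕ} (lam : d.Partition) : (sortedParts lam : Multiset ℕ) = lam.parts :=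
  Multiset.sort_eq _ _

theorem sortedParts_pairwise {d : ℕ} (lam : d.Partition) : (sortedParts lam).Pairwise (· ≥ ·) :=
  Multiset.pairwise_sort _ _

theorem sum_posLists_eq {B : Type*} [AddCommMonoid B] (d : ℕ) (F : List ℕ → B) :
    ∑ w ∈ posLists d, F w =
      ∑ lam : d.Partition, ∑ w ∈ posLists d with (sortedParts lam).Perm w, F w := by
  simp_rw [sum_filter]
  rw [sum_comm]
  refine sum_congr rfl fun w hw => ?_
  obtain ⟨h1, h2⟩ := mem_posLists.1 hw
  rw [sum_eq_single (⟨(w : Multiset ℕ), fun {i} hi => h1 i (Multiset.mem_coe.1 hi), by simpa using h2⟩ :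
    d.Partition)]
  · rw [if_pos]
    rw [← Multiset.coe_eq_coe, coe_sortedParts]
  · intro lam _ hne
    rw [if_neg]
    intro h
    apply hne
    refine Nat.Partition.ext ?_
    rw [← coe_sortedParts]
    exact Multiset.coe_eq_coe.2 h
  · simp

variable {𝕜 : Type*} [Field 𝕜] [CharZero 𝕜]

/-- Each distinct rearrangement is hit `autOrder` times; this is the origin of the factor
$1/|\mathrm{aut}(\lambda)|$ in the weights. -/
theorem sum_rearrangement {d : ℕ} (lam : d.Partition) (F : List ℕ → 𝕜) :
    ∑ w ∈ posLists d with (sortedParts lam).Perm w, F w = (autOrder (sortedParts lam) : 𝕜)⁻¹ *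
      ∑ σ : Perm (Fin (sortedParts lam).length), F (List.ofFn ((sortedParts lam).get ∘ σ)) := by
  have hmaps : ∀ σ ∈ (univ : Finset (Perm (Fin (sortedParts lam).length))),
      List.ofFn ((sortedParts lam).get ∘ σ) ∈
        filter (fun w => (sortedParts lam).Perm w) (posLists d) := by
    intro σ _
    have h : (sortedParts lam).Perm (List.ofFn ((sortedParts lam).get ∘ σ)) := by
      have := σ.ofFn_comp_perm (sortedParts lam).get
      rw [List.ofFn_get] at this
      exact this.symm
    refine mem_filter.2 ⟨mem_posLists.2 ⟨fun b hb => ?_, ?_⟩, h⟩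
    · rw [← h.mem_iff] at hb
      refine lam.parts_pos ?_
      rw [← coe_sortedParts]
      exact hb
    · rw [← h.sum_eq, ← Multiset.sum_coe, coe_sortedParts, lam.parts_sum]
  rw [← sum_fiberwise_of_maps_to hmaps, mul_sum]
  refine sum_congr rfl fun w hw => ?_
  rw [sum_congr rfl (g := fun _ => F w) fun σ hσ => by rw [(mem_filter.1 hσ).2], sum_const,
    card_rearrangement (mem_filter.1 hw).2, nsmul_eq_mul,
    inv_mul_cancel_left₀ (Nat.cast_ne_zero.2 (autOrder_ne_zero _))]

/-- The monomial symmetric function in the variables `x₀, …, x_{N-1}`. -/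
def monomialSum (N : ℕ) (x : ℕ → 𝕜) (a : List ℕ) : 𝕜 :=
  (autOrder a : 𝕜)⁻¹ * ∑ σ : Perm (Fin a.length), strictSum N x (a.get ∘ σ)

/-- The forgotten symmetric function in the variables `x₀, …, x_{N-1}`, up to a sign. -/
def forgottenSum (N : ℕ) (x : ℕ → 𝕜) (a : List ℕ) : 𝕜 :=
  (autOrder a : 𝕜)⁻¹ * ∑ σ : Perm (Fin a.length), weakSum N x (a.get ∘ σ)

theorem apply_get_ofFn {C : Type*} (F : ∀ {r : ℕ}, (Fin r → ℕ) → C) {r : ℕ} (f : Fin r → ℕ) :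
    F (List.ofFn f).get = F f := by
  have h : ∀ (l : List ℕ) (hl : r = l.length), (∀ u, l.get (Fin.cast hl u) = f u) →
      F l.get = F f := by
    rintro l rfl h
    congr 1
    exact funext h
  exact h _ (List.length_ofFn).symm fun u => by simp

variable {B : Type*} [CommRing B] [Algebra 𝕜 B]

theorem sum_posLists_smul (d : ℕ) (Y : ℕ → B) (F : List ℕ → 𝕜) :
    ∑ w ∈ posLists d, F w • (w.map Y).prod = ∑ lam : d.Partition,
      ((autOrder (sortedParts lam) : 𝕜)⁻¹ * ∑ σ : Perm (Fin (sortedParts lam).length),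
        F (List.ofFn ((sortedParts lam).get ∘ σ))) • ((sortedParts lam).map Y).prod := by
  rw [sum_posLists_eq]
  refine sum_congr rfl fun lam _ => ?_
  rw [← sum_rearrangement, sum_smul]
  refine sum_congr rfl fun w hw => ?_
  rw [((mem_filter.1 hw).2.map Y).prod_eq]

theorem sum_posLists_strictSum (N d : ℕ) (x : ℕ → 𝕜) (Y : ℕ → B) :
    ∑ w ∈ posLists d, strictSum N x w.get • (w.map Y).prod = ∑ lam : d.Partition,
      monomialSum N x (sortedParts lam) • ((sortedParts lam).map Y).prod := by
  rw [sum_posLists_smul d Y fun w => strictSum N x w.get]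
  simp_rw [apply_get_ofFn fun {r} (f : Fin r → ℕ) => strictSum N x f]
  rfl

theorem sum_posLists_weakSum (N d : ℕ) (x : ℕ → 𝕜) (Y : ℕ → B) :
    ∑ w ∈ posLists d, ((-1) ^ w.length * weakSum N x w.get) • (w.map Y).prod =
      ∑ lam : d.Partition, ((-1) ^ (sortedParts lam).length * forgottenSum N x (sortedParts lam)) •
        ((sortedParts lam).map Y).prod := by
  rw [sum_posLists_smul d Y fun w => (-1) ^ w.length * weakSum N x w.get]
  simp_rw [apply_get_ofFn fun {r} (f : Fin r → ℕ) => weakSum N x f, List.length_ofFn, ← mul_sum,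
    forgottenSum]
  refine sum_congr rfl fun lam _ => ?_
  rw [mul_left_comm]

end Rearrangements

/-! ### Words in letters of prescribed weights. -/

section Letters

variable {P : Type*} [DecidableEq P]

/-- The lists of letters with prescribed weights, where `S m` are the letters of weight `m`. -/
def letterLists (S : ℕ → Finset P) : List ℕ → Finset (List P)
  | [] => {[]}
  | m :: ms => (S m ×ˢ letterLists S ms).image fun p => p.1 :: p.2

theorem mem_letterLists {S : ℕ → Finset P} {ms : List ℕ} {L : List P} :
    L ∈ letterLists S ms ↔ List.Forall₂ (fun p m => p ∈ S m) L ms := by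
  induction ms generalizing L with
  | nil => simp [letterLists]
  | cons m ms ih =>
    simp only [letterLists, mem_image, mem_product, Prod.exists, ih, List.forall₂_cons_right_iff]
    constructor
    · rintro ⟨p, L', ⟨h1, h2⟩, rfl⟩
      exact ⟨p, L', h1, h2, rfl⟩
    · rintro ⟨p, L', h1, h2, rfl⟩
      exact ⟨p, L', ⟨h1, h2⟩, rfl⟩

theorem sum_letterLists {B : Type*} [CommSemiring B] (S : ℕ → Finset P) (y : P → B) (ms : List ℕ) :
    ∑ L ∈ letterLists S ms, (L.map y).prod = (ms.map fun m => ∑ p ∈ S m, y p).prod := by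
  induction ms with
  | nil => simp [letterLists]
  | cons m ms ih =>
    rw [letterLists, sum_image, sum_product, List.map_cons, List.prod_cons, ← ih, sum_mul_sum]
    · simp
    · rintro ⟨p, L⟩ _ ⟨p', L'⟩ _ h
      simp only [List.cons.injEq] at h
      exact Prod.ext h.1 h.2

theorem map_of_mem_letterLists {S : ℕ → Finset P} {a : P → ℕ} (ha : ∀ m, ∀ p ∈ S m, a p = m)
    {ms : List ℕ} {L : List P} (h : L ∈ letterLists S ms) : L.map a = ms := by
  rw [mem_letterLists] at h
  induction h with
  | nil => rfl
  | cons h1 _ ih => rw [List.map_cons, ih, ha _ _ h1]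

/-- The lists of letters of total weight `d`, sorted by weight. -/
def sortedLists (S : ℕ → Finset P) (d : ℕ) : Finset (List P) :=
  univ.biUnion fun lam : d.Partition => letterLists S (sortedParts lam)

theorem sum_sortedLists {B : Type*} [AddCommMonoid B] {S : ℕ → Finset P} {a : P → ℕ}
    (ha : ∀ m, ∀ p ∈ S m, a p = m) (d : ℕ) (F : List P → B) :
    ∑ L ∈ sortedLists S d, F L =
      ∑ lam : d.Partition, ∑ L ∈ letterLists S (sortedParts lam), F L := by
  rw [sortedLists, sum_biUnion]
  intro lam _ lam' _ hne
  refine disjoint_left.2 fun L h h' => hne (Nat.Partition.ext ?_)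
  rw [← coe_sortedParts, ← coe_sortedParts, ← map_of_mem_letterLists ha h,
    map_of_mem_letterLists ha h']

/-- Parts are positive, so only the sets `S m` with `0 < m` matter. This excludes the empty species,
which has weight 0 and is not admissible. -/
theorem mem_sortedLists {S : ℕ → Finset P} {a : P → ℕ} {good : P → Prop}
    (ha : ∀ m, 0 < m → ∀ p, p ∈ S m ↔ good p ∧ a p = m) (hpos : ∀ p, good p → 0 < a p) {d : ℕ}
    {L : List P} : L ∈ sortedLists S d ↔
      (∀ p ∈ L, good p) ∧ (L.map a).Pairwise (· ≥ ·) ∧ (L.map a).sum = d := by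
  simp only [sortedLists, mem_biUnion, mem_univ, true_and, mem_letterLists]
  constructor
  · rintro ⟨lam, h⟩
    have h1 : ∀ {ms : List ℕ} {L : List P}, (∀ m ∈ ms, 0 < m) →
        List.Forall₂ (fun p m => p ∈ S m) L ms → (∀ p ∈ L, good p) ∧ L.map a = ms := by
      clear h
      intro ms L hm h
      induction h with
      | nil => simp
      | cons h1 _ ih =>
        rename_i p m L ms _
        have h2 := ih fun m' hm' => hm m' (by simp [hm'])
        have h3 := (ha m (hm m (by simp)) p).1 h1
        refine ⟨fun p' hp' => ?_, by rw [List.map_cons, h2.2, h3.2]⟩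
        rcases List.mem_cons.1 hp' with rfl | hp'
        · exact h3.1
        · exact h2.1 p' hp'
    obtain ⟨h2, h3⟩ := h1 (fun m hm => lam.parts_pos (by rw [← coe_sortedParts]; exact hm)) h
    refine ⟨h2, ?_, ?_⟩
    · rw [h3]
      exact sortedParts_pairwise lam
    · rw [h3, ← Multiset.sum_coe, coe_sortedParts, lam.parts_sum]
  · rintro ⟨h1, h2, h3⟩
    have hp : ∀ m ∈ L.map a, 0 < m := by
      intro m hm
      obtain ⟨p, hp, rfl⟩ := List.mem_map.1 hm
      exact hpos p (h1 p hp)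
    refine ⟨⟨(L.map a : List ℕ), fun {i} hi => hp i (Multiset.mem_coe.1 hi), by simpa using h3⟩, ?_⟩
    have h4 : sortedParts (⟨(L.map a : List ℕ), fun {i} hi => hp i (Multiset.mem_coe.1 hi),
        by simpa using h3⟩ : d.Partition) = L.map a := by
      refine List.Perm.eq_of_pairwise (le := (· ≥ ·)) (fun _ _ _ _ h1 h2 => le_antisymm h2 h1)
        (sortedParts_pairwise _) h2 ?_
      rw [← Multiset.coe_eq_coe, coe_sortedParts]
    rw [h4, List.forall₂_map_right_iff, List.forall₂_same]
    intro p hpL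
    exact (ha _ (hpos p (h1 p hpL)) p).2 ⟨h1 p hpL, rfl⟩

variable {𝕜 B : Type*} [Field 𝕜] [CommRing B] [Algebra 𝕜 B]
  {S : ℕ → Finset P} {a : P → ℕ}

theorem sum_sortedLists_smul (ha : ∀ m, ∀ p ∈ S m, a p = m) (y : P → B) (d : ℕ) (F : List ℕ → 𝕜) :
    ∑ L ∈ sortedLists S d, F (L.map a) • (L.map y).prod = ∑ lam : d.Partition,
      F (sortedParts lam) • ((sortedParts lam).map fun m => ∑ p ∈ S m, y p).prod := by
  rw [sum_sortedLists ha]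
  refine sum_congr rfl fun lam _ => ?_
  rw [← sum_letterLists, smul_sum]
  refine sum_congr rfl fun L hL => ?_
  rw [map_of_mem_letterLists ha hL]

variable [CharZero 𝕜]

theorem coeff_prod_letters (ha : ∀ m, ∀ p ∈ S m, a p = m) (y : P → B) (x : ℕ → 𝕜) (N d : ℕ) :
    PowerSeries.coeff d (∏ k ∈ range N, scale (x k) (onePlus fun m => ∑ p ∈ S m, y p)) =
      ∑ L ∈ sortedLists S d, monomialSum N x (L.map a) • (L.map y).prod := by
  rw [coeff_prod_onePlus, sum_posLists_strictSum, sum_sortedLists_smul ha]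

theorem prod_letters_mul (ha : ∀ m, ∀ p ∈ S m, a p = m) (y : P → B) (x : ℕ → 𝕜) (N : ℕ) :
    (∏ k ∈ range N, scale (x k) (onePlus fun m => ∑ p ∈ S m, y p)) * (PowerSeries.mk fun d =>
      ∑ L ∈ sortedLists S d, ((-1) ^ L.length * forgottenSum N x (L.map a)) • (L.map y).prod) =
      1 := by
  rw [← prod_onePlus_mul (fun m => ∑ p ∈ S m, y p) x N]
  congr 2
  funext d
  rw [sum_posLists_weakSum, ← sum_sortedLists_smul ha y d
    (fun w => (-1) ^ w.length * forgottenSum N x w)]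
  simp

end Letters

end

end QuantumHurwitz

open scoped PowerSeries Polynomial

namespace QuantumHurwitz

noncomputable section

/-! ### Truncated quantum Hurwitz numbers -/

open Equiv Finset
open scoped IsMulCommutative

section Species

variable {n : ℕ}

/-- The profiles of given colength. -/
def profiles (n m : ℕ) : Finset n.Partition := {ρ | colength ρ = m}

theorem colength_of_mem_profiles (m : ℕ) (ρ : n.Partition) (h : ρ ∈ profiles n m) :
    colength ρ = m := (mem_filter.1 h).2

theorem mem_sortedLists_profiles {d : ℕ} {L : List n.Partition} :
    L ∈ sortedLists (profiles n) d ↔ (∀ ρ ∈ L, colength ρ ≠ 0) ∧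
      (L.map colength).Pairwise (· ≥ ·) ∧ (L.map colength).sum = d :=
  mem_sortedLists (good := fun ρ => colength ρ ≠ 0)
    (fun m hm ρ => by
      rw [profiles, mem_filter]
      simp only [mem_univ, true_and]
      exact ⟨fun h => ⟨by omega, h⟩, fun h => h.2⟩)
    (fun ρ h => Nat.pos_of_ne_zero h)

/-- The species of given total colength. -/
def speciesOf (n m : ℕ) : Finset (Species n) := (antidiagonal m).biUnion fun p =>
  sortedLists (profiles n) p.1 ×ˢ sortedLists (profiles n) p.2

theorem mem_speciesOf {m : ℕ} {S : Species n} : S ∈ speciesOf n m ↔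
    ((∀ ρ ∈ S.1 ++ S.2, colength ρ ≠ 0) ∧
      (S.1.map colength).Pairwise (· ≥ ·) ∧ (S.2.map colength).Pairwise (· ≥ ·)) ∧
    S.weight = m := by
  simp only [speciesOf, mem_biUnion, mem_product, mem_sortedLists_profiles,
    HasAntidiagonal.mem_antidiagonal, Prod.exists, List.mem_append, Species.weight]
  constructor
  · rintro ⟨m1, m2, h, ⟨h1, h2, h3⟩, h4, h5, h6⟩
    refine ⟨⟨?_, h2, h5⟩, by omega⟩
    rintro ρ (hρ | hρ)
    · exact h1 ρ hρ
    · exact h4 ρ hρ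
  · rintro ⟨⟨h1, h2, h3⟩, h⟩
    exact ⟨_, _, h, ⟨fun ρ hρ => h1 ρ (Or.inl hρ), h2, rfl⟩, fun ρ hρ => h1 ρ (Or.inr hρ), h3, rfl⟩

theorem weight_of_mem_speciesOf (m : ℕ) (S : Species n) (h : S ∈ speciesOf n m) : S.weight = m :=
  (mem_speciesOf.1 h).2

theorem weight_pos {S : Species n} (h : S.IsAdmissible) : 0 < S.weight := by
  obtain ⟨h1, h2, -⟩ := h
  obtain ⟨ρ, hρ⟩ := List.exists_mem_of_ne_nil _ h2
  have h3 := Nat.pos_of_ne_zero (h1 ρ hρ)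
  have h4 : colength ρ ≤ ((S.1 ++ S.2).map colength).sum :=
    List.single_le_sum (fun _ _ => Nat.zero_le _) _ (List.mem_map_of_mem hρ)
  rw [List.map_append, List.sum_append] at h4
  exact h3.trans_le h4

theorem mem_speciesOf_iff {m : ℕ} (hm : 0 < m) (S : Species n) :
    S ∈ speciesOf n m ↔ S.IsAdmissible ∧ S.weight = m := by
  rw [mem_speciesOf, Species.IsAdmissible]
  refine and_congr_left fun h => ⟨fun h' => ⟨h'.1, ?_, h'.2⟩, fun h' => ⟨h'.1, h'.2.2⟩⟩
  intro h0
  obtain ⟨h1, h2⟩ := List.append_eq_nil_iff.1 h0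
  rw [Species.weight, h1, h2] at h
  simp at h
  omega

theorem sum_speciesOf {B : Type*} [AddCommMonoid B] (m : ℕ) (F : Species n → B) :
    ∑ S ∈ speciesOf n m, F S = ∑ p ∈ antidiagonal m, ∑ L ∈ sortedLists (profiles n) p.1,
      ∑ L' ∈ sortedLists (profiles n) p.2, F (L, L') := by
  rw [speciesOf, sum_biUnion]
  · exact sum_congr rfl fun p _ => sum_product _ _ _
  · intro p _ p' _ hne
    refine disjoint_left.2 fun S h h' => hne ?_
    simp only [mem_product, mem_sortedLists_profiles] at h h'
    exact Prod.ext (h.1.2.2.symm.trans h'.1.2.2) (h.2.2.2.symm.trans h'.2.2.2)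

/-- All configurations of total colength `d`. -/
def allConfigurations (n d : ℕ) : Finset (List (Species n)) := sortedLists (speciesOf n) d

theorem mem_allConfigurations {d : ℕ} {A : List (Species n)} : A ∈ allConfigurations n d ↔
    (∀ S ∈ A, S.IsAdmissible) ∧ (A.map Species.weight).Pairwise (· ≥ ·) ∧
      (A.map Species.weight).sum = d :=
  mem_sortedLists (fun _ hm S => mem_speciesOf_iff hm S) fun _ h => weight_pos h

/-- The total colength of the profiles of class I. -/
def degreeI (A : List (Species n)) : ℕ := (A.map fun S => (S.1.map colength).sum).sum

theorem mem_configurations {d e : ℕ} {A : List (Species n)} :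
    A ∈ configurations n d e ↔ A ∈ allConfigurations n d ∧ degreeI A = e := by
  rw [mem_allConfigurations, configurations, Set.mem_ofPred_eq, degreeI]
  tauto

theorem degreeI_le {d : ℕ} {A : List (Species n)} (h : A ∈ allConfigurations n d) :
    degreeI A ≤ d := by
  rw [← (mem_allConfigurations.1 h).2.2, degreeI]
  exact List.sum_le_sum fun S _ => Nat.le_add_right _ _

end Species

/-! ### The main identity for finite products. -/

section Truncated

variable {𝕜 : Type*} [Field 𝕜] {n : ℕ}

/-- The product `∏_b G(z J_b)` over the Jucys–Murphy elements. -/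
def jmProd (n : ℕ) (G : 𝕜⟦X⟧) : (jmAlg 𝕜 n)⟦X⟧ :=
  ∏ b : Fin n, PowerSeries.rescale (jmC 𝕜 b) (PowerSeries.map (algebraMap 𝕜 (jmAlg 𝕜 n)) G)

theorem jmProd_mul (G G' : 𝕜⟦X⟧) : jmProd n (G * G') = jmProd n G * jmProd n G' := by
  simp [jmProd, prod_mul_distrib]

theorem jmProd_prod {ι : Type*} (s : Finset ι) (G : ι → 𝕜⟦X⟧) :
    jmProd n (∏ i ∈ s, G i) = ∏ i ∈ s, jmProd n (G i) := by
  simp only [jmProd, map_prod]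
  rw [prod_comm]

theorem coeff_jmProd (G : 𝕜⟦X⟧) (d : ℕ) :
    PowerSeries.coeff d (jmProd n G) = jmEval 𝕜 n (weightPoly G d n) := by
  refine Eq.trans ?_ (PowerSeries.coeff_map (jmEval 𝕜 n).toRingHom d _)
  rw [map_prod, jmProd]
  congr 1
  refine prod_congr rfl fun b _ => ?_
  ext k
  simp [PowerSeries.coeff_rescale, mul_comm, jmEval]

theorem scale_scale {B : Type*} [CommRing B] [Algebra 𝕜 B] (a b : 𝕜) (f : B⟦X⟧) :
    scale a (scale b f) = scale (a * b) f := by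
  ext m
  rw [coeff_scale, coeff_scale, coeff_scale, smul_smul, mul_pow]

/-- The generating function of the class sums by colength. -/
def classGen (𝕜 : Type*) [Field 𝕜] (n : ℕ) : (jmAlg 𝕜 n)⟦X⟧ :=
  onePlus fun m => ∑ ρ ∈ profiles n m, classSumC 𝕜 ρ

/-- Jucys' theorem in the commutative subalgebra, rescaled by $-v$. -/
theorem jmProd_linear (v : 𝕜) :
    jmProd n (1 - PowerSeries.C v * PowerSeries.X) = scale (-v) (classGen 𝕜 n) := by
  have h1 : classGen 𝕜 n = PowerSeries.map (jmEval 𝕜 n).toRingHom (elemGen 𝕜 n) := by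
    ext1 m
    rw [classGen, onePlus, PowerSeries.coeff_mk, PowerSeries.coeff_map]
    have h2 : (jmEval 𝕜 n).toRingHom (PowerSeries.coeff m (elemGen 𝕜 n)) =
        ∑ ρ ∈ profiles n m, classSumC 𝕜 ρ := by
      apply Subtype.ext
      refine (jucys_classSum m).trans ?_
      rw [AddSubmonoidClass.coe_finsetSum]
      rfl
    split_ifs with hm
    · subst hm
      rw [coeff_elemGen]
      simp
    · exact h2.symm
  rw [h1, elemGen, map_prod, map_prod, jmProd]
  refine prod_congr rfl fun b _ => ?_
  simp only [map_sub, map_mul, map_one, map_add, PowerSeries.map_C, PowerSeries.map_X,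
    PowerSeries.rescale_X, scale]
  have h3 : ∀ (a : jmAlg 𝕜 n) (r : jmAlg 𝕜 n), PowerSeries.rescale a (PowerSeries.C r) =
      PowerSeries.C r := fun a r => by
    ext m
    rw [PowerSeries.coeff_rescale, PowerSeries.coeff_C]
    split_ifs with h
    · rw [h, pow_zero, one_mul]
    · rw [mul_zero]
  rw [h3, h3]
  simp only [AlgHom.toRingHom_eq_coe, RingHom.coe_coe, map_neg]
  rw [show jmEval 𝕜 n (MvPolynomial.X b) = jmC 𝕜 b by simp [jmEval]]
  ring

variable [CharZero 𝕜]

/-- The generating function of one species, truncated. -/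
theorem scale_mul_scale (q t : 𝕜) (N : ℕ) :
    ∃ T T' : (jmAlg 𝕜 n)⟦X⟧, T = ∏ k ∈ range N, scale (q ^ k) (classGen 𝕜 n) ∧ T * T' = 1 ∧
      scale (-t) T * scale (-1 : 𝕜) T' = onePlus fun m => ∑ S ∈ speciesOf n m,
        ((-t) ^ (S.1.map colength).sum * (monomialSum N (fun k => q ^ k) (S.1.map colength) *
          ((-1) ^ ((S.2.map colength).sum + S.2.length) *
            forgottenSum N (fun k => q ^ k) (S.2.map colength)))) •
          ((S.1.map (classSumC 𝕜)).prod * (S.2.map (classSumC 𝕜)).prod) := by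
  have hinv := prod_letters_mul colength_of_mem_profiles (classSumC 𝕜 (n := n)) (fun k => q ^ k) N
  refine ⟨_, _, rfl, hinv, ?_⟩
  have hT := fun d => coeff_prod_letters colength_of_mem_profiles (classSumC 𝕜 (n := n))
    (fun k => q ^ k) N d
  have hc : ∀ f : (jmAlg 𝕜 n)⟦X⟧, ∀ a : 𝕜,
      PowerSeries.constantCoeff (scale a f) = PowerSeries.constantCoeff f := fun f a => by
    rw [← PowerSeries.coeff_zero_eq_constantCoeff_apply, coeff_scale]
    simp
  ext1 m
  rw [onePlus, PowerSeries.coeff_mk]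
  split_ifs with hm
  · subst hm
    rw [PowerSeries.coeff_zero_eq_constantCoeff_apply, map_mul, hc, hc, ← map_mul]
    exact (congrArg PowerSeries.constantCoeff hinv).trans (map_one _)
  -- Class I comes from $T(-tz)$, with $(-t)$ to the total colength. Class II comes from $T'(-z)$:
  -- the rescaling gives $(-1)^{|\lambda|}$ and the inverse gives one sign per profile, together the
  -- sign of the forgotten functions.
  · rw [PowerSeries.coeff_mul, sum_speciesOf]
    refine sum_congr rfl fun p _ => ?_
    rw [coeff_scale, coeff_scale, classGen, hT, PowerSeries.coeff_mk, smul_sum, smul_sum,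
      sum_mul_sum]
    refine sum_congr rfl fun L hL => sum_congr rfl fun L' hL' => ?_
    rw [smul_smul, smul_smul, smul_mul_smul_comm, (mem_sortedLists_profiles.1 hL).2.2,
      (mem_sortedLists_profiles.1 hL').2.2]
    congr 1
    ring

/-- The scalar factor of a configuration, truncated. -/
def truncatedWeight (q : 𝕜) (c : ℕ → 𝕜) (N : ℕ) (A : List (Species n)) : 𝕜 :=
  (A.map fun S => monomialSum N (fun k => q ^ k) (S.1.map colength) *
    ((-1) ^ ((S.2.map colength).sum + S.2.length) *
      forgottenSum N (fun k => q ^ k) (S.2.map colength))).prod *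
    monomialSum N c (A.map Species.weight)

/-- For fixed `i` the factors combine to the species series in $c_iz$. The hypothesis on `F` is free
of denominators, so it passes through `jmProd`, and $T(-c_iz)$ is then cancelled by its known
inverse. -/
theorem coeff_jmProd_truncated (q t : 𝕜) (c : ℕ → 𝕜) (N d : ℕ) (F : ℕ × ℕ → 𝕜⟦X⟧)
    (hF : ∀ p, F p * (1 - PowerSeries.C (q ^ p.1 * c p.2) * PowerSeries.X) =
      1 - PowerSeries.C (t * q ^ p.1 * c p.2) * PowerSeries.X) :
    PowerSeries.coeff d (jmProd n (∏ i ∈ range N, ∏ k ∈ range N, F (k, i))) =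
      ∑ A ∈ allConfigurations n d, ((-t) ^ degreeI A * truncatedWeight q c N A) •
        ((A.flatMap Prod.fst ++ A.flatMap Prod.snd).map (classSumC 𝕜)).prod := by
  obtain ⟨T, T', hT, hTT, hΨ⟩ := scale_mul_scale (n := n) q t N
  have h1 : ∀ i k, jmProd n (F (k, i)) * scale (-c i) (scale (q ^ k) (classGen 𝕜 n)) =
      scale (-t * c i) (scale (q ^ k) (classGen 𝕜 n)) := by
    intro i k
    have := congrArg (jmProd n) (hF (k, i))
    rw [jmProd_mul, jmProd_linear, jmProd_linear] at this
    rw [scale_scale, scale_scale]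
    convert this using 3 <;> ring_nf
  have h2 : ∀ i, (∏ k ∈ range N, jmProd n (F (k, i))) = scale (c i)
      (scale (-t) T * scale (-1 : 𝕜) T') := by
    intro i
    have h3 : (∏ k ∈ range N, jmProd n (F (k, i))) * scale (-c i) T = scale (-t * c i) T := by
      rw [hT, map_prod, map_prod, ← prod_mul_distrib]
      exact prod_congr rfl fun k _ => h1 i k
    have h4 : scale (-c i) T * scale (-c i) T' = 1 := by rw [← map_mul, hTT, map_one]
    rw [map_mul, scale_scale, scale_scale, mul_neg_one, mul_comm (c i), ← h3, mul_assoc, h4, mul_one]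
  simp_rw [jmProd_prod, h2]
  -- The expansion is applied a second time, now with species as letters and the parameters `c` as
  -- variables.
  rw [hΨ, coeff_prod_letters weight_of_mem_speciesOf]
  refine sum_congr rfl fun A _ => ?_
  have h5 : ∀ A : List (Species n), (A.map fun S : Species n =>
      ((-t) ^ (S.1.map colength).sum * (monomialSum N (fun k => q ^ k) (S.1.map colength) *
          ((-1) ^ ((S.2.map colength).sum + S.2.length) *
            forgottenSum N (fun k => q ^ k) (S.2.map colength)))) •
          ((S.1.map (classSumC 𝕜)).prod * (S.2.map (classSumC 𝕜)).prod)).prod =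
      ((-t) ^ degreeI A * (A.map fun S => monomialSum N (fun k => q ^ k) (S.1.map colength) *
        ((-1) ^ ((S.2.map colength).sum + S.2.length) *
          forgottenSum N (fun k => q ^ k) (S.2.map colength))).prod) •
        ((A.flatMap Prod.fst ++ A.flatMap Prod.snd).map (classSumC 𝕜)).prod := by
    intro A
    induction A with
    | nil => simp [degreeI]
    | cons S A ih =>
      rw [List.map_cons, List.prod_cons, ih, smul_mul_smul_comm, degreeI, degreeI]
      simp only [List.map_cons, List.sum_cons, List.prod_cons, List.flatMap_cons, List.map_append,
        List.prod_append, pow_add]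
      congr 1
      · ring
      · ring
  rw [h5, smul_smul, truncatedWeight]
  congr 1
  ring

/-- The truncated form of the main identity. -/
theorem classPairing_truncated (q t : 𝕜) (c : ℕ → 𝕜) (N d : ℕ) (F : ℕ × ℕ → 𝕜⟦X⟧)
    (hF : ∀ p, F p * (1 - PowerSeries.C (q ^ p.1 * c p.2) * PowerSeries.X) =
      1 - PowerSeries.C (t * q ^ p.1 * c p.2) * PowerSeries.X) (μ ν : n.Partition) :
    (n.factorial : 𝕜)⁻¹ * classPairing 𝕜 μ ν
      (jmHom 𝕜 n (weightPoly (∏ i ∈ range N, ∏ k ∈ range N, F (k, i)) d n)) =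
      ∑ A ∈ allConfigurations n d, (-t) ^ degreeI A * truncatedWeight q c N A *
        (hurwitz (A.flatMap Prod.fst ++ A.flatMap Prod.snd ++ [μ, ν]) : 𝕜) := by
  have hn : (n.factorial : 𝕜) ≠ 0 := Nat.cast_ne_zero.2 n.factorial_ne_zero
  have h1 := congrArg (jmAlg 𝕜 n).val (coeff_jmProd_truncated (n := n) q t c N d F hF)
  rw [coeff_jmProd] at h1
  change jmHom 𝕜 n _ = _ at h1
  rw [h1, map_sum, map_sum, mul_sum]
  refine sum_congr rfl fun A _ => ?_
  rw [map_smul, map_smul, map_list_prod, List.map_map]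
  have h2 := factorial_mul_hurwitz_append (𝕜 := 𝕜) (A.flatMap Prod.fst ++ A.flatMap Prod.snd) μ ν
  have h3 : ((jmAlg 𝕜 n).val ∘ classSumC 𝕜 : n.Partition → GroupAlg 𝕜 n) = classSum 𝕜 := rfl
  rw [h3, ← h2, smul_eq_mul, mul_left_comm, inv_mul_cancel_left₀ hn]

end Truncated

end

end QuantumHurwitz

open scoped PowerSeries Polynomial

namespace QuantumHurwitz

noncomputable section

/-! ### Convergence -/

open Equiv Finset
open scoped IsMulCommutative
open Filter Topology

section Summability

/-- Each $f_i$ is at most the total sum $s$, so $f_i^{k+1}\le s^kf_i$. -/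
theorem summable_pow {ι : Type*} {f : ι → ℝ} (h0 : ∀ i, 0 ≤ f i) (hf : Summable f) {k : ℕ}
    (hk : k ≠ 0) : Summable fun i => f i ^ k := by
  obtain ⟨k, rfl⟩ := Nat.exists_eq_succ_of_ne_zero hk
  refine Summable.of_nonneg_of_le (fun i => pow_nonneg (h0 i) _) (fun i => ?_)
    (hf.mul_left ((∑' i, f i) ^ k))
  rw [pow_succ]
  gcongr
  · exact h0 i
  · exact h0 i
  · exact hf.le_tsum i fun j _ => h0 j

theorem summable_prod_fin {r : ℕ} {g : Fin r → ℕ → ℝ} (h0 : ∀ u i, 0 ≤ g u i)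
    (hg : ∀ u, Summable (g u)) : Summable fun i : Fin r → ℕ => ∏ u, g u (i u) := by
  induction r with
  | zero => exact Summable.of_finite
  | succ r ih =>
    rw [← (Fin.consEquiv fun _ => ℕ).summable_iff]
    have h := Summable.mul_of_nonneg (hg 0) (ih (g := fun u => g u.succ) (fun u => h0 _)
      fun u => hg _) (h0 0) fun i => prod_nonneg fun u _ => h0 _ _
    refine h.congr fun p => ?_
    simp [Fin.prod_univ_succ, Fin.consEquiv_apply]

variable {𝕜 : Type*} [NormedField 𝕜] [CompleteSpace 𝕜]

theorem summable_prod_pow {x : ℕ → 𝕜} (hx : Summable fun i => ‖x i‖) {r : ℕ} {w : Fin r → ℕ}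
    (hw : ∀ u, w u ≠ 0) : Summable fun i : Fin r → ℕ => ∏ u, x (i u) ^ w u := by
  refine Summable.of_norm ((summable_prod_fin (g := fun u i => ‖x i‖ ^ w u)
    (fun u i => by positivity) fun u => summable_pow (fun i => norm_nonneg _) hx (hw u)).congr ?_)
  intro i
  simp [norm_prod, norm_pow]

/-- Sums over index sequences with a given property are limits of finite sums. -/
theorem tendsto_sum_pi {x : ℕ → 𝕜} (hx : Summable fun i => ‖x i‖) {r : ℕ} {w : Fin r → ℕ}
    (hw : ∀ u, w u ≠ 0) (p : (Fin r → ℕ) → Prop) [DecidablePred p] :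
    Tendsto (fun N => ∑ i ∈ Fintype.piFinset (fun _ : Fin r => range N) with p i,
      ∏ u, x (i u) ^ w u) atTop (𝓝 (∑' i : {i : Fin r → ℕ // p i}, ∏ u, x (i.1 u) ^ w u)) := by
  have h1 : HasSum (fun i : {i : Fin r → ℕ // p i} => ∏ u, x (i.1 u) ^ w u) _ :=
    ((summable_prod_pow hx hw).subtype {i | p i}).hasSum
  have h2 : Tendsto (fun N : ℕ => (Fintype.piFinset fun _ : Fin r => range N).subtype p)
      atTop atTop := by
    refine tendsto_atTop_finset_of_monotone (fun N N' h => subtype_mono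
      (Fintype.piFinset_subset _ _ fun _ => range_subset_range.2 h)) fun i => ?_
    refine ⟨univ.sup i.1 + 1, ?_⟩
    rw [mem_subtype, Fintype.mem_piFinset]
    exact fun u => mem_range.2 (Nat.lt_succ_of_le (le_sup (mem_univ u)))
  refine (h1.comp h2).congr fun N => ?_
  exact sum_subtype_eq_sum_filter (f := fun i : Fin r → ℕ => ∏ u, x (i u) ^ w u)

theorem strictSum_eq {R : Type*} [CommSemiring R] (N : ℕ) (x : ℕ → R) {r : ℕ} (w : Fin r → ℕ) :
    strictSum N x w = ∑ i ∈ Fintype.piFinset (fun _ : Fin r => range N) with StrictMono i,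
      ∏ u, x (i u) ^ w u.rev := by
  refine sum_nbij' (fun i => i ∘ Fin.rev) (fun i => i ∘ Fin.rev) ?_ ?_ ?_ ?_ ?_
  · intro i hi
    simp only [mem_filter, Fintype.mem_piFinset] at hi ⊢
    exact ⟨fun u => hi.1 _, hi.2.comp Fin.rev_strictAnti⟩
  · intro i hi
    simp only [mem_filter, Fintype.mem_piFinset] at hi ⊢
    exact ⟨fun u => hi.1 _, hi.2.comp_strictAnti Fin.rev_strictAnti⟩
  · intro i _
    funext u
    simp
  · intro i _
    funext u
    simp
  · intro i _
    rw [← Equiv.prod_comp Fin.revPerm]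
    simp

theorem weakSum_eq {R : Type*} [CommSemiring R] (N : ℕ) (x : ℕ → R) {r : ℕ} (w : Fin r → ℕ) :
    weakSum N x w = ∑ i ∈ Fintype.piFinset (fun _ : Fin r => range N) with Monotone i,
      ∏ u, x (i u) ^ w u.rev := by
  refine sum_nbij' (fun i => i ∘ Fin.rev) (fun i => i ∘ Fin.rev) ?_ ?_ ?_ ?_ ?_
  · intro i hi
    simp only [mem_filter, Fintype.mem_piFinset] at hi ⊢
    exact ⟨fun u => hi.1 _, hi.2.comp Fin.rev_anti⟩
  · intro i hi
    simp only [mem_filter, Fintype.mem_piFinset] at hi ⊢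
    exact ⟨fun u => hi.1 _, hi.2.comp_antitone Fin.rev_anti⟩
  · intro i _
    funext u
    simp
  · intro i _
    funext u
    simp
  · intro i _
    rw [← Equiv.prod_comp Fin.revPerm]
    simp

theorem tendsto_monomialSum {x : ℕ → 𝕜} (hx : Summable fun i => ‖x i‖) {a : List ℕ}
    (ha : ∀ m ∈ a, m ≠ 0) :
    Tendsto (fun N => monomialSum N x a) atTop (𝓝 (monomialSym x a)) := by
  have h1 : monomialSym x a = (autOrder a : 𝕜)⁻¹ * ∑ σ : Perm (Fin a.length),
      ∑' i : {i : Fin a.length → ℕ // StrictMono i}, ∏ u, x (i.1 u) ^ a.get (σ u.rev) := by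
    -- The finite sums use decreasing indices, the definition increasing ones; the reversal is
    -- absorbed into the sum over `σ`.
    rw [monomialSym, ← Equiv.sum_comp (Equiv.mulRight Fin.revPerm)]
    rfl
  rw [h1]
  refine Tendsto.const_mul _ (tendsto_finsetSum _ fun σ _ => ?_)
  simp_rw [strictSum_eq]
  exact tendsto_sum_pi hx (w := fun u => a.get (σ u.rev)) (fun u => ha _ (List.get_mem _ _)) _

theorem tendsto_forgottenSum {x : ℕ → 𝕜} (hx : Summable fun i => ‖x i‖) {a : List ℕ}
    (ha : ∀ m ∈ a, m ≠ 0) :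
    Tendsto (fun N => (-1) ^ (a.sum + a.length) * forgottenSum N x a) atTop
      (𝓝 (forgottenSym x a)) := by
  have h1 : forgottenSym x a = (-1) ^ (a.sum + a.length) * ((autOrder a : 𝕜)⁻¹ *
      ∑ σ : Perm (Fin a.length),
        ∑' i : {i : Fin a.length → ℕ // Monotone i}, ∏ u, x (i.1 u) ^ a.get (σ u.rev)) := by
    rw [forgottenSym, ← Equiv.sum_comp (Equiv.mulRight Fin.revPerm), mul_assoc]
    congr 1
    -- The exponent in `forgottenSym` is a natural subtraction; since all parts are positive it does
    -- not truncate and has the parity of the sum.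
    have h2 : a.length ≤ a.sum := by
      have := List.card_nsmul_le_sum a 1 fun m hm => Nat.one_le_iff_ne_zero.2 (ha m hm)
      simpa using this
    have h3 : a.sum + a.length = a.sum - a.length + 2 * a.length := by omega
    rw [h3, pow_add, pow_mul, neg_one_sq, one_pow, mul_one]
  rw [h1]
  refine Tendsto.const_mul _ (Tendsto.const_mul _ (tendsto_finsetSum _ fun σ _ => ?_))
  simp_rw [weakSum_eq]
  exact tendsto_sum_pi hx (w := fun u => a.get (σ u.rev)) (fun u => ha _ (List.get_mem _ _)) _

end Summability

/-! ### Convergence of the weight generating function. -/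

section Macdonald

variable {𝕜 : Type*} [NormedField 𝕜]

theorem one_sub_mul_inv (v : 𝕜) : (1 - PowerSeries.C v * PowerSeries.X) *
    (1 - PowerSeries.C v * PowerSeries.X : 𝕜⟦X⟧)⁻¹ = 1 := by
  refine PowerSeries.mul_inv_cancel _ ?_
  simp

theorem inv_one_sub (v : 𝕜) : (1 - PowerSeries.C v * PowerSeries.X : 𝕜⟦X⟧)⁻¹ =
    PowerSeries.mk fun k => v ^ k := by
  have h := mk_pow_mul v
  calc (1 - PowerSeries.C v * PowerSeries.X : 𝕜⟦X⟧)⁻¹ = (PowerSeries.mk fun k => v ^ k) *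
        ((1 - PowerSeries.C v * PowerSeries.X) * (1 - PowerSeries.C v * PowerSeries.X)⁻¹) := by
        rw [← mul_assoc, h, one_mul]
    _ = _ := by rw [one_sub_mul_inv, mul_one]

theorem macdonaldFactor_mul (q t : 𝕜) (c : ℕ → 𝕜) (p : ℕ × ℕ) : macdonaldFactor q t c p *
    (1 - PowerSeries.C (q ^ p.1 * c p.2) * PowerSeries.X) =
      1 - PowerSeries.C (t * q ^ p.1 * c p.2) * PowerSeries.X := by
  rw [macdonaldFactor, mul_assoc, mul_comm _⁻¹, one_sub_mul_inv, mul_one]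

theorem macdonaldFactor_eq (q t : 𝕜) (c : ℕ → 𝕜) (p : ℕ × ℕ) : macdonaldFactor q t c p =
    1 + PowerSeries.C ((1 - t) * (q ^ p.1 * c p.2)) * PowerSeries.X *
      PowerSeries.mk fun k => (q ^ p.1 * c p.2) ^ k := by
  have h := one_sub_mul_inv (q ^ p.1 * c p.2)
  rw [macdonaldFactor, inv_one_sub] at *
  simp only [map_mul, map_sub, map_one, mul_assoc t] at *
  linear_combination h

/-- A crude bound: each multiplication by a geometric series has at most $m+1$ terms in degree $m$.
-/
theorem norm_coeff_prod_geometric {ι : Type*} (v : ι → 𝕜) {K : ℝ} (hK0 : 0 ≤ K) (hK : ∀ i, ‖v i‖ ≤ K)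
    (s : Finset ι) (m : ℕ) :
    ‖PowerSeries.coeff m (∏ i ∈ s, PowerSeries.mk fun k => v i ^ k)‖ ≤
      ((m : ℝ) + 1) ^ #s * K ^ m := by
  classical
  induction s using Finset.induction_on generalizing m with
  | empty =>
    rw [prod_empty, card_empty, pow_zero, one_mul, PowerSeries.coeff_one]
    split_ifs with h
    · simp [h]
    · rw [norm_zero]
      positivity
  | insert a s ha ih =>
    rw [prod_insert ha, card_insert_of_notMem ha, PowerSeries.coeff_mul]
    refine (norm_sum_le _ _).trans ?_
    have h1 : ∀ p ∈ antidiagonal m, ‖PowerSeries.coeff p.1 (PowerSeries.mk fun k => v a ^ k) *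
        PowerSeries.coeff p.2 (∏ i ∈ s, PowerSeries.mk fun k => v i ^ k)‖ ≤
        ((m : ℝ) + 1) ^ #s * K ^ m := by
      intro p hp
      have h2 : p.1 + p.2 = m := HasAntidiagonal.mem_antidiagonal.1 hp
      have h3 : (p.2 : ℝ) ≤ m := by exact_mod_cast (by omega : p.2 ≤ m)
      rw [norm_mul, PowerSeries.coeff_mk, norm_pow]
      calc ‖v a‖ ^ p.1 * _ ≤ K ^ p.1 * (((p.2 : ℝ) + 1) ^ #s * K ^ p.2) := by
            gcongr
            · exact hK a
            · exact ih p.2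
        _ = ((p.2 : ℝ) + 1) ^ #s * K ^ m := by rw [← h2, pow_add]; ring
        _ ≤ _ := by gcongr
    refine (sum_le_card_nsmul _ _ _ h1).trans ?_
    rw [Nat.card_antidiagonal, nsmul_eq_mul, pow_succ]
    push_cast
    apply le_of_eq
    ring

theorem summable_norm_parameters {q : 𝕜} (hq : ‖q‖ < 1) {c : ℕ → 𝕜}
    (hc : Summable fun i => ‖c i‖) : Summable fun p : ℕ × ℕ => ‖q ^ p.1 * c p.2‖ := by
  have h := Summable.mul_of_nonneg (summable_geometric_of_lt_one (norm_nonneg q) hq) hc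
    (fun k => pow_nonneg (norm_nonneg q) k) fun i => norm_nonneg _
  refine h.congr fun p => ?_
  rw [norm_mul, norm_pow]

variable [CompleteSpace 𝕜]

/-- Expand the product over finite sets $s$ of indices. Each factor minus 1 is divisible by $z$, so
in degree $d$ only $|s|\le d$ matters, and the coefficient is at most a constant depending on $d$
times $\prod_{p\in s}\|(1-t)v_p\|$, which is summable over $s$. -/
theorem macdonaldConverges {q : 𝕜} (hq : ‖q‖ < 1) {c : ℕ → 𝕜} (hc : Summable fun i => ‖c i‖)
    (t : 𝕜) : MacdonaldConverges q t c := by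
  open scoped PowerSeries.WithPiTopology in
  have hv := summable_norm_parameters hq hc
  set v : ℕ × ℕ → 𝕜 := fun p => q ^ p.1 * c p.2 with hvdef
  have h1 : macdonaldFactor q t c = fun p => 1 + PowerSeries.C ((1 - t) * v p) * PowerSeries.X *
      PowerSeries.mk fun k => v p ^ k := funext fun p => macdonaldFactor_eq q t c p
  rw [MacdonaldConverges, h1]
  refine multipliable_one_add_of_summable_prod ?_
  rw [PowerSeries.WithPiTopology.summable_iff_summable_coeff]
  intro d
  -- The maximum with 1 makes the powers of `K` increase, so the bound becomes independent of the
  -- size of the set.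
  set K : ℝ := max 1 (∑' p, ‖v p‖) with hKdef
  have hK1 : 1 ≤ K := le_max_left _ _
  have hK : ∀ p, ‖v p‖ ≤ K := fun p =>
    (hv.le_tsum p fun _ _ => norm_nonneg _).trans (le_max_right _ _)
  have h2 := summable_finsetProd_of_summable_nonneg (f := fun p => ‖(1 - t) * v p‖)
    (fun p => norm_nonneg _) ((hv.mul_left ‖1 - t‖).congr fun p => (norm_mul _ _).symm)
  refine Summable.of_norm_bounded (h2.mul_right (((d : ℝ) + 1) ^ d * K ^ d)) fun s => ?_
  rw [prod_mul_distrib, prod_mul_distrib, prod_const, ← map_prod, mul_assoc, PowerSeries.coeff_C_mul,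
    norm_mul, norm_prod]
  gcongr
  rw [PowerSeries.coeff_X_pow_mul']
  split_ifs with hs
  · refine (norm_coeff_prod_geometric v (zero_le_one.trans hK1) hK s (d - #s)).trans ?_
    have h3 : ((d - #s : ℕ) : ℝ) ≤ d := by exact_mod_cast Nat.sub_le _ _
    calc (((d - #s : ℕ) : ℝ) + 1) ^ #s * K ^ (d - #s) ≤ ((d : ℝ) + 1) ^ #s * K ^ (d - #s) := by
          gcongr
      _ ≤ ((d : ℝ) + 1) ^ d * K ^ d := by
          gcongr
          · have : (0 : ℝ) ≤ d := Nat.cast_nonneg d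
            linarith
          · exact Nat.sub_le _ _
  · rw [norm_zero]
    positivity

theorem tendsto_coeff_macdonald {q : 𝕜} (hq : ‖q‖ < 1) {c : ℕ → 𝕜}
    (hc : Summable fun i => ‖c i‖) (t : 𝕜) (d : ℕ) :
    Tendsto (fun N => PowerSeries.coeff d
      (∏ i ∈ range N, ∏ k ∈ range N, macdonaldFactor q t c (k, i))) atTop
      (𝓝 (PowerSeries.coeff d (macdonaldWeight q t c))) := by
  open scoped PowerSeries.WithPiTopology in
  have h1 : HasProd (macdonaldFactor q t c) (macdonaldWeight q t c) :=
    (macdonaldConverges hq hc t).hasProd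
  have h2 : Tendsto (fun N : ℕ => range N ×ˢ range N) atTop atTop := by
    refine tendsto_atTop_finset_of_monotone (fun N N' h => product_subset_product
      (range_subset_range.2 h) (range_subset_range.2 h)) fun p => ⟨p.1 + p.2 + 1, ?_⟩
    rw [mem_product, mem_range, mem_range]
    omega
  have h3 := ((PowerSeries.WithPiTopology.continuous_coeff (R := 𝕜) d).tendsto _).comp (h1.comp h2)
  refine h3.congr fun N => ?_
  simp only [Function.comp_apply]
  rw [prod_product_right]

theorem coeff_zero_macdonald {q : 𝕜} (hq : ‖q‖ < 1) {c : ℕ → 𝕜}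
    (hc : Summable fun i => ‖c i‖) (t : 𝕜) :
    PowerSeries.coeff 0 (macdonaldWeight q t c) = 1 := by
  refine tendsto_nhds_unique (tendsto_coeff_macdonald hq hc t 0) ?_
  have h : ∀ p, PowerSeries.constantCoeff (macdonaldFactor q t c p) = 1 := fun p => by
    rw [macdonaldFactor_eq]
    simp
  simp only [PowerSeries.coeff_zero_eq_constantCoeff_apply, map_prod, h, prod_const_one]
  exact tendsto_const_nhds

end Macdonald

/-! ### Passage to the limit. -/

section Main

variable {𝕜 : Type*} [NormedField 𝕜]

/-- The pairing is a polynomial in finitely many coefficients of the weight series, hence continuous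
for coefficientwise convergence. -/
theorem tendsto_classPairing {n : ℕ} (d : ℕ) (μ ν : n.Partition) {G : ℕ → 𝕜⟦X⟧} {G' : 𝕜⟦X⟧}
    (h : ∀ d, Tendsto (fun N => PowerSeries.coeff d (G N)) atTop (𝓝 (PowerSeries.coeff d G'))) :
    Tendsto (fun N => classPairing 𝕜 μ ν (jmHom 𝕜 n (weightPoly (G N) d n))) atTop
      (𝓝 (classPairing 𝕜 μ ν (jmHom 𝕜 n (weightPoly G' d n)))) := by
  simp_rw [jmHom_weightPoly, map_sum, map_smul, smul_eq_mul]
  refine tendsto_finsetSum _ fun b _ => Tendsto.mul_const _ ?_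
  exact tendsto_finsetProd _ fun x _ => h _

theorem geometricHurwitz_eq (q : 𝕜) (c : ℕ → 𝕜) (d e : ℕ) {n : ℕ} (μ ν : n.Partition) :
    geometricHurwitz q c d e μ ν = ∑ A ∈ allConfigurations n d with degreeI A = e, weightQ q c A *
      (hurwitz (A.flatMap Prod.fst ++ A.flatMap Prod.snd ++ [μ, ν]) : 𝕜) := by
  rw [geometricHurwitz]
  refine finsum_mem_eq_sum_of_inter_support_eq _ ?_
  congr 1
  ext A
  rw [mem_configurations, mem_coe, mem_filter]

theorem geometricHurwitz_eq_zero (q : 𝕜) (c : ℕ → 𝕜) {d e : ℕ} (h : d < e) {n : ℕ}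
    (μ ν : n.Partition) : geometricHurwitz q c d e μ ν = 0 := by
  rw [geometricHurwitz_eq, filter_false_of_mem, sum_empty]
  intro A hA hd
  have := degreeI_le hA
  omega

variable [CompleteSpace 𝕜]

/-- Admissibility makes all exponents positive, so the sums over indices converge absolutely; the
convergence is then taken factor by factor. -/
theorem tendsto_truncatedWeight {q : 𝕜} (hq : ‖q‖ < 1) {c : ℕ → 𝕜}
    (hc : Summable fun i => ‖c i‖) {n d : ℕ} {A : List (Species n)}
    (hA : A ∈ allConfigurations n d) :
    Tendsto (fun N => truncatedWeight q c N A) atTop (𝓝 (weightQ q c A)) := by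
  have hadm := (mem_allConfigurations.1 hA).1
  have hgeom : Summable fun i : ℕ => ‖q ^ i‖ := by
    simpa only [norm_pow] using summable_geometric_of_lt_one (norm_nonneg q) hq
  refine Tendsto.mul (tendsto_list_prod A fun S hS => Tendsto.mul ?_ ?_)
    (tendsto_monomialSum hc ?_)
  · refine tendsto_monomialSum hgeom fun m hm => ?_
    obtain ⟨ρ, hρ, rfl⟩ := List.mem_map.1 hm
    exact (hadm S hS).1 ρ (List.mem_append_left _ hρ)
  · have h := tendsto_forgottenSum hgeom (a := S.2.map colength) fun m hm => by
      obtain ⟨ρ, hρ, rfl⟩ := List.mem_map.1 hm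
      exact (hadm S hS).1 ρ (List.mem_append_right _ hρ)
    rwa [List.length_map] at h
  · intro m hm
    obtain ⟨S, hS, rfl⟩ := List.mem_map.1 hm
    exact (weight_pos (hadm S hS)).ne'

variable [CharZero 𝕜]

/-- Both sides of the truncated identity converge, and limits are unique. -/
theorem classPairing_macdonald {q : 𝕜} (hq : ‖q‖ < 1) {c : ℕ → 𝕜}
    (hc : Summable fun i => ‖c i‖) (t : 𝕜) {n : ℕ} (d : ℕ) (μ ν : n.Partition) :
    (n.factorial : 𝕜)⁻¹ *
      classPairing 𝕜 μ ν (jmHom 𝕜 n (weightPoly (macdonaldWeight q t c) d n)) =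
      ∑ A ∈ allConfigurations n d, (-t) ^ degreeI A * weightQ q c A *
        (hurwitz (A.flatMap Prod.fst ++ A.flatMap Prod.snd ++ [μ, ν]) : 𝕜) := by
  have h1 := (tendsto_classPairing d μ ν (tendsto_coeff_macdonald hq hc t)).const_mul
    (n.factorial : 𝕜)⁻¹
  refine tendsto_nhds_unique h1 ?_
  simp_rw [classPairing_truncated q t c _ d (macdonaldFactor q t c) (macdonaldFactor_mul q t c) μ ν]
  refine tendsto_finsetSum _ fun A hA => Tendsto.mul_const _ (Tendsto.const_mul _ ?_)
  exact tendsto_truncatedWeight hq hc hA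

theorem classPairing_eq_geometricHurwitz {q : 𝕜} (hq : ‖q‖ < 1) {c : ℕ → 𝕜}
    (hc : Summable fun i => ‖c i‖) (t : 𝕜) {n : ℕ} (d : ℕ) (μ ν : n.Partition) :
    (n.factorial : 𝕜)⁻¹ *
      classPairing 𝕜 μ ν (jmHom 𝕜 n (weightPoly (macdonaldWeight q t c) d n)) =
      ∑ e ∈ range (d + 1), geometricHurwitz q c d e μ ν * (-t) ^ e := by
  rw [classPairing_macdonald hq hc,
    ← sum_fiberwise_of_maps_to (t := range (d + 1)) (g := degreeI) fun A hA =>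
      mem_range.2 (Nat.lt_succ_of_le (degreeI_le hA))]
  refine sum_congr rfl fun e _ => ?_
  rw [geometricHurwitz_eq, sum_mul]
  refine sum_congr rfl fun A hA => ?_
  rw [(mem_filter.1 hA).2]
  ring

theorem combinatorialHurwitz_macdonald {q : 𝕜} (hq : ‖q‖ < 1) {c : ℕ → 𝕜}
    (hc : Summable fun i => ‖c i‖) (t : 𝕜) {n : ℕ} (d : ℕ) (μ ν : n.Partition) :
    combinatorialHurwitz (macdonaldWeight q t c) d μ ν =
      ∑ e ∈ range (d + 1), geometricHurwitz q c d e μ ν * (-t) ^ e := by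
  rw [combinatorialHurwitz_eq _ (coeff_zero_macdonald hq hc t),
    classPairing_eq_geometricHurwitz hq hc]

end Main

end

end QuantumHurwitz

theorem mainTheorem6 {𝕜 : Type*} [NormedField 𝕜] [CompleteSpace 𝕜] [CharZero 𝕜]
    (q : 𝕜) (hq : ‖q‖ < 1) (c : ℕ → 𝕜) (hc : Summable fun i => ‖c i‖) :
    (∀ t : 𝕜, QuantumHurwitz.MacdonaldConverges q t c) ∧
    (∀ (n d : ℕ) (μ ν : n.Partition), ∃ P : 𝕜[X], P.natDegree ≤ d ∧
      (∀ e : ℕ, P.coeff e = (-1) ^ e * QuantumHurwitz.geometricHurwitz q c d e μ ν) ∧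
      ∀ t : 𝕜, QuantumHurwitz.combinatorialHurwitz (QuantumHurwitz.macdonaldWeight q t c) d μ ν =
        P.eval t) ∧
    (∀ (n d : ℕ) (μ ν : n.Partition) (t : 𝕜),
      QuantumHurwitz.combinatorialHurwitz (QuantumHurwitz.macdonaldWeight q t c) d μ ν =
        ∑ e ∈ Finset.range (d + 1), QuantumHurwitz.geometricHurwitz q c d e μ ν * (-t) ^ e) ∧
    ∀ t : 𝕜, QuantumHurwitz.tau (QuantumHurwitz.macdonaldWeight q t c) =
      QuantumHurwitz.formalSum fun x : (Σ n : ℕ, n.Partition × n.Partition) =>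
        MvPowerSeries.C (PowerSeries.mk fun d => ∑ e ∈ Finset.range (d + 1),
          QuantumHurwitz.geometricHurwitz q c d e x.2.1 x.2.2 * (-t) ^ e) *
        QuantumHurwitz.powerSum (QuantumHurwitz.tVar 𝕜) x.2.1 *
        QuantumHurwitz.powerSum (QuantumHurwitz.sVar 𝕜) x.2.2 := by
  refine ⟨QuantumHurwitz.macdonaldConverges hq hc, fun n d μ ν => ?_, fun n d μ ν t =>
    QuantumHurwitz.combinatorialHurwitz_macdonald hq hc t d μ ν, fun t => ?_⟩
  · refine ⟨∑ e ∈ Finset.range (d + 1), Polynomial.monomial e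
      ((-1) ^ e * QuantumHurwitz.geometricHurwitz q c d e μ ν), ?_, fun e => ?_, fun t => ?_⟩
    · refine Polynomial.natDegree_sum_le_of_forall_le _ _ fun e he => ?_
      exact (Polynomial.natDegree_monomial_le _).trans (Nat.lt_succ_iff.1 (Finset.mem_range.1 he))
    · rw [Polynomial.finsetSum_coeff]
      simp_rw [Polynomial.coeff_monomial]
      rw [Finset.sum_ite_eq']
      split_ifs with he
      · rfl
      -- For `e > d` there is no configuration, since class I is part of the total colength.
      · rw [QuantumHurwitz.geometricHurwitz_eq_zero q c (by simpa using he), mul_zero]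
    · rw [QuantumHurwitz.combinatorialHurwitz_macdonald hq hc, Polynomial.eval_finsetSum]
      refine Finset.sum_congr rfl fun e _ => ?_
      rw [Polynomial.eval_monomial, neg_pow]
      ring
  · rw [QuantumHurwitz.tau_eq]
    simp_rw [QuantumHurwitz.classPairing_eq_geometricHurwitz hq hc]
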